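/- Let $\mathcal X=\{1,2,3,4\}$, write $i\equiv j$ if $i,j$ both lie in $\{1,2\}$ or both lie in $\{3,4\}$, and put $\alpha(n)=(-1)^n$. Let $0<\delta<1$ and let $h_+,h_-:[0,\infty)\to[0,\infty)$ be bounded and continuously differentiable with $h_+ + h_->0$ everywhere and $\int_0^\infty h_\pm(v)\,dv=\infty$. For each $s\ge 0$ let $H_+(s),H_-(s)\subset\mathbb R$ be disjoint left-closed right-open intervals of lengths $h_+(s),h_-(s)$, depending measurably on $s$, and put $H(s)=H_+(s)\cup H_-(s)$. For $i\not\equiv j$ let $(h_{ij},H_{ij})$ be $(h_+,H_+)$ if $i+j$ is even and $(h_-,H_-)$ if $i+j$ is odd. Let $$g_1(i,s,z)=s\,1_{H(s)}(z),\quad g_2(i,s,z)=\sum_{j\not\equiv i}(j-i)1_{H_{ij}(s)}(z),\quad g_3(i,s,z)=\sum_{j\not\equiv i}\delta\alpha(j)1_{H_{ij}(s)}(z).$$ On a filtered probability space $(\Omega,\mathscr F,(\mathscr F_t)_{t\ge0},\mathbb P)$ let $\wp$ be a Poisson random measure on $[0,\infty)\times\mathbb R$ with Lebesgue intensity, relative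 to $(\mathscr F_t)$ (its restriction to $[0,t]\times\mathbb R$ is $\mathscr F_t$-measurable and its restriction to $(t,\infty)\times\mathbb R$ is independent of $\mathscr F_t$). Let $(P,I,S)$ be an adapted càdlàg process with values in $[0,\infty)\times\mathcal X\times[0,\infty)$ such that, almost surely for all $t\ge 0$, $$S_t=S_0+t-\int_{(0,t]\times\mathbb R}g_1(I_{v-},S_{v-},z)\,\wp(dv,dz),\quad I_t=I_0+\int_{(0,t]\times\mathbb R}g_2(I_{v-},S_{v-},z)\,\wp(dv,dz),$$ $$P_t=P_0+\int_{(0,t]\times\mathbb R}P_{v-}\,g_3(I_{v-},S_{v-},z)\,\wp(dv,dz),$$ where $P_0,I_0,S_0$ are independent, their laws have full support in $[0,\infty)$, $\mathcal X$, $[0,\infty)$ respectively, and $E[P_0]<\infty$. Fix $T>0$ and let $\mathcal D=[0,T]\times[0,\infty)\times\mathcal X\times[0,\infty)$ and $\mathcal D^{\rm o}=(0,T)\times(0,\infty)\times\mathcal X\times(0,\infty)$. Let $V$ be the set of continuous $\phi:\mathcal D\to\mathbb R$ with $\sup_{\mathcal D}|\phi(t,p,i,s)|/(1+p)<\infty$.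 For $A\subseteq\mathcal D$, $C^{1,1}(A)$ denotes the functions whose partial derivatives in $t$ and in $s$ exist on $A$ (one-sided at the boundary of $\mathcal D$) and are continuous on $A$. Then $E[P_T]<\infty$, and there is exactly one continuous function $\pi:\mathcal D\to\mathbb R$ that is a version of $$\pi(t,p,i,s)=E[P_T\mid P_t=p,\,I_t=i,\,S_t=s],$$ that is, $\pi(t,P_t,I_t,S_t)=E[P_T\mid P_t,I_t,S_t]$ almost surely for every $t\in[0,T]$. This $\pi$ belongs to $V\cap C^{1,1}(\mathcal D)$ and satisfies $$\frac{\partial\pi}{\partial t}+\frac{\partial\pi}{\partial s}+\sum_{j\not\equiv i}h_{ij}(s)\bigl(\pi(t,p(1+\delta\alpha(j)),j,0)-\pi(t,p,i,s)\bigr)=0\quad\text{on }\mathcal D,\qquad \pi(T,p,i,s)=p .$$ It is the unique solution: every $\phi\in V\cap C^{1,1}(\mathcal D^{\rm o})$ that satisfies the equation on $\mathcal D^{\rm o}$ and $\phi(T,p,i,s)=p$ for all $p,s\ge 0$, $i\in\mathcal X$, equals $\pi$ on $\mathcal D$. The same holds for every $\phi\in V$ satisfying this terminal condition for which only the derivative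 along the direction $(1,1)$ of the $(t,s)$-plane is assumed to exist on $\mathcal D^{\rm o}$ and which satisfies the equation on $\mathcal D^{\rm o}$ with that derivative in place of $\partial_t\phi+\partial_s\phi$. -/

import Mathlib

open MeasureTheory ProbabilityTheory Set Filter Topology
open scoped NNReal ENNReal

noncomputable section

namespace TickPrice

/-- The state space `{1, 2, 3, 4}`, realised inside the integers. -/
abbrev State : Type := Set.Icc (1 : ℤ) 4

/-- The equivalence relation on the state space whose classes are `{1, 2}` and `{3, 4}`. -/
abbrev SameBlock (i j : State) : Prop := (i : ℤ) ≤ 2 ↔ (j : ℤ) ≤ 2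

/-- The two signs `+` and `-`. -/
inductive Sgn : Type
  | plus
  | minus

/-- `α(n) = (-1)^n`, as a real number. -/
def alpha (n : ℤ) : ℝ := (-1 : ℝ) ^ n

/-- The sign of `α(n)`. -/
def alphaBar (n : ℤ) : Sgn := if 0 < alpha n then Sgn.plus else Sgn.minus

/-- The data of the tick-by-tick price model: the absolute return `δ`, the two intensities
`h_+`, `h_-` on `[0, ∞)`, and for every age `s ≥ 0` two disjoint half-open intervals
`H_+(s)`, `H_-(s)` of lengths `h_+(s)`, `h_-(s)`, depending measurably on `s`.
Values of `h` and `H` at negative ages are never used. -/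
structure Model where
  δ : ℝ
  h : Sgn → ℝ → ℝ
  H : Sgn → ℝ → Set ℝ
  δ_pos : 0 < δ
  δ_lt_one : δ < 1
  h_nonneg : ∀ ν, ∀ s, 0 ≤ s → 0 ≤ h ν s
  /-- `H_ν(s)` is a left-closed right-open interval of length `h_ν(s)`. -/
  H_interval : ∀ ν, ∀ s, 0 ≤ s → ∃ a : ℝ, H ν s = Set.Ico a (a + h ν s)
  H_disjoint : ∀ s, 0 ≤ s → Disjoint (H Sgn.plus s) (H Sgn.minus s)
  H_measurable : ∀ ν, MeasurableSet {x : ℝ × ℝ | 0 ≤ x.1 ∧ x.2 ∈ H ν x.1}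
  /-- `h_ν` is continuously differentiable on `[0, ∞)`. -/
  h_contDiff : ∀ ν, ContDiffOn ℝ 1 (h ν) (Set.Ici 0)
  h_bounded : ∃ c : ℝ, ∀ ν, ∀ s, 0 ≤ s → h ν s ≤ c
  h_integral : ∀ ν, Tendsto (fun y : ℝ => ∫ v in (0 : ℝ)..y, h ν v) atTop atTop
  h_pos : ∀ s, 0 ≤ s → 0 < h Sgn.plus s + h Sgn.minus s

namespace Model

variable (M : Model)

/-- `h_{ij}(s)`, the intensity of a transition from `i` to `j` at age `s`. -/
def hij (i j : State) (s : ℝ) : ℝ := M.h (alphaBar ((i : ℤ) + (j : ℤ))) s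

/-- `H_{ij}(s)`. -/
def Hij (i j : State) (s : ℝ) : Set ℝ := M.H (alphaBar ((i : ℤ) + (j : ℤ))) s

/-- The age coefficient `g₁(i, s, z) = s 1_{H(s)}(z)`, where `H(s) = H_+(s) ∪ H_-(s)`. -/
def g₁ (_i : State) (s z : ℝ) : ℝ :=
  s * (M.H Sgn.plus s ∪ M.H Sgn.minus s).indicator (fun _ => (1 : ℝ)) z

/-- The state coefficient `g₂(i, s, z) = ∑_{j ≢ i} (j - i) 1_{H_ij(s)}(z)`. -/
def g₂ (i : State) (s z : ℝ) : ℝ :=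
  ∑ j : State with ¬ SameBlock i j,
    (((j : ℤ) : ℝ) - ((i : ℤ) : ℝ)) * (M.Hij i j s).indicator (fun _ => (1 : ℝ)) z

/-- The return coefficient `g₃(i, s, z) = ∑_{j ≢ i} δ α(j) 1_{H_ij(s)}(z)`. -/
def g₃ (i : State) (s z : ℝ) : ℝ :=
  ∑ j : State with ¬ SameBlock i j,
    M.δ * alpha (j : ℤ) * (M.Hij i j s).indicator (fun _ => (1 : ℝ)) z

end Model

/-- Product Lebesgue measure on `[0, ∞) × ℝ`. -/
def lebesgueHalfPlane : Measure (ℝ≥0 × ℝ) :=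
  (volume : Measure (ℝ × ℝ)).comap (fun x : ℝ≥0 × ℝ => ((x.1 : ℝ), x.2))

variable {Ω : Type*} [mΩ : MeasurableSpace Ω]

/-- `N` is a Poisson random measure on `[0, ∞) × ℝ` with product Lebesgue intensity, relative to
the filtration `ℱ`. -/
structure IsPoissonRandomMeasure (μ : Measure Ω) (ℱ : Filtration ℝ≥0 mΩ)
    (N : Ω → Measure (ℝ≥0 × ℝ)) : Prop where
  measurable : Measurable N
  integer_valued : ∀ ω, ∀ A : Set (ℝ≥0 × ℝ), MeasurableSet A → ∃ n : ℕ∞, N ω A = (n : ℝ≥0∞)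
  /-- The mass of a set of finite intensity is Poisson distributed with that mean. -/
  poisson : ∀ A : Set (ℝ≥0 × ℝ), MeasurableSet A → lebesgueHalfPlane A ≠ ∞ →
    μ.map (fun ω => N ω A) =
      (poissonMeasure (lebesgueHalfPlane A).toNNReal).map (fun n : ℕ => (n : ℝ≥0∞))
  /-- The masses of finitely many disjoint sets are independent. -/
  indep : ∀ (n : ℕ) (A : Fin n → Set (ℝ≥0 × ℝ)), (∀ k, MeasurableSet (A k)) →
    Pairwise (fun k l => Disjoint (A k) (A l)) → iIndepFun (fun k ω => N ω (A k)) μ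
  /-- The points up to time `t` are known at time `t`. -/
  adapted : ∀ (t : ℝ≥0) (A : Set (ℝ≥0 × ℝ)), MeasurableSet A → A ⊆ Set.Iic t ×ˢ Set.univ →
    Measurable[ℱ t] (fun ω => N ω A)
  /-- The points after time `t` are independent of the information available at time `t`. -/
  future_indep : ∀ t : ℝ≥0, Indep (ℱ t)
    (⨆ A ∈ {A : Set (ℝ≥0 × ℝ) | MeasurableSet A ∧ A ⊆ Set.Ioi t ×ˢ Set.univ},
      MeasurableSpace.comap (fun ω => N ω A) inferInstance) μ

/-- Right-continuous with left limits. -/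
def IsCadlagPath {E : Type*} [TopologicalSpace E] (f : ℝ≥0 → E) : Prop :=
  ∀ t, ContinuousWithinAt f (Set.Ici t) t ∧ ∃ l, Tendsto f (𝓝[<] t) (𝓝 l)

/-- `(P, I, S)` is a (càdlàg, adapted) solution, with values in `[0, ∞) × {1, 2, 3, 4} × [0, ∞)`,
of the stochastic integral equations
`S_t = S_0 + t - ∫_{(0,t]×ℝ} g₁(I_{v-}, S_{v-}, z) N(dv, dz)`,
`I_t = I_0 + ∫_{(0,t]×ℝ} g₂(I_{v-}, S_{v-}, z) N(dv, dz)`,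
`P_t = P_0 + ∫_{(0,t]×ℝ} P_{v-} g₃(I_{v-}, S_{v-}, z) N(dv, dz)`
for all `t ≥ 0`, almost surely. -/
structure IsSolution (M : Model) (μ : Measure Ω) (ℱ : Filtration ℝ≥0 mΩ)
    (N : Ω → Measure (ℝ≥0 × ℝ)) (P : ℝ≥0 → Ω → ℝ≥0) (I : ℝ≥0 → Ω → State)
    (S : ℝ≥0 → Ω → ℝ≥0) : Prop where
  adapted_P : Adapted ℱ P
  adapted_I : Adapted ℱ I
  adapted_S : Adapted ℱ S
  cadlag_P : ∀ ω, IsCadlagPath (fun t => P t ω)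
  cadlag_I : ∀ ω, IsCadlagPath (fun t => I t ω)
  cadlag_S : ∀ ω, IsCadlagPath (fun t => S t ω)
  age_eq : ∀ᵐ ω ∂μ, ∀ t : ℝ≥0,
    IntegrableOn (fun x : ℝ≥0 × ℝ => M.g₁ (Function.leftLim (fun v => I v ω) x.1)
      (Function.leftLim (fun v => S v ω) x.1) x.2) (Set.Ioc 0 t ×ˢ Set.univ) (N ω) ∧
    (S t ω : ℝ) = S 0 ω + t -
      ∫ x in Set.Ioc 0 t ×ˢ Set.univ, M.g₁ (Function.leftLim (fun v => I v ω) x.1)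
        (Function.leftLim (fun v => S v ω) x.1) x.2 ∂(N ω)
  state_eq : ∀ᵐ ω ∂μ, ∀ t : ℝ≥0,
    IntegrableOn (fun x : ℝ≥0 × ℝ => M.g₂ (Function.leftLim (fun v => I v ω) x.1)
      (Function.leftLim (fun v => S v ω) x.1) x.2) (Set.Ioc 0 t ×ˢ Set.univ) (N ω) ∧
    ((I t ω : ℤ) : ℝ) = ((I 0 ω : ℤ) : ℝ) +
      ∫ x in Set.Ioc 0 t ×ˢ Set.univ, M.g₂ (Function.leftLim (fun v => I v ω) x.1)
        (Function.leftLim (fun v => S v ω) x.1) x.2 ∂(N ω)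
  price_eq : ∀ᵐ ω ∂μ, ∀ t : ℝ≥0,
    IntegrableOn (fun x : ℝ≥0 × ℝ => (Function.leftLim (fun v => P v ω) x.1 : ℝ) *
      M.g₃ (Function.leftLim (fun v => I v ω) x.1)
        (Function.leftLim (fun v => S v ω) x.1) x.2) (Set.Ioc 0 t ×ˢ Set.univ) (N ω) ∧
    (P t ω : ℝ) = P 0 ω +
      ∫ x in Set.Ioc 0 t ×ˢ Set.univ, (Function.leftLim (fun v => P v ω) x.1 : ℝ) *
        M.g₃ (Function.leftLim (fun v => I v ω) x.1)
          (Function.leftLim (fun v => S v ω) x.1) x.2 ∂(N ω)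

/-- The assumptions on the initial values: `P_0`, `I_0`, `S_0` are independent, `P_0` has finite
mean, and the laws of `P_0`, `I_0`, `S_0` have full support in `[0, ∞)`, `{1, 2, 3, 4}`, `[0, ∞)`
(every non-empty open set has positive probability). -/
structure IsInitialCondition (μ : Measure Ω) (P₀ : Ω → ℝ≥0) (I₀ : Ω → State)
    (S₀ : Ω → ℝ≥0) : Prop where
  indep : iIndep ![MeasurableSpace.comap P₀ inferInstance, MeasurableSpace.comap I₀ inferInstance,
    MeasurableSpace.comap S₀ inferInstance] μ
  integrable : Integrable (fun ω => (P₀ ω : ℝ)) μ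
  support_P : (μ.map P₀).IsOpenPosMeasure
  support_I : (μ.map I₀).IsOpenPosMeasure
  support_S : (μ.map S₀).IsOpenPosMeasure

/-- The closed domain `𝒟 = [0, T] × [0, ∞) × {1, 2, 3, 4} × [0, ∞)`. -/
def domain (T : ℝ≥0) : Set (ℝ × ℝ × State × ℝ) :=
  {x | x.1 ∈ Set.Icc (0 : ℝ) T ∧ 0 ≤ x.2.1 ∧ 0 ≤ x.2.2.2}

/-- The open domain `𝒟° = (0, T) × (0, ∞) × {1, 2, 3, 4} × (0, ∞)`. -/
def openDomain (T : ℝ≥0) : Set (ℝ × ℝ × State × ℝ) :=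
  {x | x.1 ∈ Set.Ioo (0 : ℝ) T ∧ 0 < x.2.1 ∧ 0 < x.2.2.2}

/-- Joint continuity on `A` of a function of `(t, p, i, s)`. -/
def ContOn (φ : ℝ → ℝ → State → ℝ → ℝ) (A : Set (ℝ × ℝ × State × ℝ)) : Prop :=
  ContinuousOn (fun x : ℝ × ℝ × State × ℝ => φ x.1 x.2.1 x.2.2.1 x.2.2.2) A

/-- Equality on the closed domain. -/
def EqOnDomain (T : ℝ≥0) (φ ψ : ℝ → ℝ → State → ℝ → ℝ) : Prop :=
  ∀ t p i s, (t, p, i, s) ∈ domain T → φ t p i s = ψ t p i s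

/-- The space `V` of continuous functions on `𝒟` with `sup |φ(t, p, i, s)| / (1 + p) < ∞`. -/
def InV (T : ℝ≥0) (φ : ℝ → ℝ → State → ℝ → ℝ) : Prop :=
  ContOn φ (domain T) ∧
    ∃ C : ℝ, ∀ t p i s, (t, p, i, s) ∈ domain T → |φ t p i s| / (1 + p) ≤ C

/-- `∂φ/∂t`, one-sided at `t = 0` and at `t = T`. -/
def partialT (T : ℝ≥0) (φ : ℝ → ℝ → State → ℝ → ℝ) (t p : ℝ) (i : State) (s : ℝ) : ℝ :=
  derivWithin (fun r => φ r p i s) (Set.Icc (0 : ℝ) T) t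

/-- `∂φ/∂s`, one-sided at `s = 0`. -/
def partialS (φ : ℝ → ℝ → State → ℝ → ℝ) (t p : ℝ) (i : State) (s : ℝ) : ℝ :=
  derivWithin (fun r => φ t p i r) (Set.Ici (0 : ℝ)) s

/-- `φ` is of class `C^{1,1}` on `A ⊆ 𝒟`: the partial derivatives in `t` and in `s` exist at every
point of `A` (one-sided at the boundary points of `𝒟`) and are jointly continuous on `A`. -/
def IsC11 (T : ℝ≥0) (φ : ℝ → ℝ → State → ℝ → ℝ) (A : Set (ℝ × ℝ × State × ℝ)) : Prop :=
  (∀ t p i s, (t, p, i, s) ∈ A →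
    DifferentiableWithinAt ℝ (fun r => φ r p i s) (Set.Icc (0 : ℝ) T) t ∧
    DifferentiableWithinAt ℝ (fun r => φ t p i r) (Set.Ici (0 : ℝ)) s) ∧
  ContOn (partialT T φ) A ∧ ContOn (partialS φ) A

/-- The jump part `∑_{j ≢ i} h_ij(s) (φ(t, p(1 + δ α(j)), j, 0) - φ(t, p, i, s))`. -/
def jumpTerm (M : Model) (φ : ℝ → ℝ → State → ℝ → ℝ) (t p : ℝ) (i : State) (s : ℝ) : ℝ :=
  ∑ j : State with ¬ SameBlock i j,
    M.hij i j s * (φ t (p * (1 + M.δ * alpha (j : ℤ))) j 0 - φ t p i s)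

/-- The equation `∂φ/∂t + ∂φ/∂s + ∑_{j ≢ i} h_ij(s) (φ(t, p(1 + δ α(j)), j, 0) - φ) = 0` on `A`. -/
def SolvesPDE (M : Model) (T : ℝ≥0) (φ : ℝ → ℝ → State → ℝ → ℝ)
    (A : Set (ℝ × ℝ × State × ℝ)) : Prop :=
  ∀ t p i s, (t, p, i, s) ∈ A →
    partialT T φ t p i s + partialS φ t p i s + jumpTerm M φ t p i s = 0

/-- The same equation on `𝒟°`, with `∂/∂t + ∂/∂s` understood as one operator, namely the
derivative along the direction `(1, 1)` of the `(t, s)`-plane (which has to exist). -/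
def SolvesPDEAlongCharacteristics (M : Model) (T : ℝ≥0) (φ : ℝ → ℝ → State → ℝ → ℝ) : Prop :=
  ∀ t p i s, (t, p, i, s) ∈ openDomain T →
    ∃ d : ℝ, HasDerivAt (fun r => φ (t + r) p i (s + r)) d 0 ∧ d + jumpTerm M φ t p i s = 0

/-- The terminal condition `φ(T, p, i, s) = p`. -/
def TerminalCondition (T : ℝ≥0) (φ : ℝ → ℝ → State → ℝ → ℝ) : Prop :=
  ∀ p i s, 0 ≤ p → 0 ≤ s → φ T p i s = p

/-- `φ(t, p, i, s)` is a version of `E[P_T | P_t = p, I_t = i, S_t = s]`: for every `t ∈ [0, T]`,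
almost surely `φ(t, P_t, I_t, S_t) = E[P_T | σ(P_t, I_t, S_t)]`. -/
def IsCondExpVersion (μ : Measure Ω) (T : ℝ≥0) (P : ℝ≥0 → Ω → ℝ≥0) (I : ℝ≥0 → Ω → State)
    (S : ℝ≥0 → Ω → ℝ≥0) (φ : ℝ → ℝ → State → ℝ → ℝ) : Prop :=
  ∀ t : ℝ≥0, t ≤ T →
    (fun ω => φ t (P t ω) (I t ω) (S t ω)) =ᵐ[μ]
      μ[fun ω => (P T ω : ℝ) |
        MeasurableSpace.comap (fun ω => (P t ω, I t ω, S t ω)) inferInstance]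

end TickPrice

end

/-!
The idea is to solve the equation explicitly, and to recognise the solution in the conditional
expectation by a martingale argument.

*Analysis.* The equation is linear in `p`, so a solution is sought in the form
`π(t, p, i, s) = p u(t, i, s)`. Integrating along the characteristics `s - t = const` expresses
`u` through its values `w_i(t) = u(t, i, 0)` at age zero (`growth`), and these have to solve a
linear Volterra system with continuous kernels (`exists_volterra_solution`). The regularity of `u`
comes from the differentiability of the integrals in the shift `s - t` and uses that the
intensities are continuously differentiable (`hasDerivAt_growth`). Uniqueness needs only the
derivative along characteristics: the difference of two solutions satisfies an integral inequality
whose iteration bounds it by `K (1 + p) (L (T - t)) ^ n / n!` for all `n`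
(`eqOnDomain_price_of_characteristics`).

*Probability.* Almost surely the points that act on the process are locally finite, at most one of
them acts at any time, because two simultaneous points would make the age negative, and between
them the process follows a characteristic. This gives a pathwise change-of-variables formula for
every function that is differentiable along characteristics (`IsJumpPath.changeOfVariables`). The
left limits of the process are predictable, so the integrals against the random measure can be
compensated (`IsPoissonRandomMeasure.integral_integral`, which holds because both sides agree on
the rectangles that generate the predictable sets). Together these give Dynkin's formula
(`IsSolution.dynkin`). It is used three times:

* for truncations of the price, to bound its moments (`IsSolution.exists_moment_bound`);
* for `π`, on which the generator vanishes, so that `π(t, P_t, I_t, S_t)` is a martingale with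
  terminal value `P_T` (`IsSolution.isCondExpVersion_price`);
* for a test function on which the generator is non-negative and that vanishes at time `t` outside
  a given open set, to show that the law of `(P_t, I_t, S_t)` has full support
  (`IsSolution.measure_ne_zero`). Every state can be entered at any given time from some state of
  the other block, so every point is reached with at most one jump. Full support makes the
  continuous version of the conditional expectation unique.
-/

noncomputable section

namespace TickPrice

section

/-! ### The state space -/

lemma alpha_eq_one_or (n : ℤ) : alpha n = 1 ∨ alpha n = -1 := by
  unfold alpha
  rcases Int.even_or_odd n with h | h
  · exact Or.inl h.neg_one_zpow
  · exact Or.inr h.neg_one_zpow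

lemma alphaBar_of_even {n : ℤ} (h : Even n) : alphaBar n = Sgn.plus := by
  simp [alphaBar, alpha, h.neg_one_zpow]

lemma alphaBar_of_odd {n : ℤ} (h : Odd n) : alphaBar n = Sgn.minus := by
  simp [alphaBar, alpha, h.neg_one_zpow]

/-- From every state exactly two states of the other block can be reached, one through each of
the two intensities. -/
lemma exists_targets (i : State) : ∃ j k : State, j ≠ k ∧
    (Finset.univ.filter fun l : State => ¬ SameBlock i l) = {j, k} ∧
    alphaBar ((i : ℤ) + (j : ℤ)) = Sgn.plus ∧ alphaBar ((i : ℤ) + (k : ℤ)) = Sgn.minus := by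
  have key : ∀ i : State, ∃ j k : State, j ≠ k ∧
    (Finset.univ.filter fun l : State => ¬ SameBlock i l) = {j, k} ∧
    Even ((i : ℤ) + (j : ℤ)) ∧ ¬ Even ((i : ℤ) + (k : ℤ)) := by decide
  obtain ⟨j, k, h1, h2, h3, h4⟩ := key i
  exact ⟨j, k, h1, h2, alphaBar_of_even h3, alphaBar_of_odd (Int.not_even_iff_odd.1 h4)⟩

lemma sum_targets (i : State) (f : Sgn → ℝ) :
    ∑ j : State with ¬ SameBlock i j, f (alphaBar ((i : ℤ) + (j : ℤ)))
      = f Sgn.plus + f Sgn.minus := by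
  obtain ⟨j, k, h1, h2, h3, h4⟩ := exists_targets i
  rw [h2, Finset.sum_pair h1, h3, h4]

namespace Model

variable (M : Model)

/-- The factor `1 + δ α(j)` by which a jump into state `j` multiplies the price. -/
def fac (j : State) : ℝ := 1 + M.δ * alpha (j : ℤ)

lemma fac_pos (j : State) : 0 < M.fac j := by
  have := M.δ_pos; have := M.δ_lt_one
  rcases alpha_eq_one_or (j : ℤ) with h | h <;> rw [fac, h] <;> linarith

lemma fac_le (j : State) : M.fac j ≤ 1 + M.δ := by
  have := M.δ_pos
  rcases alpha_eq_one_or (j : ℤ) with h | h <;> rw [fac, h] <;> linarith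

lemma fac_le_two (j : State) : M.fac j ≤ 2 := by
  have := M.fac_le j; have := M.δ_lt_one; linarith

lemma sum_hij (i : State) (s : ℝ) :
    ∑ j : State with ¬ SameBlock i j, M.hij i j s = M.h Sgn.plus s + M.h Sgn.minus s :=
  sum_targets i (fun ν => M.h ν s)

lemma hij_nonneg (i j : State) {s : ℝ} (hs : 0 ≤ s) : 0 ≤ M.hij i j s := M.h_nonneg _ _ hs

/-- A bound for both intensities. -/
def hBound : ℝ := M.h_bounded.choose

lemma h_le_hBound (ν : Sgn) {s : ℝ} (hs : 0 ≤ s) : M.h ν s ≤ M.hBound :=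
  M.h_bounded.choose_spec ν s hs

lemma hBound_nonneg : 0 ≤ M.hBound :=
  (M.h_nonneg Sgn.plus 0 le_rfl).trans (M.h_le_hBound _ le_rfl)

/-- Every state is entered with positive intensity from some state of the other block. -/
lemma exists_source (j : State) {s : ℝ} (hs : 0 ≤ s) :
    ∃ i : State, ¬ SameBlock i j ∧ 0 < M.hij i j s := by
  obtain ⟨k, l, -, h2, h3, h4⟩ := exists_targets j
  have hk : ¬ SameBlock j k := by
    have : k ∈ (Finset.univ.filter fun l : State => ¬ SameBlock j l) := by rw [h2]; simp
    simpa using this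
  have hl : ¬ SameBlock j l := by
    have : l ∈ (Finset.univ.filter fun l : State => ¬ SameBlock j l) := by rw [h2]; simp
    simpa using this
  have hp := M.h_pos s hs
  rcases lt_or_ge 0 (M.h Sgn.plus s) with h | h
  · exact ⟨k, fun h' => hk h'.symm, by rw [hij, add_comm, h3]; exact h⟩
  · exact ⟨l, fun h' => hl h'.symm, by rw [hij, add_comm, h4]; linarith⟩

/-! ### Extending the intensities to negative ages -/

lemma exists_contDiff_extension (ν : Sgn) :
    ∃ k : ℝ → ℝ, ContDiff ℝ 1 k ∧ ∀ s, 0 ≤ s → k s = M.h ν s := by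
  have hd := M.h_contDiff ν
  have hg : ContinuousOn (derivWithin (M.h ν) (Ici 0)) (Ici 0) :=
    hd.continuousOn_derivWithin (uniqueDiffOn_Ici 0) le_rfl
  set g : ℝ → ℝ := fun s => derivWithin (M.h ν) (Ici 0) (max s 0) with hgdef
  have hgc : Continuous g :=
    hg.comp_continuous (by fun_prop) (fun s => le_max_right s 0)
  have hder : ∀ s, HasDerivAt (fun s => M.h ν 0 + ∫ v in (0 : ℝ)..s, g v) (g s) s := fun s =>
    (intervalIntegral.integral_hasDerivAt_right (hgc.intervalIntegrable _ _)
      (hgc.stronglyMeasurableAtFilter _ _) hgc.continuousAt).const_add _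
  refine ⟨fun s => M.h ν 0 + ∫ v in (0 : ℝ)..s, g v, ?_, ?_⟩
  · rw [contDiff_one_iff_deriv]
    refine ⟨fun s => (hder s).differentiableAt, ?_⟩
    rw [show deriv (fun s => M.h ν 0 + ∫ v in (0 : ℝ)..s, g v) = g from
      funext fun s => (hder s).deriv]
    exact hgc
  · intro s hs
    have := intervalIntegral.integral_eq_sub_of_hasDerivAt_of_le hs
      (hd.continuousOn.mono Icc_subset_Ici_self) (f' := g) (fun x hx => by
        have h1 := (hd.differentiableOn one_ne_zero x hx.1.le).hasDerivWithinAt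
        have h2 := h1.hasDerivAt (Ici_mem_nhds hx.1)
        simpa [hgdef, max_eq_left hx.1.le] using h2) (hgc.intervalIntegrable _ _)
    simp only [this]; ring

/-- A continuously differentiable extension of the intensity `h_ν` to the real line. -/
def hx (ν : Sgn) : ℝ → ℝ := (M.exists_contDiff_extension ν).choose

lemma contDiff_hx (ν : Sgn) : ContDiff ℝ 1 (M.hx ν) :=
  (M.exists_contDiff_extension ν).choose_spec.1

lemma hx_eq (ν : Sgn) {s : ℝ} (hs : 0 ≤ s) : M.hx ν s = M.h ν s :=
  (M.exists_contDiff_extension ν).choose_spec.2 s hs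

@[fun_prop]
lemma continuous_hx (ν : Sgn) : Continuous (M.hx ν) := (M.contDiff_hx ν).continuous

/-- The cumulative hazard `∫_0^s (h_+ + h_-)`. -/
def hazard (s : ℝ) : ℝ := ∫ v in (0 : ℝ)..s, (M.hx Sgn.plus v + M.hx Sgn.minus v)

@[simp] lemma hazard_zero : M.hazard 0 = 0 := by simp [hazard]

lemma hasDerivAt_hazard (s : ℝ) :
    HasDerivAt M.hazard (M.hx Sgn.plus s + M.hx Sgn.minus s) s := by
  have hc : Continuous fun v => M.hx Sgn.plus v + M.hx Sgn.minus v := by fun_prop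
  exact intervalIntegral.integral_hasDerivAt_right (hc.intervalIntegrable _ _)
      (hc.stronglyMeasurableAtFilter _ _) hc.continuousAt

lemma contDiff_hazard : ContDiff ℝ 1 M.hazard := by
  rw [contDiff_one_iff_deriv]
  refine ⟨fun s => (M.hasDerivAt_hazard s).differentiableAt, ?_⟩
  rw [show deriv M.hazard = _ from funext fun s => (M.hasDerivAt_hazard s).deriv]
  fun_prop

@[fun_prop]
lemma continuous_hazard : Continuous M.hazard := M.contDiff_hazard.continuous

lemma monotoneOn_hazard : MonotoneOn M.hazard (Ici 0) := by
  refine monotoneOn_of_deriv_nonneg (convex_Ici 0) M.continuous_hazard.continuousOn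
    (fun s _ => (M.hasDerivAt_hazard s).differentiableAt.differentiableWithinAt) fun s hs => ?_
  have hs' : 0 ≤ s := interior_subset hs
  rw [(M.hasDerivAt_hazard s).deriv, M.hx_eq _ hs', M.hx_eq _ hs']
  exact (M.h_pos s hs').le

/-- The sub-density `h_ij(y) exp(-∫_0^y (h_+ + h_-))` of the age at which a jump from `i` to `j`
occurs, as a function on the real line. -/
def kern (i j : State) (y : ℝ) : ℝ :=
  M.hx (alphaBar ((i : ℤ) + (j : ℤ))) y * Real.exp (-M.hazard y)

lemma contDiff_kern (i j : State) : ContDiff ℝ 1 (M.kern i j) :=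
  (M.contDiff_hx _).mul (Real.contDiff_exp.comp M.contDiff_hazard.neg)

@[fun_prop]
lemma continuous_kern (i j : State) : Continuous (M.kern i j) := (M.contDiff_kern i j).continuous

end Model

end

section

/-! ### The Volterra system for the values at age zero -/

lemma integral_exp_neg_le {lam : ℝ} (hlam : 0 < lam) (t T : ℝ) :
    ∫ v in t..T, Real.exp (-lam * (v - t)) ≤ 1 / lam := by
  have hd : ∀ v ∈ uIcc t T, HasDerivAt (fun v => -(Real.exp (-lam * (v - t)) / lam))
      (Real.exp (-lam * (v - t))) v := fun v _ => by
    have h1 : HasDerivAt (fun v => -lam * (v - t)) (-lam) v := by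
      simpa using ((hasDerivAt_id v).sub_const t).const_mul (-lam)
    have h2 := (h1.exp.div_const lam).neg
    refine HasDerivAt.congr_deriv h2 ?_
    field_simp
  rw [intervalIntegral.integral_eq_sub_of_hasDerivAt hd
    (Continuous.intervalIntegrable (by fun_prop) _ _)]
  have := Real.exp_pos (-lam * (T - t))
  have : 0 < Real.exp (-lam * (T - t)) / lam := by positivity
  simp only [sub_self, mul_zero, Real.exp_zero]
  linarith

/-- A linear Volterra system with continuous data on `[0, T]`, run backwards from `T`, has a
continuous solution: in a norm with exponential weight the integral operator is a contraction. -/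
theorem exists_volterra_solution {ι : Type*} [Fintype ι] {T : ℝ} (hT : 0 ≤ T) (a : ι → ℝ → ℝ)
    (ha : ∀ i, Continuous (a i)) (K : ι → ι → ℝ → ℝ) (hK : ∀ i j, Continuous (K i j)) :
    ∃ w : ι → ℝ → ℝ, (∀ i, Continuous (w i)) ∧ ∀ i, ∀ t ∈ Icc 0 T,
      w i t = a i t + ∑ j, ∫ v in t..T, K i j (v - t) * w j v := by
  classical
  obtain ⟨B, hB0, hB⟩ : ∃ B : ℝ, 0 ≤ B ∧ ∀ i j, ∀ y ∈ Icc 0 T, |K i j y| ≤ B := by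
    have h : ∀ i j, ∃ B : ℝ, ∀ y ∈ Icc 0 T, |K i j y| ≤ B := fun i j => by
      obtain ⟨B, hB⟩ := isCompact_Icc.exists_bound_of_continuousOn (hK i j).continuousOn
        (s := Icc 0 T)
      exact ⟨B, hB⟩
    choose B hB using h
    refine ⟨∑ i, ∑ j, |B i j|, by positivity, fun i j y hy => (hB i j y hy).trans ?_⟩
    calc B i j ≤ |B i j| := le_abs_self _
      _ ≤ ∑ j, |B i j| := Finset.single_le_sum (f := fun j => |B i j|)
          (fun _ _ => abs_nonneg _) (Finset.mem_univ j)
      _ ≤ _ := Finset.single_le_sum (f := fun i => ∑ j, |B i j|)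
          (fun _ _ => by positivity) (Finset.mem_univ i)
  set c : ℝ := (Fintype.card ι : ℝ) with hc
  have hc0 : 0 ≤ c := by positivity
  set lam : ℝ := 2 * c * B + 1 with hlamdef
  have hlam : 0 < lam := by positivity
  have hext : ∀ (f : C(Icc 0 T, ι → ℝ)) (j : ι), Continuous fun v => IccExtend hT f v j :=
    fun f j => (continuous_apply j).comp (f.continuous.Icc_extend')
  have hintc' : ∀ (f : C(Icc 0 T, ι → ℝ)) (i j : ι) (t b c : ℝ), IntervalIntegrable (fun v : ℝ =>
      Real.exp (-lam * (v - t)) * K i j (v - t) * IccExtend hT f v j) volume b c :=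
    fun f i j t b c =>
    (((by fun_prop : Continuous fun x : ℝ => Real.exp (-lam * (x - t))).mul
      ((hK i j).comp (by fun_prop))).mul (hext f j)).intervalIntegrable _ _
  have hintc : ∀ (f : C(Icc 0 T, ι → ℝ)) (i j : ι), Continuous (Function.uncurry fun t v : ℝ =>
      Real.exp (-lam * (v - t)) * K i j (v - t) * IccExtend hT f v j) := fun f i j => by
    have := hext f j
    have := hK i j
    unfold Function.uncurry
    exact ((by fun_prop : Continuous fun x : ℝ × ℝ => Real.exp (-lam * (x.2 - x.1))).mul
      ((hK i j).comp (by fun_prop))).mul ((hext f j).comp continuous_snd)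
  -- the fixed point is `exp(-lam (T - t)) w(t)`; the factor is what makes `Φ` contract
  let Φ : C(Icc 0 T, ι → ℝ) → C(Icc 0 T, ι → ℝ) := fun f =>
    { toFun := fun t i => Real.exp (-lam * (T - t)) * a i t - ∑ j, ∫ v in T..(t : ℝ),
        Real.exp (-lam * (v - t)) * K i j (v - t) * IccExtend hT f v j
      continuous_toFun := by
        refine continuous_pi fun i => Continuous.sub ?_ (continuous_finsetSum _ fun j _ => ?_)
        · exact (by fun_prop : Continuous fun x : Icc 0 T => Real.exp (-lam * (T - x))).mul
            ((ha i).comp continuous_subtype_val)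
        · exact (intervalIntegral.continuous_parametric_intervalIntegral_of_continuous
            (hintc f i j) continuous_id).comp continuous_subtype_val }
  have hΦ : ∀ f t i, Φ f t i = Real.exp (-lam * (T - t)) * a i t - ∑ j, ∫ v in T..(t : ℝ),
        Real.exp (-lam * (v - t)) * K i j (v - t) * IccExtend hT f v j := fun _ _ _ => rfl
  have hcontr : ContractingWith (1 / 2) Φ := by
    refine ⟨by rw [← NNReal.coe_lt_coe]; norm_num, LipschitzWith.of_dist_le_mul fun f g => ?_⟩
    rw [ContinuousMap.dist_le (by positivity)]
    intro t
    rw [dist_pi_le_iff (by positivity)]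
    intro i
    rw [hΦ, hΦ, Real.dist_eq, sub_sub_sub_cancel_left, ← Finset.sum_sub_distrib]
    have hterm : ∀ j, |(∫ v in T..(t : ℝ),
        Real.exp (-lam * (v - t)) * K i j (v - t) * IccExtend hT g v j) - ∫ v in T..(t : ℝ),
        Real.exp (-lam * (v - t)) * K i j (v - t) * IccExtend hT f v j|
        ≤ B * dist f g * (1 / lam) := fun j => by
      rw [← intervalIntegral.integral_sub (hintc' g i j t _ _) (hintc' f i j t _ _),
        intervalIntegral.integral_symm, abs_neg, ← Real.norm_eq_abs]
      calc _ ≤ ∫ v in (t : ℝ)..T, Real.exp (-lam * (v - t)) * (B * dist f g) := by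
            refine intervalIntegral.norm_integral_le_of_norm_le (μ := volume) (E := ℝ)
              t.2.2 (ae_of_all _ fun v hv => ?_)
              ((by fun_prop : Continuous fun v : ℝ =>
                Real.exp (-lam * (v - t)) * (B * dist f g)).intervalIntegrable _ _)
            have hv0 : v ∈ Icc 0 T := ⟨t.2.1.trans hv.1.le, hv.2⟩
            rw [← mul_sub, Real.norm_eq_abs, abs_mul, abs_mul, Real.abs_exp, mul_assoc]
            refine mul_le_mul_of_nonneg_left (mul_le_mul (hB _ _ _
              ⟨by linarith [hv.1], by linarith [hv.2, t.2.1]⟩) ?_ (abs_nonneg _) hB0)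
              (by positivity)
            rw [IccExtend_of_mem hT _ hv0, IccExtend_of_mem hT _ hv0, ← Real.dist_eq, dist_comm]
            exact (dist_le_pi_dist _ _ j).trans (ContinuousMap.dist_apply_le_dist _)
        _ ≤ _ := by
            rw [intervalIntegral.integral_mul_const, mul_comm]
            exact mul_le_mul_of_nonneg_left (integral_exp_neg_le hlam _ _) (by positivity)
    calc _ ≤ ∑ j : ι, B * dist f g * (1 / lam) :=
          (Finset.abs_sum_le_sum_abs _ _).trans (Finset.sum_le_sum fun j _ => hterm j)
      _ = (c * B / lam) * dist f g := by
          rw [Finset.sum_const, Finset.card_univ, nsmul_eq_mul]; ring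
      _ ≤ _ := by
          refine mul_le_mul_of_nonneg_right ?_ dist_nonneg
          rw [div_le_iff₀ hlam]
          push_cast
          linarith
  obtain ⟨f, hf⟩ : ∃ f, Φ f = f := ⟨hcontr.fixedPoint, hcontr.fixedPoint_isFixedPt⟩
  refine ⟨fun i t => Real.exp (lam * (T - t)) * IccExtend hT f t i, fun i =>
    (by fun_prop : Continuous fun t : ℝ => Real.exp (lam * (T - t))).mul (hext f i), ?_⟩
  intro i t ht
  have h1 := hΦ f ⟨t, ht⟩ i
  rw [hf] at h1
  simp only at h1 ⊢
  rw [IccExtend_of_mem hT _ ht, h1, mul_sub, ← mul_assoc, ← Real.exp_add]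
  have h0 : lam * (T - t) + -lam * (T - t) = 0 := by ring
  rw [h0, Real.exp_zero, one_mul, sub_eq_add_neg, ← mul_neg, ← Finset.sum_neg_distrib,
    Finset.mul_sum]
  congr 1
  refine Finset.sum_congr rfl fun j _ => ?_
  rw [← intervalIntegral.integral_symm, ← intervalIntegral.integral_const_mul]
  refine intervalIntegral.integral_congr fun v _ => ?_
  have : Real.exp (lam * (T - v)) = Real.exp (lam * (T - t)) * Real.exp (-lam * (v - t)) := by
    rw [← Real.exp_add]; ring_nf
  simp only [this]
  ring

end

section

/-! ### The candidate solution -/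

/-- Differentiation of `∫_t^T k(c + v) W(v) dv` in the shift `c`. -/
lemma hasDerivAt_integral_shift {k W : ℝ → ℝ} (hk : ContDiff ℝ 1 k) (hW : Continuous W)
    (T t c : ℝ) : HasDerivAt (fun c => ∫ v in t..T, k (c + v) * W v)
      (∫ v in t..T, deriv k (c + v) * W v) c := by
  have hk' : Continuous (deriv k) := hk.continuous_deriv_one
  have hkc := hk.continuous
  have hc1 : Continuous fun x : ℝ × ℝ => deriv k (x.1 + x.2) * W x.2 := by fun_prop
  obtain ⟨B, hB⟩ := ((isCompact_closedBall c 1).prod (isCompact_uIcc (a := t) (b := T))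
    ).exists_bound_of_continuousOn hc1.continuousOn
  refine (intervalIntegral.hasDerivAt_integral_of_dominated_loc_of_deriv_le
    (F := fun c v => k (c + v) * W v) (F' := fun c v => deriv k (c + v) * W v)
    (bound := fun _ => B) (Metric.ball_mem_nhds c one_pos) ?_ ?_ ?_ ?_ ?_ ?_).2
  · exact Eventually.of_forall fun x =>
      (by fun_prop : Continuous fun v => k (x + v) * W v).aestronglyMeasurable
  · exact (by fun_prop : Continuous fun v => k (c + v) * W v).intervalIntegrable _ _
  · exact (by fun_prop : Continuous fun v => deriv k (c + v) * W v).aestronglyMeasurable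
  · exact ae_of_all _ fun v hv x hx =>
      hB (x, v) ⟨Metric.ball_subset_closedBall hx, uIoc_subset_uIcc hv⟩
  · exact intervalIntegrable_const
  · refine ae_of_all _ fun v _ x _ => ?_
    have h1 : HasDerivAt (fun x => k (x + v)) (deriv k (x + v)) x :=
      ((hk.differentiable one_ne_zero (x + v)).hasDerivAt).comp_add_const x v
    exact h1.mul_const _

/-- The function `(c, t) ↦ ∫_t^T k(c + v) W(v) dv` is differentiable, with the expected gradient. -/
lemma hasFDerivAt_integral_shift {k W : ℝ → ℝ} (hk : ContDiff ℝ 1 k) (hW : Continuous W)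
    (T : ℝ) (x : ℝ × ℝ) : HasFDerivAt (fun x : ℝ × ℝ => ∫ v in x.2..T, k (x.1 + v) * W v)
      ((ContinuousLinearMap.toSpanSingleton ℝ (∫ v in x.2..T, deriv k (x.1 + v) * W v)).coprod
        (ContinuousLinearMap.toSpanSingleton ℝ (-(k (x.1 + x.2) * W x.2)))) x := by
  have hk' : Continuous (deriv k) := hk.continuous_deriv_one
  have hkc := hk.continuous
  have hcont : Continuous fun x : ℝ × ℝ => ∫ v in x.2..T, deriv k (x.1 + v) * W v := by
    simp_rw [intervalIntegral.integral_symm T]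
    exact (intervalIntegral.continuous_parametric_intervalIntegral_of_continuous
      (f := fun (x : ℝ × ℝ) v => deriv k (x.1 + v) * W v)
      (by unfold Function.uncurry; fun_prop) continuous_snd).neg
  have hts : Continuous fun a : ℝ => ContinuousLinearMap.toSpanSingleton ℝ (M₁ := ℝ) a :=
    (ContinuousLinearMap.toSpanSingletonCLE (𝕜 := ℝ) (E := ℝ)).continuous
  refine (hasStrictFDerivAt_uncurry_coprod (𝕜 := ℝ) (u := x)
    (f := fun c t => ∫ v in t..T, k (c + v) * W v)
    (f₁ := fun c t => ContinuousLinearMap.toSpanSingleton ℝ (∫ v in t..T, deriv k (c + v) * W v))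
    (f₂ := fun c t => ContinuousLinearMap.toSpanSingleton ℝ (-(k (c + t) * W t)))
    ?_ ?_ ?_ ?_).hasFDerivAt
  · exact Eventually.of_forall fun y => (hasDerivAt_integral_shift hk hW T y.2 y.1).hasFDerivAt
  · refine Eventually.of_forall fun y => HasDerivAt.hasFDerivAt ?_
    have hc : Continuous fun v => k (y.1 + v) * W v := by fun_prop
    exact intervalIntegral.integral_hasDerivAt_left (hc.intervalIntegrable _ _)
      (hc.stronglyMeasurableAtFilter _ _) hc.continuousAt
  · exact (hts.comp hcont).continuousAt
  · exact (hts.comp (by fun_prop :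
      Continuous fun y : ℝ × ℝ => -(k (y.1 + y.2) * W y.2))).continuousAt

lemma continuous_integral_shift {k W : ℝ → ℝ} (hk : Continuous k) (hW : Continuous W) (T : ℝ) :
    Continuous fun x : ℝ × ℝ => ∫ v in x.2..T, k (x.1 + v) * W v := by
  simp_rw [intervalIntegral.integral_symm T]
  exact (intervalIntegral.continuous_parametric_intervalIntegral_of_continuous
    (f := fun (x : ℝ × ℝ) v => k (x.1 + v) * W v)
    (by unfold Function.uncurry; fun_prop) continuous_snd).neg

lemma continuous_of_forall_state {φ : ℝ → ℝ → State → ℝ → ℝ}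
    (h : ∀ i, Continuous fun x : ℝ × ℝ × ℝ => φ x.1 x.2.1 i x.2.2) :
    Continuous fun x : ℝ × ℝ × State × ℝ => φ x.1 x.2.1 x.2.2.1 x.2.2.2 := by
  rw [continuous_iff_continuousAt]
  rintro ⟨t, p, i, s⟩
  have h1 : ContinuousAt (fun x : ℝ × ℝ × State × ℝ => φ x.1 x.2.1 i x.2.2.2) (t, p, i, s) :=
    ((h i).comp (by fun_prop : Continuous fun x : ℝ × ℝ × State × ℝ =>
      (x.1, x.2.1, x.2.2.2))).continuousAt
  refine h1.congr ?_
  have : ∀ᶠ x : ℝ × ℝ × State × ℝ in 𝓝 (t, p, i, s), x.2.2.1 = i :=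
    (by fun_prop : Continuous fun x : ℝ × ℝ × State × ℝ => x.2.2.1).continuousAt.eventually
      (p := fun j => j = i) (by simp [nhds_discrete])
  filter_upwards [this] with x hx
  rw [hx]

namespace Model

variable (M : Model)

lemma exists_ageZero (T : ℝ≥0) : ∃ w : State → ℝ → ℝ, (∀ i, Continuous (w i)) ∧
    ∀ i, ∀ t ∈ Icc (0 : ℝ) T, w i t = Real.exp (-M.hazard (T - t)) +
      ∑ j : State with ¬ SameBlock i j, M.fac j * ∫ v in t..T, M.kern i j (v - t) * w j v := by
  obtain ⟨w, h1, h2⟩ := exists_volterra_solution T.2 (fun _ t => Real.exp (-M.hazard (T - t)))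
    (fun _ => by fun_prop)
    (fun i j y => if ¬ SameBlock i j then M.fac j * M.kern i j y else 0) (fun i j => by
      split_ifs <;> fun_prop)
  refine ⟨w, h1, fun i t ht => ?_⟩
  rw [h2 i t ht, Finset.sum_filter]
  congr 1
  refine Finset.sum_congr rfl fun j _ => ?_
  split_ifs <;> simp [mul_assoc]

/-- `w_i(t)`: the expected growth of the price between `t` and `T` when state `i` has just been
entered at time `t`. -/
def ageZero (T : ℝ≥0) : State → ℝ → ℝ := (M.exists_ageZero T).choose

@[fun_prop]
lemma continuous_ageZero (T : ℝ≥0) (i : State) : Continuous (M.ageZero T i) :=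
  (M.exists_ageZero T).choose_spec.1 i

lemma ageZero_eq (T : ℝ≥0) (i : State) {t : ℝ} (ht : t ∈ Icc (0 : ℝ) T) :
    M.ageZero T i t = Real.exp (-M.hazard (T - t)) + ∑ j : State with ¬ SameBlock i j,
      M.fac j * ∫ v in t..T, M.kern i j (v - t) * M.ageZero T j v :=
  (M.exists_ageZero T).choose_spec.2 i t ht

/-- The part `exp(-∫_0^(c+T) h) + ∑_j (1 + δα(j)) ∫_t^T k_ij(c + v) w_j(v) dv` of the growth
function, in which `c = s - t` is constant along characteristics. -/
def charPart (T : ℝ≥0) (i : State) (x : ℝ × ℝ) : ℝ :=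
  Real.exp (-M.hazard (x.1 + T)) + ∑ j : State with ¬ SameBlock i j,
    M.fac j * ∫ v in x.2..T, M.kern i j (x.1 + v) * M.ageZero T j v

/-- The derivative of `charPart` in the parameter `c = s - t`. -/
def charPartDeriv (T : ℝ≥0) (i : State) (x : ℝ × ℝ) : ℝ :=
  -(M.hx Sgn.plus (x.1 + T) + M.hx Sgn.minus (x.1 + T)) * Real.exp (-M.hazard (x.1 + T)) +
    ∑ j : State with ¬ SameBlock i j,
      M.fac j * ∫ v in x.2..T, deriv (M.kern i j) (x.1 + v) * M.ageZero T j v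

/-- The inflow `∑_j (1 + δα(j)) h_ij(s) w_j(t)`. -/
def inflow (T : ℝ≥0) (t : ℝ) (i : State) (s : ℝ) : ℝ :=
  ∑ j : State with ¬ SameBlock i j,
    M.fac j * (M.hx (alphaBar ((i : ℤ) + (j : ℤ))) s * M.ageZero T j t)

/-- The growth function `u(t, i, s) = E[P_T / P_t | I_t = i, S_t = s]`. -/
def growth (T : ℝ≥0) (t : ℝ) (i : State) (s : ℝ) : ℝ :=
  Real.exp (M.hazard s) * M.charPart T i (s - t, t)

/-- The derivative of the growth function in the age. -/
def growthS (T : ℝ≥0) (t : ℝ) (i : State) (s : ℝ) : ℝ :=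
  (M.hx Sgn.plus s + M.hx Sgn.minus s) * M.growth T t i s +
    Real.exp (M.hazard s) * M.charPartDeriv T i (s - t, t)

/-- The derivative of the growth function along the characteristics. -/
def growthD (T : ℝ≥0) (t : ℝ) (i : State) (s : ℝ) : ℝ :=
  (M.hx Sgn.plus s + M.hx Sgn.minus s) * M.growth T t i s - M.inflow T t i s

lemma continuous_charPart (T : ℝ≥0) (i : State) : Continuous (M.charPart T i) := by
  unfold charPart
  refine Continuous.add (by fun_prop) (continuous_finsetSum _ fun j _ => ?_)
  exact continuous_const.mul
    (continuous_integral_shift (M.continuous_kern i j) (M.continuous_ageZero T j) T)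

lemma continuous_charPartDeriv (T : ℝ≥0) (i : State) : Continuous (M.charPartDeriv T i) := by
  unfold charPartDeriv
  refine Continuous.add (by fun_prop) (continuous_finsetSum _ fun j _ => ?_)
  exact continuous_const.mul (continuous_integral_shift
    (M.contDiff_kern i j).continuous_deriv_one (M.continuous_ageZero T j) T)

@[fun_prop]
lemma continuous_growth (T : ℝ≥0) (i : State) :
    Continuous fun x : ℝ × ℝ => M.growth T x.1 i x.2 := by
  unfold growth
  exact (by fun_prop : Continuous fun x : ℝ × ℝ => Real.exp (M.hazard x.2)).mul
    ((M.continuous_charPart T i).comp (by fun_prop))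

lemma continuous_inflow (T : ℝ≥0) (i : State) :
    Continuous fun x : ℝ × ℝ => M.inflow T x.1 i x.2 := by
  unfold inflow
  fun_prop

lemma continuous_growthS (T : ℝ≥0) (i : State) :
    Continuous fun x : ℝ × ℝ => M.growthS T x.1 i x.2 := by
  unfold growthS
  refine Continuous.add (by fun_prop) ?_
  exact (by fun_prop : Continuous fun x : ℝ × ℝ => Real.exp (M.hazard x.2)).mul
    ((M.continuous_charPartDeriv T i).comp (by fun_prop))

lemma continuous_growthD (T : ℝ≥0) (i : State) :
    Continuous fun x : ℝ × ℝ => M.growthD T x.1 i x.2 := by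
  unfold growthD
  exact Continuous.sub (by fun_prop) (M.continuous_inflow T i)

/-- The growth function is differentiable in `(t, s)`; here the derivative along a curve whose
velocity at `r` is `(a, b)`. -/
lemma hasDerivAt_growth (T : ℝ≥0) (i : State) {τ σ : ℝ → ℝ} {r a b : ℝ}
    (hτ : HasDerivAt τ a r) (hσ : HasDerivAt σ b r) :
    HasDerivAt (fun r => M.growth T (τ r) i (σ r))
      (a * (M.growthD T (τ r) i (σ r) - M.growthS T (τ r) i (σ r)) +
        b * M.growthS T (τ r) i (σ r)) r := by
  have hc : HasDerivAt (fun r => (σ r - τ r, τ r)) (b - a, a) r := (hσ.sub hτ).prodMk hτ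
  have hE : HasDerivAt (fun r => Real.exp (M.hazard (σ r)))
      (Real.exp (M.hazard (σ r)) * ((M.hx Sgn.plus (σ r) + M.hx Sgn.minus (σ r)) * b)) r :=
    ((M.hasDerivAt_hazard (σ r)).comp r hσ).exp
  have h1 : HasDerivAt (fun r => Real.exp (-M.hazard (σ r - τ r + T)))
      (Real.exp (-M.hazard (σ r - τ r + T)) * -((M.hx Sgn.plus (σ r - τ r + T) +
        M.hx Sgn.minus (σ r - τ r + T)) * (b - a))) r := by
    have h0 : HasDerivAt (fun r => σ r - τ r + T) (b - a) r := (hσ.sub hτ).add_const (T : ℝ)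
    exact ((M.hasDerivAt_hazard (σ r - τ r + T)).comp r h0).neg.exp
  have h2 : ∀ j, HasDerivAt (fun r => ∫ v in τ r..T, M.kern i j (σ r - τ r + v) * M.ageZero T j v)
      ((b - a) * (∫ v in τ r..T, deriv (M.kern i j) (σ r - τ r + v) * M.ageZero T j v) -
        a * (M.kern i j (σ r) * M.ageZero T j (τ r))) r := fun j => by
    have := (hasFDerivAt_integral_shift (M.contDiff_kern i j) (M.continuous_ageZero T j) T
      (σ r - τ r, τ r)).comp_hasDerivAt r hc
    refine this.congr_deriv ?_
    simp only [ContinuousLinearMap.coprod_apply, ContinuousLinearMap.toSpanSingleton_apply,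
      smul_eq_mul, sub_add_cancel]
    ring
  have h3 : HasDerivAt (fun r => M.charPart T i (σ r - τ r, τ r))
      ((b - a) * M.charPartDeriv T i (σ r - τ r, τ r) -
        a * ∑ j : State with ¬ SameBlock i j,
          M.fac j * (M.kern i j (σ r) * M.ageZero T j (τ r))) r := by
    refine (h1.add (HasDerivAt.fun_sum fun j _ => (h2 j).const_mul (M.fac j))).congr_deriv ?_
    simp only [charPartDeriv, mul_add, Finset.mul_sum, mul_sub, Finset.sum_sub_distrib]
    have : ∀ x y z w : ℝ, x = z → y = w → x + y = z + w := fun _ _ _ _ h h' => by rw [h, h']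
    rw [add_sub_assoc]
    refine this _ _ _ _ (by ring) ?_
    congr 1
    · exact Finset.sum_congr rfl fun j _ => by ring
    · exact Finset.sum_congr rfl fun j _ => by ring
  have h4 : Real.exp (M.hazard (σ r)) * ∑ j : State with ¬ SameBlock i j,
      M.fac j * (M.kern i j (σ r) * M.ageZero T j (τ r)) = M.inflow T (τ r) i (σ r) := by
    rw [inflow, Finset.mul_sum]
    refine Finset.sum_congr rfl fun j _ => ?_
    have : Real.exp (M.hazard (σ r)) * Real.exp (-M.hazard (σ r)) = 1 := by
      rw [← Real.exp_add]; simp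
    rw [kern]
    linear_combination (M.fac j * (M.hx (alphaBar ((i : ℤ) + (j : ℤ))) (σ r) *
      M.ageZero T j (τ r))) * this
  refine (hE.mul h3).congr_deriv ?_
  rw [growthD, ← h4, growthS, growth]
  ring

/-- At age zero the growth function is the solution of the Volterra system. -/
lemma growth_zero (T : ℝ≥0) (i : State) {t : ℝ} (ht : t ∈ Icc (0 : ℝ) T) :
    M.growth T t i 0 = M.ageZero T i t := by
  rw [growth, charPart, M.ageZero_eq T i ht]
  simp [neg_add_eq_sub]

lemma growth_terminal (T : ℝ≥0) (i : State) (s : ℝ) : M.growth T T i s = 1 := by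
  simp [growth, charPart, ← Real.exp_add]

/-- The growth function is bounded on `[0, T] × [0, ∞)`. -/
lemma exists_growth_bound (T : ℝ≥0) : ∃ C : ℝ, 0 ≤ C ∧ ∀ t ∈ Icc (0 : ℝ) T, ∀ i, ∀ s, 0 ≤ s →
    |M.growth T t i s| ≤ C := by
  obtain ⟨W, hW0, hW⟩ : ∃ W : ℝ, 0 ≤ W ∧ ∀ j, ∀ t ∈ Icc (0 : ℝ) T, |M.ageZero T j t| ≤ W := by
    have h : ∀ j, ∃ B : ℝ, ∀ y ∈ Icc (0 : ℝ) T, |M.ageZero T j y| ≤ B := fun j => by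
      obtain ⟨B, hB⟩ := isCompact_Icc.exists_bound_of_continuousOn
        (M.continuous_ageZero T j).continuousOn (s := Icc (0 : ℝ) T)
      exact ⟨B, hB⟩
    choose B hB using h
    refine ⟨∑ j, |B j|, by positivity, fun j y hy => (hB j y hy).trans ?_⟩
    exact (le_abs_self _).trans (Finset.single_le_sum (f := fun j => |B j|)
      (fun _ _ => abs_nonneg _) (Finset.mem_univ j))
  have hb := M.hBound_nonneg
  refine ⟨1 + ∑ j : State, 2 * (M.hBound * W * T), by positivity, fun t ht i s hs => ?_⟩
  have hmono : ∀ y, s ≤ y → Real.exp (M.hazard s) * Real.exp (-M.hazard y) ≤ 1 := fun y hy => by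
    rw [← Real.exp_add, Real.exp_le_one_iff]
    have := M.monotoneOn_hazard (mem_Ici.2 hs) (mem_Ici.2 (hs.trans hy)) hy
    linarith
  rw [growth, charPart, mul_add, Finset.mul_sum]
  refine (abs_add_le _ _).trans (add_le_add ?_ ((Finset.abs_sum_le_sum_abs _ _).trans
    ((Finset.sum_le_sum fun j _ => ?_).trans
      (Finset.sum_le_univ_sum_of_nonneg fun j => by positivity))))
  · rw [abs_of_pos (by positivity)]
    exact hmono _ (by linarith [ht.2])
  · rw [mul_left_comm, abs_mul, abs_of_pos (M.fac_pos j), ← intervalIntegral.integral_const_mul]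
    refine mul_le_mul (M.fac_le_two j) ?_ (abs_nonneg _) zero_le_two
    have := intervalIntegral.norm_integral_le_of_norm_le_const (a := t) (b := T)
      (f := fun v => Real.exp (M.hazard s) * (M.kern i j (s - t + v) * M.ageZero T j v))
      (C := M.hBound * W) (fun v hv => by
        rw [uIoc_of_le ht.2] at hv
        have hy : s ≤ s - t + v := by linarith [hv.1]
        rw [kern, M.hx_eq _ (hs.trans hy), Real.norm_eq_abs, show ∀ a b c d : ℝ,
          a * (b * c * d) = (b * (a * c)) * d from fun a b c d => by ring, abs_mul]
        refine mul_le_mul ?_ (hW j v ⟨ht.1.trans hv.1.le, hv.2⟩) (abs_nonneg _) hb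
        have h0 := M.h_nonneg (alphaBar ((i : ℤ) + (j : ℤ))) _ (hs.trans hy)
        rw [abs_of_nonneg (by positivity)]
        calc _ ≤ M.h (alphaBar ((i : ℤ) + (j : ℤ))) (s - t + v) * 1 :=
              mul_le_mul_of_nonneg_left (hmono _ hy) h0
          _ ≤ _ := by rw [mul_one]; exact M.h_le_hBound _ (hs.trans hy))
    refine this.trans (mul_le_mul_of_nonneg_left ?_ (by positivity))
    rw [abs_of_nonneg (by linarith [ht.2])]
    linarith [ht.1]

/-- The function `π(t, p, i, s) = p u(t, i, s)`. -/
def price (T : ℝ≥0) (t p : ℝ) (i : State) (s : ℝ) : ℝ := p * M.growth T t i s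

/-- The derivative of `price` along the characteristics. -/
def priceD (T : ℝ≥0) (t p : ℝ) (i : State) (s : ℝ) : ℝ := p * M.growthD T t i s

lemma continuous_price (T : ℝ≥0) :
    Continuous fun x : ℝ × ℝ × State × ℝ => M.price T x.1 x.2.1 x.2.2.1 x.2.2.2 :=
  continuous_of_forall_state fun i => (by fun_prop : Continuous fun x : ℝ × ℝ × ℝ => x.2.1).mul
    ((M.continuous_growth T i).comp (by fun_prop : Continuous fun x : ℝ × ℝ × ℝ => (x.1, x.2.2)))

lemma continuous_priceD (T : ℝ≥0) :
    Continuous fun x : ℝ × ℝ × State × ℝ => M.priceD T x.1 x.2.1 x.2.2.1 x.2.2.2 :=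
  continuous_of_forall_state fun i => (by fun_prop : Continuous fun x : ℝ × ℝ × ℝ => x.2.1).mul
    ((M.continuous_growthD T i).comp (by fun_prop : Continuous fun x : ℝ × ℝ × ℝ => (x.1, x.2.2)))

lemma hasDerivAt_price_char (T : ℝ≥0) (t p : ℝ) (i : State) (s : ℝ) :
    HasDerivAt (fun r => M.price T (t + r) p i (s + r)) (M.priceD T t p i s) 0 := by
  have := (M.hasDerivAt_growth T i ((hasDerivAt_id (0 : ℝ)).const_add t)
    ((hasDerivAt_id (0 : ℝ)).const_add s)).const_mul p
  refine this.congr_deriv ?_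
  simp [priceD]

/-- Along characteristics, `π` changes at the rate prescribed by the jump part. -/
lemma priceD_add_jumpTerm (T : ℝ≥0) {t : ℝ} (ht : t ∈ Icc (0 : ℝ) T) (p : ℝ) (i : State) {s : ℝ}
    (hs : 0 ≤ s) : M.priceD T t p i s + jumpTerm M (M.price T) t p i s = 0 := by
  simp only [jumpTerm, price, mul_sub, Finset.sum_sub_distrib]
  rw [← Finset.sum_mul, M.sum_hij, priceD, growthD, inflow, M.hx_eq _ hs, M.hx_eq _ hs]
  have : ∑ j : State with ¬ SameBlock i j,
      M.hij i j s * (p * (1 + M.δ * alpha (j : ℤ)) * M.growth T t j 0) =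
      p * ∑ j : State with ¬ SameBlock i j,
        M.fac j * (M.hx (alphaBar ((i : ℤ) + (j : ℤ))) s * M.ageZero T j t) := by
    rw [Finset.mul_sum]
    refine Finset.sum_congr rfl fun j _ => ?_
    rw [M.growth_zero T j ht, M.hx_eq _ hs, hij, fac]
    ring
  rw [this]
  ring

lemma price_terminal (T : ℝ≥0) (p : ℝ) (i : State) (s : ℝ) : M.price T T p i s = p := by
  rw [price, M.growth_terminal, mul_one]

lemma exists_price_bound (T : ℝ≥0) : ∃ C : ℝ, 0 ≤ C ∧ ∀ t p i s, (t, p, i, s) ∈ domain T →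
    |M.price T t p i s| ≤ C * (1 + p) ∧ |M.priceD T t p i s| ≤ C * (1 + p) := by
  obtain ⟨C, hC0, hC⟩ := M.exists_growth_bound T
  have hb := M.hBound_nonneg
  refine ⟨C + 4 * M.hBound * C + ∑ j : State, 2 * (M.hBound * C), by positivity, ?_⟩
  rintro t p i s ⟨ht, hp, hs⟩
  simp only at ht hp hs
  have hu := hC t ht i s hs
  have hS : 0 ≤ ∑ j : State, 2 * (M.hBound * C) := by positivity
  have hbC : 0 ≤ M.hBound * C := by positivity
  constructor
  · rw [price, abs_mul, abs_of_nonneg hp]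
    nlinarith [abs_nonneg (M.growth T t i s)]
  · have h1 : |M.inflow T t i s| ≤ ∑ j : State, 2 * (M.hBound * C) := by
      refine (Finset.abs_sum_le_sum_abs _ _).trans ((Finset.sum_le_sum fun j _ => ?_).trans
        (Finset.sum_le_univ_sum_of_nonneg fun j => by positivity))
      rw [abs_mul, abs_of_pos (M.fac_pos j), abs_mul, M.hx_eq _ hs,
        abs_of_nonneg (M.h_nonneg _ _ hs), ← M.growth_zero T j ht]
      exact mul_le_mul (M.fac_le_two j) (mul_le_mul (M.h_le_hBound _ hs) (hC t ht j 0 le_rfl)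
        (abs_nonneg _) hb) (mul_nonneg (M.h_nonneg _ _ hs) (abs_nonneg _)) zero_le_two
    have h2 : |M.growthD T t i s| ≤ 4 * M.hBound * C + ∑ j : State, 2 * (M.hBound * C) := by
      refine (abs_sub _ _).trans (add_le_add ?_ h1)
      rw [abs_mul, M.hx_eq _ hs, M.hx_eq _ hs, abs_of_pos (M.h_pos s hs)]
      have := M.h_le_hBound Sgn.plus hs
      have := M.h_le_hBound Sgn.minus hs
      exact mul_le_mul (by linarith) hu (abs_nonneg _) (by linarith)
    rw [priceD, abs_mul, abs_of_nonneg hp]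
    have := mul_le_mul_of_nonneg_left h2 hp
    nlinarith

lemma price_inV (T : ℝ≥0) : InV T (M.price T) := by
  refine ⟨(M.continuous_price T).continuousOn, ?_⟩
  obtain ⟨C, -, hC⟩ := M.exists_price_bound T
  refine ⟨C, fun t p i s h => ?_⟩
  have hp : 0 ≤ p := h.2.1
  rw [div_le_iff₀ (by linarith)]
  exact (hC t p i s h).1

lemma hasDerivAt_price_time (T : ℝ≥0) (t p : ℝ) (i : State) (s : ℝ) :
    HasDerivAt (fun r => M.price T r p i s)
      (p * (M.growthD T t i s - M.growthS T t i s)) t := by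
  have := (M.hasDerivAt_growth T i (hasDerivAt_id t) (hasDerivAt_const t s)).const_mul p
  refine this.congr_deriv ?_
  simp

lemma hasDerivAt_price_age (T : ℝ≥0) (t p : ℝ) (i : State) (s : ℝ) :
    HasDerivAt (fun r => M.price T t p i r) (p * M.growthS T t i s) s := by
  have := (M.hasDerivAt_growth T i (hasDerivAt_const s t) (hasDerivAt_id s)).const_mul p
  refine this.congr_deriv ?_
  simp

lemma partialT_price {T : ℝ≥0} (hT : 0 < T) {t : ℝ} (ht : t ∈ Icc (0 : ℝ) T) (p : ℝ) (i : State)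
    (s : ℝ) : partialT T (M.price T) t p i s = p * (M.growthD T t i s - M.growthS T t i s) :=
  (M.hasDerivAt_price_time T t p i s).hasDerivWithinAt.derivWithin
    (uniqueDiffOn_Icc (NNReal.coe_pos.2 hT) t ht)

lemma partialS_price (T : ℝ≥0) (t p : ℝ) (i : State) {s : ℝ} (hs : 0 ≤ s) :
    partialS (M.price T) t p i s = p * M.growthS T t i s :=
  (M.hasDerivAt_price_age T t p i s).hasDerivWithinAt.derivWithin (uniqueDiffOn_Ici 0 s hs)

lemma price_isC11 {T : ℝ≥0} (hT : 0 < T) : IsC11 T (M.price T) (domain T) := by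
  refine ⟨fun t p i s _ =>
    ⟨(M.hasDerivAt_price_time T t p i s).differentiableAt.differentiableWithinAt,
      (M.hasDerivAt_price_age T t p i s).differentiableAt.differentiableWithinAt⟩, ?_, ?_⟩
  · refine ContinuousOn.congr (f := fun x : ℝ × ℝ × State × ℝ =>
      (fun t p i s => p * (M.growthD T t i s - M.growthS T t i s)) x.1 x.2.1 x.2.2.1 x.2.2.2)
      (continuous_of_forall_state
        (φ := fun t p i s => p * (M.growthD T t i s - M.growthS T t i s)) fun i => ?_).continuousOn
      fun x hx => M.partialT_price hT hx.1 _ _ _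
    exact (by fun_prop : Continuous fun x : ℝ × ℝ × ℝ => x.2.1).mul
      (((M.continuous_growthD T i).sub (M.continuous_growthS T i)).comp
        (by fun_prop : Continuous fun x : ℝ × ℝ × ℝ => (x.1, x.2.2)))
  · refine ContinuousOn.congr (f := fun x : ℝ × ℝ × State × ℝ =>
      (fun t p i s => p * M.growthS T t i s) x.1 x.2.1 x.2.2.1 x.2.2.2)
      (continuous_of_forall_state
        (φ := fun t p i s => p * M.growthS T t i s) fun i => ?_).continuousOn
      fun x hx => M.partialS_price _ _ _ _ hx.2.2
    exact (by fun_prop : Continuous fun x : ℝ × ℝ × ℝ => x.2.1).mul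
      ((M.continuous_growthS T i).comp
        (by fun_prop : Continuous fun x : ℝ × ℝ × ℝ => (x.1, x.2.2)))

lemma price_solvesPDE {T : ℝ≥0} (hT : 0 < T) : SolvesPDE M T (M.price T) (domain T) := by
  rintro t p i s ⟨ht, -, hs⟩
  simp only at ht hs
  rw [M.partialT_price hT ht, M.partialS_price _ _ _ _ hs,
    ← M.priceD_add_jumpTerm T ht p i hs, priceD]
  ring

end Model

end

section

/-! ### Uniqueness of solutions of the terminal value problem -/

lemma jumpTerm_sub (M : Model) (φ ψ : ℝ → ℝ → State → ℝ → ℝ) (t p : ℝ) (i : State) (s : ℝ) :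
    jumpTerm M (fun t p i s => φ t p i s - ψ t p i s) t p i s
      = jumpTerm M φ t p i s - jumpTerm M ψ t p i s := by
  simp only [jumpTerm, ← Finset.sum_sub_distrib]
  exact Finset.sum_congr rfl fun j _ => by ring

lemma jumpTerm_eq (M : Model) (φ : ℝ → ℝ → State → ℝ → ℝ) (t p : ℝ) (i : State) (s : ℝ) :
    jumpTerm M φ t p i s = ∑ j : State with ¬ SameBlock i j,
      M.hij i j s * φ t (p * M.fac j) j 0 -
      (M.h Sgn.plus s + M.h Sgn.minus s) * φ t p i s := by
  simp only [jumpTerm, mul_sub, Finset.sum_sub_distrib]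
  rw [← Finset.sum_mul, M.sum_hij]
  rfl

lemma integral_mul_pow_div_factorial (L t T : ℝ) (n : ℕ) :
    ∫ v in t..T, L * ((L * (T - v)) ^ n / n.factorial)
      = (L * (T - t)) ^ (n + 1) / (n + 1).factorial := by
  have hd : ∀ v ∈ uIcc t T, HasDerivAt
      (fun v => -((L * (T - v)) ^ (n + 1) / ((n + 1).factorial : ℝ)))
      (L * ((L * (T - v)) ^ n / n.factorial)) v := fun v _ => by
    have h1 : HasDerivAt (fun v => L * (T - v)) (-L) v := by
      simpa using ((hasDerivAt_id v).const_sub T).const_mul L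
    refine (((h1.pow (n + 1)).div_const ((n + 1).factorial : ℝ)).neg).congr_deriv ?_
    rw [Nat.factorial_succ]
    have : (n.factorial : ℝ) ≠ 0 := by positivity
    have : (n : ℝ) + 1 ≠ 0 := by positivity
    push_cast
    field_simp
  rw [intervalIntegral.integral_eq_sub_of_hasDerivAt hd
    ((by fun_prop : Continuous fun v : ℝ =>
      L * ((L * (T - v)) ^ n / n.factorial)).intervalIntegrable _ _)]
  simp

/-- Variation of constants along a characteristic for a solution of the homogeneous problem with
zero terminal value. -/
lemma eq_integral_along_characteristic (M : Model) {T : ℝ≥0} {ψ : ℝ → ℝ → State → ℝ → ℝ}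
    (hc : ContOn ψ (domain T)) (hψ : SolvesPDEAlongCharacteristics M T ψ)
    (hterm : ∀ p i s, 0 ≤ p → 0 ≤ s → ψ T p i s = 0) {t p : ℝ} {i : State} {s : ℝ}
    (ht : t ∈ Icc (0 : ℝ) T) (hp : 0 < p) (hs : 0 ≤ s) :
    Real.exp (-M.hazard s) * ψ t p i s =
      ∫ v in t..T, Real.exp (-M.hazard (s - t + v)) *
        ∑ j : State with ¬ SameBlock i j, M.hx (alphaBar ((i : ℤ) + (j : ℤ))) (s - t + v) *
          ψ v (p * M.fac j) j 0 := by
  set F : ℝ → ℝ := fun v => Real.exp (-M.hazard (s - t + v)) * ψ v p i (s - t + v) with hF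
  set f : ℝ → ℝ := fun v => Real.exp (-M.hazard (s - t + v)) *
        ∑ j : State with ¬ SameBlock i j, M.hx (alphaBar ((i : ℤ) + (j : ℤ))) (s - t + v) *
          ψ v (p * M.fac j) j 0 with hf
  have hFc : ContinuousOn F (Icc t T) := by
    refine (by fun_prop : Continuous fun v : ℝ =>
      Real.exp (-M.hazard (s - t + v))).continuousOn.mul ?_
    refine ContinuousOn.comp (g := fun x : ℝ × ℝ × State × ℝ => ψ x.1 x.2.1 x.2.2.1 x.2.2.2)
      (f := fun v => (v, p, i, s - t + v)) hc (by fun_prop) fun v hv => ?_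
    exact ⟨⟨ht.1.trans hv.1, hv.2⟩, hp.le, by simpa using by linarith [hv.1]⟩
  have hfc : ContinuousOn f (Icc t T) := by
    refine (by fun_prop : Continuous fun v : ℝ =>
      Real.exp (-M.hazard (s - t + v))).continuousOn.mul (continuousOn_finsetSum _ fun j _ => ?_)
    refine (by fun_prop : Continuous fun v : ℝ =>
      M.hx (alphaBar ((i : ℤ) + (j : ℤ))) (s - t + v)).continuousOn.mul ?_
    refine ContinuousOn.comp (g := fun x : ℝ × ℝ × State × ℝ => ψ x.1 x.2.1 x.2.2.1 x.2.2.2)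
      (f := fun v => (v, p * M.fac j, j, (0 : ℝ))) hc (by fun_prop) fun v hv => ?_
    exact ⟨⟨ht.1.trans hv.1, hv.2⟩, (mul_pos hp (M.fac_pos j)).le, le_rfl⟩
  have hder : ∀ v ∈ Ioo t (T : ℝ), HasDerivAt F (-f v) v := fun v hv => by
    have hy : 0 < s - t + v := by linarith [hv.1]
    obtain ⟨d, hd, hd0⟩ := hψ v p i (s - t + v) ⟨⟨ht.1.trans_lt hv.1, hv.2⟩, hp, hy⟩
    have h1 : HasDerivAt (fun w => ψ w p i (s - t + w)) d v := by
      have := HasDerivAt.comp_sub_const (f := fun r => ψ (v + r) p i (s - t + v + r)) v v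
        (by rw [sub_self]; exact hd)
      refine this.congr_of_eventuallyEq (Eventually.of_forall fun w => ?_)
      simp [add_assoc]
    have h0 : HasDerivAt (fun w => s - t + w) 1 v := (hasDerivAt_id v).const_add _
    have h2 : HasDerivAt (fun w => Real.exp (-M.hazard (s - t + w)))
        (Real.exp (-M.hazard (s - t + v)) *
          -((M.hx Sgn.plus (s - t + v) + M.hx Sgn.minus (s - t + v)) * 1)) v :=
      ((M.hasDerivAt_hazard (s - t + v)).comp v h0).neg.exp
    refine (h2.mul h1).congr_deriv ?_
    rw [jumpTerm_eq] at hd0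
    have hsum : ∑ j : State with ¬ SameBlock i j,
        M.hx (alphaBar ((i : ℤ) + (j : ℤ))) (s - t + v) * ψ v (p * M.fac j) j 0 =
        ∑ j : State with ¬ SameBlock i j, M.hij i j (s - t + v) * ψ v (p * M.fac j) j 0 :=
      Finset.sum_congr rfl fun j _ => by rw [M.hx_eq _ hy.le, Model.hij]
    rw [hf]
    simp only [hsum]
    rw [M.hx_eq _ hy.le, M.hx_eq _ hy.le]
    linear_combination Real.exp (-M.hazard (s - t + v)) * hd0
  have := intervalIntegral.integral_eq_sub_of_hasDerivAt_of_le ht.2 hFc hder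
    (hfc.intervalIntegrable_of_Icc ht.2).neg
  rw [intervalIntegral.integral_neg] at this
  have hT : F T = 0 := by
    simp only [hF]
    rw [hterm p i _ hp.le (by linarith [ht.2]), mul_zero]
  have h0 : F t = Real.exp (-M.hazard s) * ψ t p i s := by simp [hF]
  rw [← h0]
  linarith

/-- Uniqueness for the problem along characteristics: iterating the variation of constants formula
bounds the difference of two solutions by `K (1 + p) (L (T - t)) ^ n / n!` for every `n`. -/
theorem eqOnDomain_price_of_characteristics (M : Model) {T : ℝ≥0} {φ : ℝ → ℝ → State → ℝ → ℝ}
    (hV : InV T φ) (hφ : SolvesPDEAlongCharacteristics M T φ) (hterm : TerminalCondition T φ) :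
    EqOnDomain T φ (M.price T) := by
  set ψ : ℝ → ℝ → State → ℝ → ℝ := fun t p i s => φ t p i s - M.price T t p i s with hψdef
  have hc : ContOn ψ (domain T) := hV.1.sub (M.continuous_price T).continuousOn
  have hψ : SolvesPDEAlongCharacteristics M T ψ := by
    intro t p i s h
    obtain ⟨d, hd, hd0⟩ := hφ t p i s h
    refine ⟨_, hd.sub (M.hasDerivAt_price_char T t p i s), ?_⟩
    rw [hψdef, jumpTerm_sub]
    have := M.priceD_add_jumpTerm T (Ioo_subset_Icc_self h.1) p i h.2.2.le
    simp only at this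
    linarith
  have hψT : ∀ p i s, 0 ≤ p → 0 ≤ s → ψ T p i s = 0 := fun p i s hp hs => by
    simp [hψdef, hterm p i s hp hs, M.price_terminal]
  obtain ⟨K, hK0, hK⟩ : ∃ K : ℝ, 0 ≤ K ∧ ∀ t p i s, (t, p, i, s) ∈ domain T →
      |ψ t p i s| ≤ K * (1 + p) := by
    obtain ⟨C, hC⟩ := hV.2
    obtain ⟨C', hC'0, hC'⟩ := M.exists_price_bound T
    refine ⟨|C| + C', by positivity, fun t p i s h => ?_⟩
    have hp : 0 ≤ p := h.2.1
    have h1 := hC t p i s h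
    rw [div_le_iff₀ (by linarith)] at h1
    refine (abs_sub _ _).trans ?_
    have h2 := (hC' t p i s h).1
    nlinarith [le_abs_self C]
  set c := M.hBound with hcdef
  have hc0 : 0 ≤ c := M.hBound_nonneg
  set L := 4 * c with hL
  have hbound : ∀ n : ℕ, ∀ t p i s, t ∈ Icc (0 : ℝ) T → 0 < p → 0 ≤ s →
      |ψ t p i s| ≤ K * (1 + p) * ((L * (T - t)) ^ n / n.factorial) := by
    intro n
    induction n with
    | zero => intro t p i s ht hp hs; simpa using hK t p i s ⟨ht, hp.le, hs⟩
    | succ n ih =>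
      intro t p i s ht hp hs
      have hrep := eq_integral_along_characteristic M hc hψ hψT (i := i) ht hp hs
      have hest : |Real.exp (-M.hazard s) * ψ t p i s| ≤ ∫ v in t..T,
          (Real.exp (-M.hazard s) * (K * (1 + p))) * (L * ((L * (T - v)) ^ n / n.factorial)) := by
        rw [hrep, ← Real.norm_eq_abs]
        refine intervalIntegral.norm_integral_le_of_norm_le (μ := volume) (E := ℝ) ht.2
          (ae_of_all _ fun v hv => ?_) ((by fun_prop : Continuous fun v : ℝ =>
            (Real.exp (-M.hazard s) * (K * (1 + p))) *
              (L * ((L * (T - v)) ^ n / n.factorial))).intervalIntegrable _ _)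
        have hy : s ≤ s - t + v := by linarith [hv.1]
        have hv0 : v ∈ Icc (0 : ℝ) T := ⟨ht.1.trans hv.1.le, hv.2⟩
        rw [Real.norm_eq_abs, abs_mul, Real.abs_exp, mul_assoc]
        have hG := M.monotoneOn_hazard (mem_Ici.2 hs) (mem_Ici.2 (hs.trans hy)) hy
        refine mul_le_mul (Real.exp_le_exp.2 (by linarith)) ?_ (abs_nonneg _) (by positivity)
        set q := (L * (T - v)) ^ n / (n.factorial : ℝ) with hq
        have hq0 : 0 ≤ q := by
          have : 0 ≤ L * (T - v) := mul_nonneg (by positivity) (by linarith [hv.2])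
          positivity
        calc _ ≤ ∑ j : State with ¬ SameBlock i j,
              M.hij i j (s - t + v) * (K * (2 * (1 + p)) * q) := by
              refine (Finset.abs_sum_le_sum_abs _ _).trans (Finset.sum_le_sum fun j _ => ?_)
              rw [abs_mul, M.hx_eq _ (hs.trans hy),
                abs_of_nonneg (M.h_nonneg _ _ (hs.trans hy))]
              refine mul_le_mul_of_nonneg_left ?_ (M.hij_nonneg i j (hs.trans hy))
              refine (ih v (p * M.fac j) j 0 hv0 (mul_pos hp (M.fac_pos j)) le_rfl).trans ?_
              refine mul_le_mul_of_nonneg_right (mul_le_mul_of_nonneg_left ?_ hK0) hq0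
              nlinarith [M.fac_le_two j]
          _ ≤ (2 * c) * (K * (2 * (1 + p)) * q) := by
              rw [← Finset.sum_mul, M.sum_hij]
              refine mul_le_mul_of_nonneg_right ?_ (by positivity)
              linarith [M.h_le_hBound Sgn.plus (hs.trans hy), M.h_le_hBound Sgn.minus (hs.trans hy)]
          _ = _ := by rw [hL]; ring
      rw [intervalIntegral.integral_const_mul, integral_mul_pow_div_factorial, abs_mul,
        Real.abs_exp, mul_assoc] at hest
      exact le_of_mul_le_mul_left hest (Real.exp_pos _)
  have hzero : ∀ t p i s, t ∈ Icc (0 : ℝ) T → 0 < p → 0 ≤ s → ψ t p i s = 0 := by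
    intro t p i s ht hp hs
    have h1 : Tendsto (fun n : ℕ => K * (1 + p) * ((L * (T - t)) ^ n / n.factorial)) atTop
        (𝓝 (K * (1 + p) * 0)) :=
      (FloorSemiring.tendsto_pow_div_factorial_atTop (L * (T - t))).const_mul _
    rw [mul_zero] at h1
    exact abs_eq_zero.1 (le_antisymm (ge_of_tendsto' h1 fun n => hbound n t p i s ht hp hs)
      (abs_nonneg _))
  rintro t p i s ⟨ht, hp, hs⟩
  simp only at ht hp hs
  suffices ψ t p i s = 0 from sub_eq_zero.1 this
  rcases hp.eq_or_lt with rfl | hp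
  · -- the boundary value at price zero follows by continuity
    have h1 : Tendsto (fun q : ℝ => ψ t q i s) (𝓝[>] 0) (𝓝 (ψ t 0 i s)) := by
      have h2 : ContinuousWithinAt (fun q : ℝ => ψ t q i s) (Ici 0) 0 :=
        ContinuousWithinAt.comp
          (g := fun x : ℝ × ℝ × State × ℝ => ψ x.1 x.2.1 x.2.2.1 x.2.2.2)
          (f := fun q : ℝ => (t, q, i, s)) (hc (t, 0, i, s) ⟨ht, le_rfl, hs⟩)
          (by fun_prop) fun q hq => ⟨ht, hq, hs⟩
      exact h2.tendsto.mono_left (nhdsWithin_mono _ Ioi_subset_Ici_self)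
    refine tendsto_nhds_unique h1 (tendsto_const_nhds.congr' ?_)
    filter_upwards [self_mem_nhdsWithin] with q hq
    exact (hzero t q i s ht hq hs).symm
  · exact hzero t p i s ht hp hs

/-- A classical solution has the derivative along characteristics, because continuous partial
derivatives give joint differentiability in `(t, s)`. -/
lemma SolvesPDE.alongCharacteristics {M : Model} {T : ℝ≥0} {φ : ℝ → ℝ → State → ℝ → ℝ}
    (hC : IsC11 T φ (openDomain T)) (hφ : SolvesPDE M T φ (openDomain T)) :
    SolvesPDEAlongCharacteristics M T φ := by
  intro t p i s h
  have hopen : IsOpen {y : ℝ × ℝ | (y.1, p, i, y.2) ∈ openDomain T} := by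
    have : {y : ℝ × ℝ | (y.1, p, i, y.2) ∈ openDomain T} =
        {y | y.1 ∈ Ioo (0 : ℝ) T} ∩ {y | 0 < y.2} := by
      ext y
      simp only [openDomain, mem_ofPred_eq, mem_inter_iff]
      exact ⟨fun h => ⟨h.1, h.2.2⟩, fun h' => ⟨h'.1, h.2.1, h'.2⟩⟩
    rw [this]
    exact (isOpen_Ioo.preimage continuous_fst).inter (isOpen_Ioi.preimage continuous_snd)
  have hnhds : {y : ℝ × ℝ | (y.1, p, i, y.2) ∈ openDomain T} ∈ 𝓝 (t, s) := hopen.mem_nhds h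
  have hts : Continuous fun a : ℝ => ContinuousLinearMap.toSpanSingleton ℝ (M₁ := ℝ) a :=
    (ContinuousLinearMap.toSpanSingletonCLE (𝕜 := ℝ) (E := ℝ)).continuous
  have hcont : ∀ ψ : ℝ → ℝ → State → ℝ → ℝ, ContOn ψ (openDomain T) →
      ContinuousAt (fun y : ℝ × ℝ => ψ y.1 p i y.2) (t, s) := fun ψ hψ =>
    (ContinuousOn.comp (g := fun x : ℝ × ℝ × State × ℝ => ψ x.1 x.2.1 x.2.2.1 x.2.2.2)
      (f := fun y : ℝ × ℝ => (y.1, p, i, y.2)) hψ (by fun_prop)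
      (s := {y : ℝ × ℝ | (y.1, p, i, y.2) ∈ openDomain T}) fun y hy => hy).continuousAt hnhds
  have key := (hasStrictFDerivAt_uncurry_coprod (𝕜 := ℝ) (u := (t, s))
    (f := fun t s => φ t p i s)
    (f₁ := fun t s => ContinuousLinearMap.toSpanSingleton ℝ (partialT T φ t p i s))
    (f₂ := fun t s => ContinuousLinearMap.toSpanSingleton ℝ (partialS φ t p i s))
    ?_ ?_ (hts.continuousAt.comp (hcont _ hC.2.1)) (hts.continuousAt.comp (hcont _ hC.2.2))
    ).hasFDerivAt
  · have h0 : (t, s) = ((fun r => (t + r, s + r)) (0 : ℝ)) := by simp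
    have hcurve : HasDerivAt (fun r : ℝ => (t + r, s + r)) ((1 : ℝ), (1 : ℝ)) 0 :=
      ((hasDerivAt_id (0 : ℝ)).const_add t).prodMk ((hasDerivAt_id (0 : ℝ)).const_add s)
    have hder := HasFDerivAt.comp_hasDerivAt (0 : ℝ) (h0 ▸ key) hcurve
    refine ⟨_, hder, ?_⟩
    have := hφ t p i s h
    simp only [Function.HasUncurry.uncurry, add_zero, ContinuousLinearMap.coprod_apply,
      ContinuousLinearMap.toSpanSingleton_apply, smul_eq_mul, one_mul, id]
    exact this
  · filter_upwards [hnhds] with y hy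
    exact ((hC.1 _ _ _ _ hy).1.hasDerivWithinAt.hasDerivAt
      (Icc_mem_nhds hy.1.1 hy.1.2)).hasFDerivAt
  · filter_upwards [hnhds] with y hy
    exact ((hC.1 _ _ _ _ hy).2.hasDerivWithinAt.hasDerivAt
      (Ici_mem_nhds hy.2.2)).hasFDerivAt

end

section

/-! ### Lebesgue measure on the half-plane -/

lemma measurableEmbedding_halfPlane :
    MeasurableEmbedding (fun x : ℝ≥0 × ℝ => ((x.1 : ℝ), x.2)) :=
  MeasurableEmbedding.prodMap NNReal.isClosedEmbedding_coe.measurableEmbedding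
    MeasurableEmbedding.id

lemma map_lebesgueHalfPlane :
    lebesgueHalfPlane.map (fun x : ℝ≥0 × ℝ => ((x.1 : ℝ), x.2))
      = (volume : Measure (ℝ × ℝ)).restrict (Ici 0 ×ˢ univ) := by
  rw [lebesgueHalfPlane, measurableEmbedding_halfPlane.map_comap]
  congr 1
  ext ⟨a, b⟩
  simp only [mem_range, Prod.mk.injEq, Prod.exists, mem_prod, mem_Ici, mem_univ, and_true]
  exact ⟨fun ⟨x, y, h, _⟩ => h ▸ x.2, fun h => ⟨⟨a, h⟩, b, rfl, rfl⟩⟩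

lemma lebesgueHalfPlane_prod (J : Set ℝ≥0) (B : Set ℝ) :
    lebesgueHalfPlane (J ×ˢ B) = volume ((fun r : ℝ≥0 => (r : ℝ)) '' J) * volume B := by
  rw [lebesgueHalfPlane, measurableEmbedding_halfPlane.comap_apply, Measure.volume_eq_prod,
    ← Measure.prod_prod]
  congr 1
  ext ⟨a, b⟩
  simp only [mem_image, mem_prod, Prod.exists, Prod.mk.injEq]
  constructor
  · rintro ⟨x, y, ⟨hx, hy⟩, rfl, rfl⟩
    exact ⟨⟨x, hx, rfl⟩, hy⟩
  · rintro ⟨⟨x, hx, rfl⟩, hb⟩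
    exact ⟨x, b, ⟨hx, hb⟩, rfl, rfl⟩

lemma lebesgueHalfPlane_zero (B : Set ℝ) : lebesgueHalfPlane ({0} ×ˢ B) = 0 := by
  rw [lebesgueHalfPlane_prod]
  simp

lemma lebesgueHalfPlane_lt_top {J : Set ℝ≥0} {b : ℝ≥0} (hJ : J ⊆ Iic b) {B : Set ℝ}
    (hB : volume B ≠ ∞) : lebesgueHalfPlane (J ×ˢ B) < ∞ := by
  rw [lebesgueHalfPlane_prod]
  refine ENNReal.mul_lt_top ?_ hB.lt_top
  calc _ ≤ volume (Icc (0 : ℝ) b) := by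
        refine measure_mono ?_
        rintro _ ⟨x, hx, rfl⟩
        exact ⟨x.2, NNReal.coe_le_coe.2 (hJ hx)⟩
    _ < ∞ := measure_Icc_lt_top

/-- The rectangles `[0, n] × [-n, n]`, which exhaust the half-plane. -/
def box (n : ℕ) : Set (ℝ≥0 × ℝ) := Iic (n : ℝ≥0) ×ˢ Icc (-(n : ℝ)) n

lemma measurableSet_box (n : ℕ) : MeasurableSet (box n) := measurableSet_Iic.prod measurableSet_Icc

lemma iUnion_box : ⋃ n, box n = univ := by
  refine eq_univ_of_forall fun x => ?_
  obtain ⟨n, hn⟩ := exists_nat_ge x.1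
  obtain ⟨m, hm⟩ := exists_nat_ge |x.2|
  rw [mem_iUnion]
  refine ⟨max n m, ⟨?_, ?_, ?_⟩⟩
  · exact hn.trans (by exact_mod_cast le_max_left n m)
  · have : (m : ℝ) ≤ (max n m : ℕ) := by exact_mod_cast le_max_right n m
    linarith [neg_abs_le x.2]
  · have : (m : ℝ) ≤ (max n m : ℕ) := by exact_mod_cast le_max_right n m
    linarith [le_abs_self x.2]

lemma lebesgueHalfPlane_box_lt_top (n : ℕ) : lebesgueHalfPlane (box n) < ∞ :=
  lebesgueHalfPlane_lt_top le_rfl measure_Icc_lt_top.ne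

instance : SigmaFinite lebesgueHalfPlane :=
  ⟨⟨⟨box, fun _ => trivial, lebesgueHalfPlane_box_lt_top, iUnion_box⟩⟩⟩

/-! ### The compensation formula -/

lemma lintegral_natCast_poissonMeasure (r : ℝ≥0) :
    ∫⁻ n : ℕ, (n : ℝ≥0∞) ∂(poissonMeasure r) = r := by
  have hsum : HasSum (fun n : ℕ => Real.exp (-r) * r ^ n / n.factorial * n) (r : ℝ) := by
    rw [← hasSum_nat_add_iff' 1]
    simp only [Finset.range_one, Finset.sum_singleton, Nat.cast_zero, mul_zero, sub_zero]
    have := (hasSum_one_poissonMeasure r).mul_left (r : ℝ)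
    rw [mul_one] at this
    refine this.congr_fun ?_ |> id
    intro n
    rw [Nat.factorial_succ]
    have : (n.factorial : ℝ) ≠ 0 := by positivity
    have : (n : ℝ) + 1 ≠ 0 := by positivity
    push_cast
    field_simp
    ring
  rw [poissonMeasure, lintegral_sum_measure]
  simp only [lintegral_smul_measure, lintegral_dirac, smul_eq_mul]
  have : ∀ n : ℕ, ENNReal.ofReal (Real.exp (-r) * r ^ n / n.factorial) * (n : ℝ≥0∞)
      = ENNReal.ofReal (Real.exp (-r) * r ^ n / n.factorial * n) := fun n => by
    rw [ENNReal.ofReal_mul (by positivity), ENNReal.ofReal_natCast]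
  simp_rw [this]
  rw [← ENNReal.ofReal_tsum_of_nonneg (fun n => by positivity) hsum.summable, hsum.tsum_eq,
    ENNReal.ofReal_coe_nnreal]

variable {Ω : Type*} [mΩ : MeasurableSpace Ω]

/-- A kernel of pointwise finite measures is s-finite: split according to the integer part of the
total mass. -/
lemma isSFiniteKernel_of_forall_lt_top {X : Type*} [MeasurableSpace X] (κ : Kernel Ω X)
    (h : ∀ ω, κ ω univ < ∞) : IsSFiniteKernel κ := by
  classical
  have hm : ∀ n : ℕ, MeasurableSet {ω | ⌊(κ ω univ).toReal⌋₊ = n} := fun n =>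
    (Nat.measurable_floor.comp (κ.measurable_coe MeasurableSet.univ).ennreal_toReal)
      (measurableSet_singleton n)
  have hκ : κ = Kernel.sum fun n => Kernel.piecewise (hm n) κ 0 := by
    refine Kernel.ext fun ω => ?_
    rw [Kernel.sum_apply]
    refine Measure.ext fun s hs => ?_
    rw [Measure.sum_apply _ hs, tsum_eq_single ⌊(κ ω univ).toReal⌋₊]
    · rw [Kernel.piecewise_apply, if_pos (by exact rfl)]
    · intro n hn
      rw [Kernel.piecewise_apply, if_neg (fun h' => hn h'.symm)]
      simp
  rw [hκ]
  have : ∀ n, IsSFiniteKernel (Kernel.piecewise (hm n) κ 0) := fun n => by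
    have : IsFiniteKernel (Kernel.piecewise (hm n) κ 0) := by
      refine ⟨(n : ℝ≥0∞) + 1, by finiteness, fun ω => ?_⟩
      rw [Kernel.piecewise_apply]
      split_ifs with h'
      · have h' : ⌊(κ ω univ).toReal⌋₊ = n := h'
        have h1 := (Nat.lt_floor_add_one (κ ω univ).toReal).le
        rw [h'] at h1
        rw [← ENNReal.ofReal_toReal (h ω).ne]
        refine (ENNReal.ofReal_le_ofReal h1).trans ?_
        rw [ENNReal.ofReal_add (by positivity) zero_le_one]
        simp
      · simp
    infer_instance
  exact Kernel.isSFiniteKernel_sum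

/-- The rectangles `F × (J × B)` that generate the predictable σ-algebra on `Ω × [0, ∞) × ℝ`:
either `J = (s, t]` and `F` is known at time `s`, or `J = {0}` and `F` is known at time `0`. -/
def predictableRectangles (ℱ : Filtration ℝ≥0 mΩ) : Set (Set (Ω × ℝ≥0 × ℝ)) :=
  {A | ∃ (F : Set Ω) (J : Set ℝ≥0) (B : Set ℝ), MeasurableSet B ∧ volume B ≠ ∞ ∧
    (MeasurableSet[ℱ 0] F ∧ J = {0} ∨ ∃ s t, MeasurableSet[ℱ s] F ∧ J = Ioc s t) ∧
    A = F ×ˢ (J ×ˢ B)}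

/-- The predictable σ-algebra on `Ω × [0, ∞) × ℝ`. -/
@[reducible] def predictableSpace (ℱ : Filtration ℝ≥0 mΩ) : MeasurableSpace (Ω × ℝ≥0 × ℝ) :=
  MeasurableSpace.generateFrom (predictableRectangles ℱ)

lemma isPiSystem_predictableRectangles (ℱ : Filtration ℝ≥0 mΩ) :
    IsPiSystem (predictableRectangles ℱ) := by
  rintro _ ⟨F, J, B, hB, hBv, hFJ, rfl⟩ _ ⟨F', J', B', hB', hBv', hFJ', rfl⟩ -
  refine ⟨F ∩ F', J ∩ J', B ∩ B', hB.inter hB',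
    (measure_mono_top inter_subset_left).mt hBv, ?_, by rw [prod_inter_prod, prod_inter_prod]⟩
  rcases hFJ with ⟨hF, rfl⟩ | ⟨s, t, hF, rfl⟩ <;> rcases hFJ' with ⟨hF', rfl⟩ | ⟨s', t', hF', rfl⟩
  · exact Or.inl ⟨hF.inter hF', by simp⟩
  · refine Or.inr ⟨s', s', (ℱ.mono (zero_le) _ hF).inter hF', ?_⟩
    rw [Ioc_self, singleton_inter_eq_empty]
    simp
  · refine Or.inr ⟨s, s, hF.inter (ℱ.mono (zero_le) _ hF'), ?_⟩
    rw [Ioc_self, inter_singleton_eq_empty]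
    simp
  · exact Or.inr ⟨max s s', min t t', (ℱ.mono (le_max_left _ _) _ hF).inter
      (ℱ.mono (le_max_right _ _) _ hF'), by rw [Ioc_inter_Ioc]⟩

lemma predictableSpace_le (ℱ : Filtration ℝ≥0 mΩ) :
    predictableSpace ℱ ≤ (inferInstance : MeasurableSpace (Ω × ℝ≥0 × ℝ)) := by
  refine MeasurableSpace.generateFrom_le ?_
  rintro _ ⟨F, J, B, hB, -, hFJ, rfl⟩
  rcases hFJ with ⟨hF, rfl⟩ | ⟨s, t, hF, rfl⟩
  · exact (ℱ.le _ _ hF).prod ((measurableSet_singleton _).prod hB)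
  · exact (ℱ.le _ _ hF).prod (measurableSet_Ioc.prod hB)

/-- The information carried by the points of `N` after time `s`. -/
@[reducible] def futureSpace (N : Ω → Measure (ℝ≥0 × ℝ)) (s : ℝ≥0) : MeasurableSpace Ω :=
  ⨆ A ∈ {A : Set (ℝ≥0 × ℝ) | MeasurableSet A ∧ A ⊆ Set.Ioi s ×ˢ Set.univ},
    MeasurableSpace.comap (fun ω => N ω A) inferInstance

namespace IsPoissonRandomMeasure

variable {μ : Measure Ω} {ℱ : Filtration ℝ≥0 mΩ} {N : Ω → Measure (ℝ≥0 × ℝ)}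

lemma measurable_apply (hN : IsPoissonRandomMeasure μ ℱ N) {A : Set (ℝ≥0 × ℝ)}
    (hA : MeasurableSet A) : Measurable fun ω => N ω A :=
  (Measure.measurable_coe hA).comp hN.measurable

lemma lintegral_apply (hN : IsPoissonRandomMeasure μ ℱ N) {A : Set (ℝ≥0 × ℝ)}
    (hA : MeasurableSet A) (hA' : lebesgueHalfPlane A ≠ ∞) :
    ∫⁻ ω, N ω A ∂μ = lebesgueHalfPlane A := by
  have h1 : ∫⁻ y, y ∂(μ.map fun ω => N ω A) = ∫⁻ ω, N ω A ∂μ :=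
    lintegral_map measurable_id (hN.measurable_apply hA)
  rw [← h1, hN.poisson A hA hA', lintegral_map (f := fun y => y) measurable_id (by fun_prop),
    lintegral_natCast_poissonMeasure, ENNReal.coe_toNNReal hA']

lemma setLIntegral_future (hN : IsPoissonRandomMeasure μ ℱ N) {s : ℝ≥0} {F : Set Ω}
    (hF : MeasurableSet[ℱ s] F) {A : Set (ℝ≥0 × ℝ)} (hA : MeasurableSet A)
    (hA' : lebesgueHalfPlane A ≠ ∞) (hAs : A ⊆ Ioi s ×ˢ univ) :
    ∫⁻ ω in F, N ω A ∂μ = μ F * lebesgueHalfPlane A := by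
  have hF' := ℱ.le s _ hF
  have hle : futureSpace N s ≤ mΩ := iSup₂_le fun A hA => (hN.measurable_apply hA.1).comap_le
  have hmeas : Measurable[futureSpace N s] fun ω => N ω A := by
    have : MeasurableSpace.comap (fun ω => N ω A) inferInstance ≤ futureSpace N s :=
      le_iSup₂_of_le (f := fun (A : Set (ℝ≥0 × ℝ))
        (_ : A ∈ {A : Set (ℝ≥0 × ℝ) | MeasurableSet A ∧ A ⊆ Set.Ioi s ×ˢ Set.univ}) =>
        MeasurableSpace.comap (fun ω => N ω A) inferInstance) A ⟨hA, hAs⟩ le_rfl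
    exact (comap_measurable _).mono this le_rfl
  have hFm : Measurable[ℱ s] (F.indicator (1 : Ω → ℝ≥0∞)) :=
    Measurable.indicator measurable_const hF
  have h := lintegral_mul_eq_lintegral_mul_lintegral_of_independent_measurableSpace
    (μ := μ) (f := F.indicator 1) (g := fun ω => N ω A) (ℱ.le s) hle (hN.future_indep s)
    hFm hmeas
  rw [hN.lintegral_apply hA hA', lintegral_indicator_one hF'] at h
  rw [← h, ← lintegral_indicator hF']
  refine lintegral_congr fun ω => ?_
  by_cases hω : ω ∈ F <;> simp [hω]

/-- On every box, the random measure is almost surely finite. -/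
lemma ae_box_lt_top (hN : IsPoissonRandomMeasure μ ℱ N) : ∀ᵐ ω ∂μ, ∀ n, N ω (box n) < ∞ := by
  rw [ae_all_iff]
  intro n
  refine ae_lt_top (hN.measurable_apply (measurableSet_box n)) ?_
  rw [hN.lintegral_apply (measurableSet_box n) (lebesgueHalfPlane_box_lt_top n).ne]
  exact (lebesgueHalfPlane_box_lt_top n).ne

open Classical in
/-- The random measure as a kernel, with the null set on which it is not locally finite removed;
this makes the kernel s-finite. -/
def kernel (hN : IsPoissonRandomMeasure μ ℱ N) : Kernel Ω (ℝ≥0 × ℝ) where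
  toFun ω := if ∀ n, N ω (box n) < ∞ then N ω else 0
  measurable' := by
    refine Measurable.ite ?_ hN.measurable measurable_const
    rw [ofPred_forall]
    exact MeasurableSet.iInter fun n =>
      measurableSet_lt (hN.measurable_apply (measurableSet_box n)) measurable_const

lemma kernel_ae_eq (hN : IsPoissonRandomMeasure μ ℱ N) : ∀ᵐ ω ∂μ, hN.kernel ω = N ω := by
  filter_upwards [hN.ae_box_lt_top] with ω hω
  exact if_pos hω

instance (hN : IsPoissonRandomMeasure μ ℱ N) : IsSFiniteKernel hN.kernel := by
  have hbox : ∀ ω n, hN.kernel ω (box n) < ∞ := fun ω n => by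
    by_cases h : ∀ n, N ω (box n) < ∞
    · rw [show hN.kernel ω = N ω from if_pos h]
      exact h n
    · rw [show hN.kernel ω = 0 from if_neg h]
      simp
  have hd : ∀ n, MeasurableSet (disjointed box n) :=
    MeasurableSet.disjointed measurableSet_box
  have hκ : hN.kernel = Kernel.sum fun n => hN.kernel.restrict (hd n) := by
    refine Kernel.ext fun ω => ?_
    rw [Kernel.sum_apply]
    simp only [Kernel.restrict_apply]
    rw [← Measure.restrict_iUnion (disjoint_disjointed _) hd, iUnion_disjointed, iUnion_box,
      Measure.restrict_univ]
  rw [hκ]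
  have : ∀ n, IsSFiniteKernel (hN.kernel.restrict (hd n)) := fun n => by
    refine isSFiniteKernel_of_forall_lt_top _ fun ω => ?_
    rw [Kernel.restrict_apply, Measure.restrict_apply_univ]
    exact (measure_mono (disjointed_subset _ _)).trans_lt (hbox ω n)
  exact Kernel.isSFiniteKernel_sum

/-- On predictable sets the random measure has the same mean as Lebesgue measure. -/
lemma trim_compProd_kernel [IsProbabilityMeasure μ] (hN : IsPoissonRandomMeasure μ ℱ N) :
    (μ ⊗ₘ hN.kernel).trim (predictableSpace_le ℱ) =
      (μ.prod lebesgueHalfPlane).trim (predictableSpace_le ℱ) := by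
  have hval : ∀ A ∈ predictableRectangles ℱ,
      (μ ⊗ₘ hN.kernel) A = (μ.prod lebesgueHalfPlane) A := by
    rintro _ ⟨F, J, B, hB, hBv, hFJ, rfl⟩
    have hF : MeasurableSet F := by
      rcases hFJ with ⟨hF, rfl⟩ | ⟨s, t, hF, rfl⟩
      · exact ℱ.le _ _ hF
      · exact ℱ.le _ _ hF
    have hJ : MeasurableSet J := by
      rcases hFJ with ⟨hF, rfl⟩ | ⟨s, t, hF, rfl⟩
      · exact measurableSet_singleton _
      · exact measurableSet_Ioc
    rw [Measure.compProd_apply_prod hF (hJ.prod hB), Measure.prod_prod]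
    have : ∫⁻ ω in F, hN.kernel ω (J ×ˢ B) ∂μ = ∫⁻ ω in F, N ω (J ×ˢ B) ∂μ := by
      refine lintegral_congr_ae (ae_restrict_of_ae ?_)
      filter_upwards [hN.kernel_ae_eq] with ω hω
      rw [hω]
    rw [this]
    rcases hFJ with ⟨hF, rfl⟩ | ⟨s, t, hF, rfl⟩
    · rw [lebesgueHalfPlane_zero, mul_zero]
      refine le_antisymm ((setLIntegral_le_lintegral _ _).trans ?_) (zero_le)
      rw [hN.lintegral_apply (hJ.prod hB) (by rw [lebesgueHalfPlane_zero]; simp),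
        lebesgueHalfPlane_zero]
    · exact hN.setLIntegral_future hF (hJ.prod hB)
        (lebesgueHalfPlane_lt_top (b := t) (fun x hx => hx.2) hBv).ne
        (prod_mono (fun x hx => hx.1) (subset_univ _))
  have hmeas : ∀ A ∈ predictableRectangles ℱ, MeasurableSet[predictableSpace ℱ] A :=
    fun A hA => MeasurableSpace.measurableSet_generateFrom hA
  set T₁ : Set (Set (Ω × ℝ≥0 × ℝ)) :=
    range fun n : ℕ => (univ : Set Ω) ×ˢ (({0} : Set ℝ≥0) ×ˢ Icc (-(n : ℝ)) n)
  set T₂ : Set (Set (Ω × ℝ≥0 × ℝ)) :=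
    range fun n : ℕ => (univ : Set Ω) ×ˢ ((Ioc (0 : ℝ≥0) n) ×ˢ Icc (-(n : ℝ)) n)
  have hsub : T₁ ∪ T₂ ⊆ predictableRectangles ℱ := by
    rintro _ (⟨n, rfl⟩ | ⟨n, rfl⟩)
    · exact ⟨univ, {0}, _, measurableSet_Icc, measure_Icc_lt_top.ne,
        Or.inl ⟨MeasurableSet.univ, rfl⟩, rfl⟩
    · exact ⟨univ, _, _, measurableSet_Icc, measure_Icc_lt_top.ne,
        Or.inr ⟨0, n, MeasurableSet.univ, rfl⟩, rfl⟩
  refine Measure.ext_of_generateFrom_of_cover_subset (S := predictableRectangles ℱ)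
    (T := T₁ ∪ T₂) rfl (isPiSystem_predictableRectangles ℱ) hsub
    ((countable_range _).union (countable_range _)) ?_ ?_ ?_
  · refine eq_univ_of_forall fun x => ?_
    have hx : x.2 ∈ ⋃ n, box n := by rw [iUnion_box]; trivial
    obtain ⟨n, hn1, hn2⟩ := mem_iUnion.1 hx
    rcases eq_or_ne x.2.1 0 with h0 | h0
    · exact ⟨_, Or.inl ⟨n, rfl⟩, trivial, h0, hn2⟩
    · exact ⟨_, Or.inr ⟨n, rfl⟩, trivial, ⟨pos_iff_ne_zero.2 h0, hn1⟩, hn2⟩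
  · intro A hA
    rw [trim_measurableSet_eq _ (hmeas A (hsub hA)), hval A (hsub hA)]
    rcases hA with ⟨n, rfl⟩ | ⟨n, rfl⟩
    · simp only [Measure.prod_prod, lebesgueHalfPlane_zero]
      simp
    · simp only [Measure.prod_prod, measure_univ, one_mul]
      exact (lebesgueHalfPlane_lt_top (b := (n : ℝ≥0)) (fun x hx => hx.2)
        measure_Icc_lt_top.ne).ne
  · intro A hA
    rw [trim_measurableSet_eq _ (hmeas A hA), trim_measurableSet_eq _ (hmeas A hA), hval A hA]

/-- The compensation formula for non-negative predictable integrands. -/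
theorem lintegral_lintegral [IsProbabilityMeasure μ] (hN : IsPoissonRandomMeasure μ ℱ N)
    {f : Ω × ℝ≥0 × ℝ → ℝ≥0∞} (hf : Measurable[predictableSpace ℱ] f) :
    ∫⁻ ω, ∫⁻ x, f (ω, x) ∂(N ω) ∂μ = ∫⁻ ω, ∫⁻ x, f (ω, x) ∂lebesgueHalfPlane ∂μ := by
  have hf' : Measurable f := hf.mono (predictableSpace_le ℱ) le_rfl
  have h := congrArg (fun m => @lintegral _ (predictableSpace ℱ) m f) hN.trim_compProd_kernel
  rw [lintegral_trim _ hf, lintegral_trim _ hf, Measure.lintegral_compProd hf',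
    lintegral_prod _ hf'.aemeasurable] at h
  rw [← h]
  refine lintegral_congr_ae ?_
  filter_upwards [hN.kernel_ae_eq] with ω hω
  rw [hω]

/-- The compensation formula for integrable predictable integrands. -/
theorem integral_integral [IsProbabilityMeasure μ] (hN : IsPoissonRandomMeasure μ ℱ N)
    {f : Ω × ℝ≥0 × ℝ → ℝ} (hf : Measurable[predictableSpace ℱ] f)
    (hint : Integrable f (μ.prod lebesgueHalfPlane)) :
    Integrable (fun ω => ∫ x, f (ω, x) ∂(N ω)) μ ∧
      ∫ ω, ∫ x, f (ω, x) ∂(N ω) ∂μ = ∫ ω, ∫ x, f (ω, x) ∂lebesgueHalfPlane ∂μ := by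
  have h := congrArg (fun m => @integral _ _ _ _ (predictableSpace ℱ) m f) hN.trim_compProd_kernel
  have hint' : Integrable f (μ ⊗ₘ hN.kernel) := by
    refine integrable_of_integrable_trim (predictableSpace_le ℱ) ?_
    rw [hN.trim_compProd_kernel]
    exact hint.trim _ hf.stronglyMeasurable
  rw [← integral_trim _ hf.stronglyMeasurable, ← integral_trim _ hf.stronglyMeasurable,
    Measure.integral_compProd hint', integral_prod _ hint] at h
  have hae : (fun ω => ∫ x, f (ω, x) ∂(hN.kernel ω)) =ᵐ[μ] fun ω => ∫ x, f (ω, x) ∂(N ω) := by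
    filter_upwards [hN.kernel_ae_eq] with ω hω
    rw [hω]
  refine ⟨Integrable.congr ?_ hae, by rw [← h]; exact (integral_congr_ae hae).symm⟩
  exact Integrable.integral_compProd (κ := Kernel.const Unit μ)
    (η := Kernel.prodMkLeft Unit hN.kernel) (a := ()) hint'

end IsPoissonRandomMeasure

end

section

/-! ### The change-of-variables formula along a path -/

/-- The change of `φ(t, p, i, s)` caused by a point at height `z`: the sum over `j ≢ i` of
`φ(t, p(1 + δα(j)), j, 0) - φ(t, p, i, s)` if `z ∈ H_ij(s)`. -/
def jumpDiff (M : Model) (φ : ℝ → ℝ → State → ℝ → ℝ) (t p : ℝ) (i : State) (s z : ℝ) : ℝ :=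
  ∑ j : State with ¬ SameBlock i j,
    (φ t (p * M.fac j) j 0 - φ t p i s) * (M.Hij i j s).indicator (fun _ => (1 : ℝ)) z

namespace Model

variable (M : Model)

lemma mul_g₃_eq_jumpDiff (t p : ℝ) (i : State) (s z : ℝ) :
    p * M.g₃ i s z = jumpDiff M (fun _ p _ _ => p) t p i s z := by
  rw [g₃, jumpDiff, Finset.mul_sum]
  exact Finset.sum_congr rfl fun j _ => by rw [fac]; ring

/-- The set `H(s) = H_+(s) ∪ H_-(s)`. -/
def HUnion (s : ℝ) : Set ℝ := M.H Sgn.plus s ∪ M.H Sgn.minus s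

lemma Hij_subset (i j : State) (s : ℝ) : M.Hij i j s ⊆ M.HUnion s := by
  rw [Hij, HUnion]
  cases alphaBar ((i : ℤ) + (j : ℤ))
  · exact subset_union_left
  · exact subset_union_right

lemma sum_indicator_Hij (i : State) {s : ℝ} (hs : 0 ≤ s) (z : ℝ) :
    ∑ j : State with ¬ SameBlock i j, (M.Hij i j s).indicator (fun _ => (1 : ℝ)) z =
      (M.HUnion s).indicator (fun _ => (1 : ℝ)) z := by
  rw [HUnion, indicator_union_of_disjoint (M.H_disjoint s hs)]
  exact sum_targets i fun ν => (M.H ν s).indicator (fun _ => (1 : ℝ)) z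

lemma neg_g₁_eq_jumpDiff (t p : ℝ) (i : State) {s : ℝ} (hs : 0 ≤ s) (z : ℝ) :
    -M.g₁ i s z = jumpDiff M (fun _ _ _ s => s) t p i s z := by
  rw [g₁, jumpDiff, ← Finset.mul_sum, M.sum_indicator_Hij i hs, HUnion]
  ring

lemma measurableSet_H (ν : Sgn) {s : ℝ} (hs : 0 ≤ s) : MeasurableSet (M.H ν s) := by
  obtain ⟨a, ha⟩ := M.H_interval ν s hs
  rw [ha]
  exact measurableSet_Ico

lemma measurableSet_Hij (i j : State) {s : ℝ} (hs : 0 ≤ s) : MeasurableSet (M.Hij i j s) :=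
  M.measurableSet_H _ hs

lemma volume_Hij (i j : State) {s : ℝ} (hs : 0 ≤ s) :
    volume (M.Hij i j s) = ENNReal.ofReal (M.hij i j s) := by
  obtain ⟨a, ha⟩ := M.H_interval (alphaBar ((i : ℤ) + (j : ℤ))) s hs
  rw [Hij, ha, Real.volume_Ico, hij, add_sub_cancel_left]

end Model

lemma jumpDiff_eq_zero (M : Model) (φ : ℝ → ℝ → State → ℝ → ℝ) (t p : ℝ) (i : State) {s z : ℝ}
    (hz : z ∉ M.HUnion s) : jumpDiff M φ t p i s z = 0 :=
  Finset.sum_eq_zero fun j _ => by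
    rw [indicator_of_notMem fun h => hz (M.Hij_subset i j s h), mul_zero]

/-- Integrating the jumps over the heights gives the jump part of the equation. -/
lemma integral_jumpDiff (M : Model) (φ : ℝ → ℝ → State → ℝ → ℝ) (t p : ℝ) (i : State) {s : ℝ}
    (hs : 0 ≤ s) : ∫ z, jumpDiff M φ t p i s z = jumpTerm M φ t p i s := by
  have hfin : ∀ j, volume (M.Hij i j s) ≠ ∞ := fun j => by simp [M.volume_Hij i j hs]
  simp only [jumpDiff]
  rw [integral_finsetSum]
  · refine Finset.sum_congr rfl fun j _ => ?_
    rw [integral_const_mul, integral_indicator (M.measurableSet_Hij i j hs), setIntegral_const,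
      measureReal_def, M.volume_Hij i j hs, ENNReal.toReal_ofReal (M.hij_nonneg i j hs),
      smul_eq_mul, mul_one, mul_comm]
    rfl
  · exact fun j _ => ((integrable_indicator_iff (M.measurableSet_Hij i j hs)).2
      (integrableOn_const (hfin j))).const_mul _

/-- The left limit of a path in `[0, ∞)`, as a number in `[0, ∞)`. -/
abbrev leftVal (f : ℝ≥0 → ℝ≥0) (t : ℝ≥0) : ℝ≥0 := Function.leftLim f t

/-- The jumps of `φ` along the path `(p, i, s)`, as a function of the points. -/
def jumpAlong (M : Model) (φ : ℝ → ℝ → State → ℝ → ℝ) (p : ℝ≥0 → ℝ≥0) (i : ℝ≥0 → State)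
    (s : ℝ≥0 → ℝ≥0) (x : ℝ≥0 × ℝ) : ℝ :=
  jumpDiff M φ x.1 (leftVal p x.1) (Function.leftLim i x.1) (leftVal s x.1) x.2

/-- The points that make a path with ages `s` jump. -/
def activeSet (M : Model) (s : ℝ≥0 → ℝ≥0) : Set (ℝ≥0 × ℝ) :=
  {x | x.2 ∈ M.HUnion (leftVal s x.1)}

/-- `(p, i, s)` is a path driven by the points of `n`: only finitely many points are active up to
any time, and price, state and age are the sums of their jumps, plus the passing time for the
age. -/
structure IsJumpPath (M : Model) (n : Measure (ℝ≥0 × ℝ)) (p : ℝ≥0 → ℝ≥0) (i : ℝ≥0 → State)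
    (s : ℝ≥0 → ℝ≥0) : Prop where
  measurableSet_active : MeasurableSet (activeSet M s)
  integer_valued : ∀ A, MeasurableSet A → ∃ k : ℕ∞, n A = (k : ℝ≥0∞)
  finite : ∀ t, n (activeSet M s ∩ Ioc 0 t ×ˢ univ) < ∞
  price_eq : ∀ t, IntegrableOn (jumpAlong M (fun _ p _ _ => p) p i s) (Ioc 0 t ×ˢ univ) n ∧
    (p t : ℝ) = p 0 + ∫ x in Ioc 0 t ×ˢ univ, jumpAlong M (fun _ p _ _ => p) p i s x ∂n
  state_eq : ∀ t, IntegrableOn (jumpAlong M (fun _ _ i _ => ((i : ℤ) : ℝ)) p i s)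
      (Ioc 0 t ×ˢ univ) n ∧
    ((i t : ℤ) : ℝ) = ((i 0 : ℤ) : ℝ) +
      ∫ x in Ioc 0 t ×ˢ univ, jumpAlong M (fun _ _ i _ => ((i : ℤ) : ℝ)) p i s x ∂n
  age_eq : ∀ t, IntegrableOn (jumpAlong M (fun _ _ _ s => s) p i s) (Ioc 0 t ×ˢ univ) n ∧
    (s t : ℝ) = s 0 + t + ∫ x in Ioc 0 t ×ˢ univ, jumpAlong M (fun _ _ _ s => s) p i s x ∂n

namespace IsJumpPath

variable {M : Model} {n : Measure (ℝ≥0 × ℝ)} {p : ℝ≥0 → ℝ≥0} {i : ℝ≥0 → State} {s : ℝ≥0 → ℝ≥0}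

lemma eq_zero_of_lt_one (h : IsJumpPath M n p i s) {A : Set (ℝ≥0 × ℝ)} (hA : MeasurableSet A)
    (h1 : n A < 1) : n A = 0 := by
  obtain ⟨k, hk⟩ := h.integer_valued A hA
  rw [hk] at h1 ⊢
  have : k < 1 := by exact_mod_cast h1
  rw [Order.lt_one_iff.1 this]
  simp

/-- Integer-valuedness turns continuity from above into extinction. -/
lemma exists_null (h : IsJumpPath M n p i s) {A : ℕ → Set ℝ≥0} (hA : ∀ k, MeasurableSet (A k))
    (hanti : Antitone A) {t : ℝ≥0} (hAt : ∀ k, A k ⊆ Ioc 0 t) (hempty : ⋂ k, A k = ∅) :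
    ∃ k, n (activeSet M s ∩ A k ×ˢ univ) = 0 := by
  have hm : ∀ k, MeasurableSet (activeSet M s ∩ A k ×ˢ univ) := fun k =>
    h.measurableSet_active.inter ((hA k).prod MeasurableSet.univ)
  have hlim := tendsto_measure_iInter_atTop (μ := n)
    (s := fun k => activeSet M s ∩ A k ×ˢ (univ : Set ℝ)) (fun k => (hm k).nullMeasurableSet)
    (fun k l hkl => inter_subset_inter_right _ (Set.prod_mono_left (hanti hkl)))
    ⟨0, ((measure_mono (inter_subset_inter_right _ (Set.prod_mono_left (hAt 0)))).trans_lt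
      (h.finite t)).ne⟩
  have he : ⋂ k, activeSet M s ∩ A k ×ˢ (univ : Set ℝ) = ∅ := by
    rw [eq_empty_iff_forall_notMem]
    intro x hx
    have : x.1 ∈ ⋂ k, A k := mem_iInter.2 fun k => ((mem_iInter.1 hx k).2).1
    rw [hempty] at this
    exact this
  rw [he, measure_empty] at hlim
  obtain ⟨k, hk⟩ := (hlim.eventually (gt_mem_nhds zero_lt_one)).exists
  exact ⟨k, h.eq_zero_of_lt_one (hm k) hk⟩

lemma exists_gap_right (h : IsJumpPath M n p i s) (t : ℝ≥0) :
    ∃ u, t < u ∧ n (activeSet M s ∩ Ioc t u ×ˢ univ) = 0 := by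
  obtain ⟨u, hanti, hu, hlim⟩ := exists_seq_strictAnti_tendsto t
  obtain ⟨k, hk⟩ := h.exists_null (A := fun k => Ioc t (u k)) (t := u 0)
    (fun k => measurableSet_Ioc) (fun k l hkl => Ioc_subset_Ioc_right (hanti.antitone hkl))
    (fun k => Ioc_subset_Ioc (zero_le) (hanti.antitone (Nat.zero_le k))) (by
      rw [eq_empty_iff_forall_notMem]
      intro x hx
      have hx' := fun k => (mem_iInter.1 hx k)
      exact absurd (ge_of_tendsto' hlim fun k => (hx' k).2) (not_le.2 (hx' 0).1))
  exact ⟨u k, hu k, hk⟩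

lemma exists_gap_left (h : IsJumpPath M n p i s) {t : ℝ≥0} (ht : 0 < t) :
    ∃ u, u < t ∧ n (activeSet M s ∩ Ioo u t ×ˢ univ) = 0 := by
  obtain ⟨u, hmono, hu, hlim⟩ := exists_seq_strictMono_tendsto' ht
  obtain ⟨k, hk⟩ := h.exists_null (A := fun k => Ioo (u k) t) (t := t)
    (fun k => measurableSet_Ioo) (fun k l hkl => Ioo_subset_Ioo_left (hmono.monotone hkl))
    (fun k x hx => ⟨zero_le.trans_lt hx.1, hx.2.le⟩) (by
      rw [eq_empty_iff_forall_notMem]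
      intro x hx
      have hx' := fun k => (mem_iInter.1 hx k)
      exact absurd (le_of_tendsto' hlim fun k => (hx' k).1.le) (not_le.2 (hx' 0).2))
  exact ⟨u k, (hu k).2, hk⟩

/-- No jumps occur in a set of times without active points. -/
lemma jumpAlong_ae_eq_zero {A : Set ℝ≥0} (hA : MeasurableSet A)
    (h0 : n (activeSet M s ∩ A ×ˢ univ) = 0) (φ : ℝ → ℝ → State → ℝ → ℝ) :
    jumpAlong M φ p i s =ᵐ[n.restrict (A ×ˢ univ)] 0 := by
  rw [Filter.EventuallyEq, ae_restrict_iff' (hA.prod MeasurableSet.univ), ae_iff]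
  refine measure_mono_null (fun x hx => ?_) h0
  have hx' : x ∈ A ×ˢ univ ∧ jumpAlong M φ p i s x ≠ 0 := by simpa using hx
  refine ⟨?_, hx'.1⟩
  by_contra hz
  exact hx'.2 (jumpDiff_eq_zero M φ _ _ _ hz)

lemma integrableOn_of_gap {A : Set ℝ≥0} (hA : MeasurableSet A)
    (h0 : n (activeSet M s ∩ A ×ˢ univ) = 0) (φ : ℝ → ℝ → State → ℝ → ℝ) :
    IntegrableOn (jumpAlong M φ p i s) (A ×ˢ univ) n :=
  (integrable_zero _ _ _).congr (jumpAlong_ae_eq_zero hA h0 φ).symm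

lemma setIntegral_of_gap {A : Set ℝ≥0} (hA : MeasurableSet A)
    (h0 : n (activeSet M s ∩ A ×ˢ univ) = 0) (φ : ℝ → ℝ → State → ℝ → ℝ) :
    ∫ x in A ×ˢ univ, jumpAlong M φ p i s x ∂n = 0 := by
  rw [integral_congr_ae (jumpAlong_ae_eq_zero hA h0 φ)]
  simp

lemma setIntegral_Ioc_add {f : ℝ≥0 × ℝ → ℝ} {a b c : ℝ≥0} (hab : a ≤ b) (hbc : b ≤ c)
    (hf : IntegrableOn f (Ioc a c ×ˢ univ) n) :
    ∫ x in Ioc a c ×ˢ univ, f x ∂n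
      = ∫ x in Ioc a b ×ˢ univ, f x ∂n + ∫ x in Ioc b c ×ˢ univ, f x ∂n := by
  rw [← Ioc_union_Ioc_eq_Ioc hab hbc, union_prod] at hf ⊢
  refine setIntegral_union ?_ (measurableSet_Ioc.prod MeasurableSet.univ)
    (hf.mono_set subset_union_left) (hf.mono_set subset_union_right)
  rw [Set.disjoint_prod]
  exact Or.inl (Ioc_disjoint_Ioc_of_le le_rfl)

lemma eq_of_gap (h : IsJumpPath M n p i s) {a r : ℝ≥0} (har : a ≤ r)
    (h0 : n (activeSet M s ∩ Ioc a r ×ˢ univ) = 0) :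
    p r = p a ∧ i r = i a ∧ (s r : ℝ) = s a + (r - a) := by
  have hJ := fun φ => setIntegral_of_gap (p := p) (i := i) measurableSet_Ioc h0 φ
  refine ⟨?_, ?_, ?_⟩
  · have h1 := (h.price_eq r).2
    rw [setIntegral_Ioc_add zero_le har (h.price_eq r).1, hJ, add_zero,
      ← (h.price_eq a).2] at h1
    exact_mod_cast h1
  · have h1 := (h.state_eq r).2
    rw [setIntegral_Ioc_add zero_le har (h.state_eq r).1, hJ, add_zero,
      ← (h.state_eq a).2] at h1
    exact Subtype.ext (by exact_mod_cast h1)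
  · have h1 := (h.age_eq r).2
    have h2 := (h.age_eq a).2
    rw [setIntegral_Ioc_add zero_le har (h.age_eq r).1, hJ, add_zero] at h1
    linarith

/-- After an active-free gap the left limits lie on the same characteristic. -/
lemma leftLim_of_gap (h : IsJumpPath M n p i s) {a t : ℝ≥0}
    (h0 : n (activeSet M s ∩ Ioo a t ×ˢ univ) = 0) {r : ℝ≥0} (hr : r ∈ Ioo a t) :
    leftVal p t = p r ∧ Function.leftLim i t = i r ∧
      (leftVal s t : ℝ) = s r + (t - r) := by
  have hne : (𝓝[<] t).NeBot := nhdsLT_neBot_of_exists_lt ⟨r, hr.2⟩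
  have hev : ∀ᶠ v in 𝓝[<] t, v ∈ Ioo r t := Ioo_mem_nhdsLT hr.2
  have key : ∀ v ∈ Ioo r t, p v = p r ∧ i v = i r ∧ (s v : ℝ) = s r + (v - r) := fun v hv =>
    h.eq_of_gap hv.1.le (measure_mono_null (inter_subset_inter_right _ (Set.prod_mono_left
      (show Ioc r v ⊆ Ioo a t from fun x hx => ⟨hr.1.trans hx.1, hx.2.trans_lt hv.2⟩))) h0)
  refine ⟨leftLim_eq_of_tendsto (tendsto_const_nhds.congr' ?_),
    leftLim_eq_of_tendsto (tendsto_const_nhds.congr' ?_), ?_⟩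
  · filter_upwards [hev] with v hv using (key v hv).1.symm
  · filter_upwards [hev] with v hv using (key v hv).2.1.symm
  · have hlim : Tendsto s (𝓝[<] t) (𝓝 (s r + (t - r))) := by
      have h1 : Tendsto (fun v : ℝ≥0 => s r + (v - r)) (𝓝[<] t) (𝓝 (s r + (t - r))) :=
        ((by fun_prop : Continuous fun v : ℝ≥0 => s r + (v - r)).tendsto t).mono_left
          nhdsWithin_le_nhds
      refine h1.congr' ?_
      filter_upwards [hev] with v hv
      rw [← NNReal.coe_inj, (key v hv).2.2, NNReal.coe_add, NNReal.coe_sub hv.1.le]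
    rw [show leftVal s t = s r + (t - r) from leftLim_eq_of_tendsto hlim, NNReal.coe_add,
      NNReal.coe_sub hr.2.le]

lemma leftLim_age_pos (h : IsJumpPath M n p i s) {t : ℝ≥0} (ht : 0 < t) :
    0 < leftVal s t := by
  obtain ⟨u, hut, h0⟩ := h.exists_gap_left ht
  obtain ⟨r, hr⟩ := exists_between hut
  rw [← NNReal.coe_pos, (h.leftLim_of_gap h0 hr).2.2]
  have : (r : ℝ) < t := hr.2
  have := (s r).2
  linarith

/-- The mass of the points at time `t` that cause a jump into state `j`. -/
def atom (M : Model) (n : Measure (ℝ≥0 × ℝ)) (i : ℝ≥0 → State) (s : ℝ≥0 → ℝ≥0) (t : ℝ≥0)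
    (j : State) : ℝ :=
  n.real ({t} ×ˢ M.Hij (Function.leftLim i t) j (leftVal s t))

lemma atom_lt_top (h : IsJumpPath M n p i s) {t : ℝ≥0} (ht : 0 < t) (k j : State) :
    n ({t} ×ˢ M.Hij k j (leftVal s t)) < ∞ := by
  refine (measure_mono ?_).trans_lt (h.finite t)
  rintro ⟨v, z⟩ ⟨hv, hz⟩
  simp only [mem_singleton_iff] at hv
  subst hv
  exact ⟨M.Hij_subset _ _ _ hz, ⟨ht, le_rfl⟩, trivial⟩

lemma exists_atom_eq_nat (h : IsJumpPath M n p i s) {t : ℝ≥0} (ht : 0 < t) (j : State) :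
    ∃ k : ℕ, atom M n i s t j = k := by
  obtain ⟨k, hk⟩ := h.integer_valued ({t} ×ˢ M.Hij (Function.leftLim i t) j (leftVal s t))
    ((measurableSet_singleton t).prod (M.measurableSet_Hij _ _ (NNReal.coe_nonneg _)))
  have hfin := h.atom_lt_top ht (Function.leftLim i t) j
  rw [hk] at hfin
  lift k to ℕ using (by rintro rfl; simp at hfin)
  exact ⟨k, by rw [atom, measureReal_def, hk]; simp⟩

lemma jumpAlong_atom (M : Model) (φ : ℝ → ℝ → State → ℝ → ℝ) (p : ℝ≥0 → ℝ≥0) (i : ℝ≥0 → State)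
    (s : ℝ≥0 → ℝ≥0) (t : ℝ≥0) : EqOn (jumpAlong M φ p i s)
      (fun x => ∑ j : State with ¬ SameBlock (Function.leftLim i t) j,
        (φ t (leftVal p t * M.fac j) j 0 -
          φ t (leftVal p t) (Function.leftLim i t) (leftVal s t)) *
        ({t} ×ˢ M.Hij (Function.leftLim i t) j (leftVal s t)).indicator
          (fun _ => (1 : ℝ)) x) ({t} ×ˢ univ) := by
  rintro ⟨v, z⟩ ⟨hv, -⟩
  simp only [mem_singleton_iff] at hv
  subst hv
  simp only [jumpAlong, jumpDiff]
  refine Finset.sum_congr rfl fun j _ => ?_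
  congr 1
  by_cases hz : z ∈ M.Hij (Function.leftLim i v) j (leftVal s v)
  · rw [indicator_of_mem hz, indicator_of_mem (by exact ⟨rfl, hz⟩)]
  · rw [indicator_of_notMem hz, indicator_of_notMem fun h => hz h.2]

lemma integrable_atom (h : IsJumpPath M n p i s) {t : ℝ≥0} (ht : 0 < t) (c : ℝ) (k j : State) :
    Integrable (fun x => c * ({t} ×ˢ M.Hij k j (leftVal s t)).indicator
      (fun _ => (1 : ℝ)) x) n := by
  have hm : MeasurableSet (({t} : Set ℝ≥0) ×ˢ M.Hij k j (leftVal s t)) :=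
    (measurableSet_singleton t).prod (M.measurableSet_Hij _ _ (NNReal.coe_nonneg _))
  exact ((integrable_indicator_iff hm).2
    (integrableOn_const (h.atom_lt_top ht k j).ne)).const_mul c

lemma integrableOn_atom (h : IsJumpPath M n p i s) {t : ℝ≥0} (ht : 0 < t)
    (φ : ℝ → ℝ → State → ℝ → ℝ) : IntegrableOn (jumpAlong M φ p i s) ({t} ×ˢ univ) n := by
  rw [integrableOn_congr_fun (jumpAlong_atom M φ p i s t)
    ((measurableSet_singleton t).prod MeasurableSet.univ)]
  exact (integrable_finsetSum _ fun j _ => h.integrable_atom ht _ _ j).integrableOn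

lemma setIntegral_atom (h : IsJumpPath M n p i s) {t : ℝ≥0} (ht : 0 < t)
    (φ : ℝ → ℝ → State → ℝ → ℝ) : ∫ x in {t} ×ˢ univ, jumpAlong M φ p i s x ∂n =
      ∑ j : State with ¬ SameBlock (Function.leftLim i t) j,
        (φ t (leftVal p t * M.fac j) j 0 -
          φ t (leftVal p t) (Function.leftLim i t) (leftVal s t)) *
        atom M n i s t j := by
  rw [setIntegral_congr_fun ((measurableSet_singleton t).prod MeasurableSet.univ)
    (jumpAlong_atom M φ p i s t), integral_finsetSum _ fun j _ =>
      (h.integrable_atom ht _ _ j).integrableOn]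
  refine Finset.sum_congr rfl fun j _ => ?_
  have hm : MeasurableSet (({t} : Set ℝ≥0) ×ˢ M.Hij (Function.leftLim i t) j
      (leftVal s t)) :=
    (measurableSet_singleton t).prod (M.measurableSet_Hij _ _ (NNReal.coe_nonneg _))
  rw [integral_const_mul, integral_indicator hm, setIntegral_const, smul_eq_mul, mul_one, atom,
    measureReal_restrict_apply hm,
    inter_eq_self_of_subset_left (Set.prod_mono_right (subset_univ _))]

lemma integrableOn_Ioc_and_setIntegral (h : IsJumpPath M n p i s) {r t : ℝ≥0} (hrt : r < t)
    (h0 : n (activeSet M s ∩ Ioo r t ×ˢ univ) = 0) (φ : ℝ → ℝ → State → ℝ → ℝ) :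
    IntegrableOn (jumpAlong M φ p i s) (Ioc r t ×ˢ univ) n ∧
      ∫ x in Ioc r t ×ˢ univ, jumpAlong M φ p i s x ∂n =
        ∫ x in {t} ×ˢ univ, jumpAlong M φ p i s x ∂n := by
  have h1 := integrableOn_of_gap (p := p) (i := i) measurableSet_Ioo h0 φ
  have h2 := h.integrableOn_atom (zero_le.trans_lt hrt) φ
  rw [← Ioo_union_right hrt, union_prod]
  refine ⟨h1.union h2, ?_⟩
  rw [setIntegral_union ?_ ((measurableSet_singleton t).prod MeasurableSet.univ) h1 h2,
    setIntegral_of_gap measurableSet_Ioo h0, zero_add]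
  rw [Set.disjoint_prod]
  exact Or.inl (by simp)

/-- The ages being non-negative, at most one point can be active at any time; hence the jump of
any function of the path is the integral over the points at that time. -/
lemma setIntegral_atom_eq (h : IsJumpPath M n p i s) {t : ℝ≥0} (ht : 0 < t)
    (φ : ℝ → ℝ → State → ℝ → ℝ) : ∫ x in {t} ×ˢ univ, jumpAlong M φ p i s x ∂n =
      φ t (p t) (i t) (s t) -
        φ t (leftVal p t) (Function.leftLim i t) (leftVal s t) := by
  obtain ⟨u, hut, h0⟩ := h.exists_gap_left ht
  obtain ⟨r, hr⟩ := exists_between hut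
  obtain ⟨hp, hi, hs⟩ := h.leftLim_of_gap h0 hr
  have h0' : n (activeSet M s ∩ Ioo r t ×ˢ univ) = 0 :=
    measure_mono_null (inter_subset_inter_right _ (Set.prod_mono_left
      (Ioo_subset_Ioo_left hr.1.le))) h0
  have hJ := fun φ => (h.integrableOn_Ioc_and_setIntegral hr.2 h0' φ).2
  have h1 : (p t : ℝ) = leftVal p t +
      ∫ x in {t} ×ˢ univ, jumpAlong M (fun _ p _ _ => p) p i s x ∂n := by
    rw [(h.price_eq t).2, setIntegral_Ioc_add zero_le hr.2.le (h.price_eq t).1, hJ, ← add_assoc,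
      ← (h.price_eq r).2, hp]
  have h2 : ((i t : ℤ) : ℝ) = (((Function.leftLim i t : State) : ℤ) : ℝ) +
      ∫ x in {t} ×ˢ univ, jumpAlong M (fun _ _ i _ => ((i : ℤ) : ℝ)) p i s x ∂n := by
    rw [(h.state_eq t).2, setIntegral_Ioc_add zero_le hr.2.le (h.state_eq t).1, hJ, ← add_assoc,
      ← (h.state_eq r).2, hi]
  have h3 : (s t : ℝ) = leftVal s t +
      ∫ x in {t} ×ˢ univ, jumpAlong M (fun _ _ _ s => s) p i s x ∂n := by
    have e1 := (h.age_eq t).2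
    rw [setIntegral_Ioc_add zero_le hr.2.le (h.age_eq t).1, hJ] at e1
    have e2 := (h.age_eq r).2
    linarith
  rw [h.setIntegral_atom ht] at h1 h2 h3 ⊢
  obtain ⟨j, k, hjk, hset, -, -⟩ := exists_targets (Function.leftLim i t)
  rw [hset, Finset.sum_pair hjk] at h1 h2 h3 ⊢
  obtain ⟨a, ha⟩ := h.exists_atom_eq_nat ht j
  obtain ⟨b, hb⟩ := h.exists_atom_eq_nat ht k
  rw [ha, hb] at h1 h2 h3 ⊢
  have hpos : (0 : ℝ) < leftVal s t := NNReal.coe_pos.2 (h.leftLim_age_pos ht)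
  -- the age after `a + b` simultaneous jumps would be `(1 - (a + b))` times the age before them
  have hab : a + b ≤ 1 := by
    by_contra hlt
    have h4 : (2 : ℝ) ≤ a + b := by exact_mod_cast (show 2 ≤ a + b by omega)
    have h5 := (s t).2
    have h6 : (s t : ℝ) = leftVal s t * (1 - (a + b)) := by rw [h3]; ring
    have : (leftVal s t : ℝ) * (1 - (a + b)) < 0 :=
      mul_neg_of_pos_of_neg hpos (by linarith)
    have : (0 : ℝ) ≤ s t := h5
    linarith
  have hcases : a = 0 ∧ b = 0 ∨ a = 1 ∧ b = 0 ∨ a = 0 ∧ b = 1 := by omega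
  rcases hcases with ⟨rfl, rfl⟩ | ⟨rfl, rfl⟩ | ⟨rfl, rfl⟩ <;>
    simp only [Nat.cast_zero, Nat.cast_one, mul_zero, mul_one, add_zero, zero_add,
      add_sub_cancel] at h1 h2 h3 ⊢ <;>
    rw [h1, h3, Subtype.ext (by exact_mod_cast h2) (a1 := i t)]
  ring

lemma leftLim_eq_of_gap (h : IsJumpPath M n p i s) {a v : ℝ≥0} (hav : a < v)
    (h0 : n (activeSet M s ∩ Ioo a v ×ˢ univ) = 0) :
    leftVal p v = p a ∧ Function.leftLim i v = i a ∧ (leftVal s v : ℝ) = s a + (v - a) := by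
  obtain ⟨r, hr⟩ := exists_between hav
  obtain ⟨h1, h2, h3⟩ := h.leftLim_of_gap h0 hr
  obtain ⟨e1, e2, e3⟩ := h.eq_of_gap hr.1.le (measure_mono_null (inter_subset_inter_right _
    (Set.prod_mono_left (show Ioc a r ⊆ Ioo a v from fun x hx => ⟨hx.1, hx.2.trans_lt hr.2⟩))) h0)
  exact ⟨h1.trans e1, h2.trans e2, by rw [h3, e3]; ring⟩

/-- The values of `d` at the left limits of the path, as a function of real time. -/
def along (d : ℝ → ℝ → State → ℝ → ℝ) (p : ℝ≥0 → ℝ≥0) (i : ℝ≥0 → State) (s : ℝ≥0 → ℝ≥0)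
    (v : ℝ) : ℝ :=
  d v (leftVal p v.toNNReal) (Function.leftLim i v.toNNReal) (leftVal s v.toNNReal)

lemma intervalIntegral_of_gap (h : IsJumpPath M n p i s) {φ d : ℝ → ℝ → State → ℝ → ℝ}
    (hd : Continuous fun x : ℝ × ℝ × State × ℝ => d x.1 x.2.1 x.2.2.1 x.2.2.2)
    (hφ : ∀ t p i s, HasDerivAt (fun r => φ (t + r) p i (s + r)) (d t p i s) 0)
    {a b : ℝ≥0} (hab : a ≤ b) (h0 : n (activeSet M s ∩ Ioo a b ×ˢ univ) = 0) :
    IntervalIntegrable (along d p i s) volume a b ∧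
      ∫ v in (a : ℝ)..b, along d p i s v =
        φ b (p a) (i a) (s a + (b - a)) - φ a (p a) (i a) (s a) := by
  have hc : Continuous fun v : ℝ => d v (p a) (i a) (s a - a + v) :=
    hd.comp (by fun_prop : Continuous fun v : ℝ => (v, (p a : ℝ), i a, (s a - a + v : ℝ)))
  have heq : EqOn (fun v : ℝ => d v (p a) (i a) (s a - a + v)) (along d p i s)
      (uIoc (a : ℝ) b) := by
    intro v hv
    rw [uIoc_of_le (by exact_mod_cast hab)] at hv
    have hv0 : (0 : ℝ) ≤ v := a.2.trans hv.1.le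
    have hva : a < v.toNNReal := by rw [← NNReal.coe_lt_coe, Real.coe_toNNReal _ hv0]; exact hv.1
    have hvb : v.toNNReal ≤ b := by rw [← NNReal.coe_le_coe, Real.coe_toNNReal _ hv0]; exact hv.2
    obtain ⟨e1, e2, e3⟩ := h.leftLim_eq_of_gap hva (measure_mono_null (inter_subset_inter_right _
      (Set.prod_mono_left (Ioo_subset_Ioo_right hvb))) h0)
    simp only [along]
    rw [e1, e2, e3, Real.coe_toNNReal _ hv0]
    ring_nf
  refine ⟨(hc.intervalIntegrable _ _).congr heq, ?_⟩
  rw [← intervalIntegral.integral_congr_ae (ae_of_all _ fun v hv => heq hv)]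
  have hder : ∀ v ∈ uIcc (a : ℝ) b, HasDerivAt (fun v => φ v (p a) (i a) (s a - a + v))
      (d v (p a) (i a) (s a - a + v)) v := fun v _ => by
    have := HasDerivAt.comp_sub_const (f := fun r => φ (v + r) (p a) (i a) (s a - a + v + r)) v v
      (by rw [sub_self]; exact hφ _ _ _ _)
    refine this.congr_of_eventuallyEq (Eventually.of_forall fun w => ?_)
    simp [add_assoc]
  rw [intervalIntegral.integral_eq_sub_of_hasDerivAt hder (hc.intervalIntegrable _ _)]
  ring_nf

/-- The change-of-variables formula on the time interval `(a, b]`, including the existence of the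
two integrals in it. -/
def ChangeOfVariables (M : Model) (n : Measure (ℝ≥0 × ℝ)) (p : ℝ≥0 → ℝ≥0) (i : ℝ≥0 → State)
    (s : ℝ≥0 → ℝ≥0) (φ d : ℝ → ℝ → State → ℝ → ℝ) (a b : ℝ≥0) : Prop :=
  IntervalIntegrable (along d p i s) volume a b ∧
    IntegrableOn (jumpAlong M φ p i s) (Ioc a b ×ˢ univ) n ∧
    φ b (p b) (i b) (s b) - φ a (p a) (i a) (s a) = (∫ v in (a : ℝ)..b, along d p i s v) +
      ∫ x in Ioc a b ×ˢ univ, jumpAlong M φ p i s x ∂n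

lemma ChangeOfVariables.trans {φ d : ℝ → ℝ → State → ℝ → ℝ} {a b c : ℝ≥0} (hab : a ≤ b)
    (hbc : b ≤ c) (h1 : ChangeOfVariables M n p i s φ d a b)
    (h2 : ChangeOfVariables M n p i s φ d b c) : ChangeOfVariables M n p i s φ d a c := by
  have hint : IntegrableOn (jumpAlong M φ p i s) (Ioc a c ×ˢ univ) n := by
    rw [← Ioc_union_Ioc_eq_Ioc hab hbc, union_prod]
    exact h1.2.1.union h2.2.1
  refine ⟨h1.1.trans h2.1, hint, ?_⟩
  rw [setIntegral_Ioc_add hab hbc hint,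
    ← intervalIntegral.integral_add_adjacent_intervals h1.1 h2.1]
  linarith [h1.2.2, h2.2.2]

lemma ChangeOfVariables.of_trans {φ d : ℝ → ℝ → State → ℝ → ℝ} {a b c : ℝ≥0} (hab : a ≤ b)
    (hbc : b ≤ c) (h1 : ChangeOfVariables M n p i s φ d a c)
    (h2 : ChangeOfVariables M n p i s φ d b c) : ChangeOfVariables M n p i s φ d a b := by
  have hi : IntervalIntegrable (along d p i s) volume a b := h1.1.trans h2.1.symm
  refine ⟨hi, h1.2.1.mono_set (Set.prod_mono_left (Ioc_subset_Ioc_right hbc)), ?_⟩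
  have e1 := h1.2.2
  rw [setIntegral_Ioc_add hab hbc h1.2.1,
    ← intervalIntegral.integral_add_adjacent_intervals hi h2.1] at e1
  linarith [h2.2.2]

/-- The change-of-variables formula. It holds on short intervals to the right and to the left of
every time, hence on every interval. -/
theorem changeOfVariables (h : IsJumpPath M n p i s) {φ d : ℝ → ℝ → State → ℝ → ℝ}
    (hd : Continuous fun x : ℝ × ℝ × State × ℝ => d x.1 x.2.1 x.2.2.1 x.2.2.2)
    (hφ : ∀ t p i s, HasDerivAt (fun r => φ (t + r) p i (s + r)) (d t p i s) 0)
    {a b : ℝ≥0} (hab : a ≤ b) : ChangeOfVariables M n p i s φ d a b := by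
  have hright : ∀ t, ∃ u, t < u ∧ ∀ r ∈ Icc t u, ChangeOfVariables M n p i s φ d t r := by
    intro t
    obtain ⟨u, htu, h0⟩ := h.exists_gap_right t
    refine ⟨u, htu, fun r hr => ?_⟩
    have h0' : n (activeSet M s ∩ Ioc t r ×ˢ univ) = 0 := measure_mono_null
      (inter_subset_inter_right _ (Set.prod_mono_left (Ioc_subset_Ioc_right hr.2))) h0
    obtain ⟨e1, e2⟩ := h.intervalIntegral_of_gap hd hφ hr.1 (measure_mono_null
      (inter_subset_inter_right _ (Set.prod_mono_left Ioo_subset_Ioc_self)) h0')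
    refine ⟨e1, integrableOn_of_gap measurableSet_Ioc h0' φ, ?_⟩
    obtain ⟨f1, f2, f3⟩ := h.eq_of_gap hr.1 h0'
    rw [e2, setIntegral_of_gap measurableSet_Ioc h0', f1, f2, f3, add_zero]
  have hleft : ∀ t, 0 < t → ∃ u, u < t ∧ ∀ r ∈ Ioo u t, ChangeOfVariables M n p i s φ d r t := by
    intro t ht
    obtain ⟨u, hut, h0⟩ := h.exists_gap_left ht
    refine ⟨u, hut, fun r hr => ?_⟩
    have h0' : n (activeSet M s ∩ Ioo r t ×ˢ univ) = 0 := measure_mono_null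
      (inter_subset_inter_right _ (Set.prod_mono_left (Ioo_subset_Ioo_left hr.1.le))) h0
    obtain ⟨e1, e2⟩ := h.intervalIntegral_of_gap hd hφ hr.2.le h0'
    obtain ⟨e3, e4⟩ := h.integrableOn_Ioc_and_setIntegral hr.2 h0' φ
    refine ⟨e1, e3, ?_⟩
    obtain ⟨f1, f2, f3⟩ := h.leftLim_eq_of_gap hr.2 h0'
    rw [e2, e4, h.setIntegral_atom_eq ht, f1, f2, f3]
    ring
  have hrefl : ChangeOfVariables M n p i s φ d a a := by
    obtain ⟨u, hu, hQ⟩ := hright a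
    exact hQ a ⟨le_rfl, hu.le⟩
  set A : Set ℝ≥0 := {t | ChangeOfVariables M n p i s φ d a t} with hA
  have hclosed : IsClosed (A ∩ Icc a b) := by
    refine isClosed_of_closure_subset fun t ht => ?_
    have htab : t ∈ Icc a b :=
      closure_minimal inter_subset_right isClosed_Icc ht
    refine ⟨?_, htab⟩
    rcases htab.1.eq_or_lt with rfl | hat
    · exact hrefl
    obtain ⟨w, htw, hw⟩ := hright t
    obtain ⟨u, hut, hu⟩ := hleft t (zero_le.trans_lt hat)
    obtain ⟨r, hr, hrA⟩ := mem_closure_iff.1 ht (Ioo u w) isOpen_Ioo ⟨hut, htw⟩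
    rcases lt_trichotomy r t with hrt | rfl | hrt
    · exact hrA.1.trans hrA.2.1 hrt.le (hu r ⟨hr.1, hrt⟩)
    · exact hrA.1
    · exact hrA.1.of_trans hat.le hrt.le (hw r ⟨hrt.le, hr.2.le⟩)
  have := hclosed.Icc_subset_of_forall_exists_gt hrefl fun t ht y hy => by
    obtain ⟨w, htw, hw⟩ := hright t
    have hlt : t < min w y := lt_min htw hy
    exact ⟨min w y, ChangeOfVariables.trans ht.2.1 hlt.le ht.1
      (hw _ ⟨hlt.le, min_le_left _ _⟩), hlt, min_le_right _ _⟩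
  exact this ⟨hab, le_rfl⟩

end IsJumpPath

end

section

/-! ### Predictability of the left limits -/

variable {Ω : Type*} [mΩ : MeasurableSpace Ω]

lemma leftLim_zero {E : Type*} [TopologicalSpace E] (f : ℝ≥0 → E) :
    Function.leftLim f 0 = f 0 :=
  leftLim_eq_of_isBot fun _ => zero_le

lemma IsCadlagPath.tendsto_leftLim {E : Type*} [TopologicalSpace E] {f : ℝ≥0 → E}
    (hf : IsCadlagPath f) (t : ℝ≥0) : Tendsto f (𝓝[<] t) (𝓝 (Function.leftLim f t)) :=
  tendsto_leftLim_of_tendsto (hf t).2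

lemma IsCadlagPath.leftLim_coe {f : ℝ≥0 → ℝ≥0} (hf : IsCadlagPath f) (t : ℝ≥0) :
    Function.leftLim (fun v => (f v : ℝ)) t = (leftVal f t : ℝ) := by
  rcases eq_zero_or_pos t with rfl | ht
  · rw [leftLim_zero, leftVal, leftLim_zero]
  · have : (𝓝[<] t).NeBot := nhdsLT_neBot_of_exists_lt ⟨0, ht⟩
    exact leftLim_eq_of_tendsto
      ((NNReal.continuous_coe.tendsto _).comp (hf.tendsto_leftLim t))

/-- A rectangle with unrestricted heights is predictable. -/
lemma measurableSet_predictable_Ioc (ℱ : Filtration ℝ≥0 mΩ) {F : Set Ω} {s t : ℝ≥0}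
    (hF : MeasurableSet[ℱ s] F) {B : Set ℝ} (hB : MeasurableSet B) :
    MeasurableSet[predictableSpace ℱ] (F ×ˢ (Ioc s t ×ˢ B)) := by
  have : F ×ˢ (Ioc s t ×ˢ B) = ⋃ m : ℕ, F ×ˢ (Ioc s t ×ˢ (B ∩ Icc (-(m : ℝ)) m)) := by
    ext ⟨ω, v, z⟩
    simp only [Set.mem_prod, mem_iUnion, mem_inter_iff]
    constructor
    · rintro ⟨h1, h2, h3⟩
      obtain ⟨m, hm⟩ := exists_nat_ge |z|
      exact ⟨m, h1, h2, h3, abs_le.1 hm⟩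
    · rintro ⟨m, h1, h2, h3, -⟩
      exact ⟨h1, h2, h3⟩
  rw [this]
  exact MeasurableSet.iUnion fun m => MeasurableSpace.measurableSet_generateFrom
    ⟨F, _, _, hB.inter measurableSet_Icc,
      ((measure_mono inter_subset_right).trans_lt measure_Icc_lt_top).ne,
      Or.inr ⟨s, t, hF, rfl⟩, rfl⟩

lemma measurableSet_predictable_zero (ℱ : Filtration ℝ≥0 mΩ) {F : Set Ω}
    (hF : MeasurableSet[ℱ 0] F) {B : Set ℝ} (hB : MeasurableSet B) :
    MeasurableSet[predictableSpace ℱ] (F ×ˢ (({0} : Set ℝ≥0) ×ˢ B)) := by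
  have : F ×ˢ (({0} : Set ℝ≥0) ×ˢ B) =
      ⋃ m : ℕ, F ×ˢ (({0} : Set ℝ≥0) ×ˢ (B ∩ Icc (-(m : ℝ)) m)) := by
    ext ⟨ω, v, z⟩
    simp only [Set.mem_prod, mem_iUnion, mem_inter_iff]
    constructor
    · rintro ⟨h1, h2, h3⟩
      obtain ⟨m, hm⟩ := exists_nat_ge |z|
      exact ⟨m, h1, h2, h3, abs_le.1 hm⟩
    · rintro ⟨m, h1, h2, h3, -⟩
      exact ⟨h1, h2, h3⟩
  rw [this]
  exact MeasurableSet.iUnion fun m => MeasurableSpace.measurableSet_generateFrom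
    ⟨F, _, _, hB.inter measurableSet_Icc,
      ((measure_mono inter_subset_right).trans_lt measure_Icc_lt_top).ne,
      Or.inl ⟨hF, rfl⟩, rfl⟩

lemma measurable_predictable_height (ℱ : Filtration ℝ≥0 mΩ) :
    Measurable[predictableSpace ℱ] fun x : Ω × ℝ≥0 × ℝ => x.2.2 := by
  intro B hB
  have : (fun x : Ω × ℝ≥0 × ℝ => x.2.2) ⁻¹' B = univ ×ˢ (({0} : Set ℝ≥0) ×ˢ B) ∪
      ⋃ m : ℕ, univ ×ˢ (Ioc (0 : ℝ≥0) m ×ˢ B) := by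
    ext ⟨ω, v, z⟩
    simp only [mem_preimage, mem_union, Set.mem_prod, mem_univ, true_and, mem_singleton_iff,
      mem_iUnion]
    constructor
    · intro hz
      rcases eq_zero_or_pos v with h0 | h0
      · exact Or.inl ⟨h0, hz⟩
      · obtain ⟨m, hm⟩ := exists_nat_ge v
        exact Or.inr ⟨m, ⟨h0, hm⟩, hz⟩
    · rintro (⟨-, hz⟩ | ⟨m, -, hz⟩) <;> exact hz
  rw [this]
  exact (measurableSet_predictable_zero ℱ MeasurableSet.univ hB).union
    (MeasurableSet.iUnion fun m => measurableSet_predictable_Ioc ℱ MeasurableSet.univ hB)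

/-- The left limits of an adapted càdlàg process are predictable: they are limits of the values
at the last points of grids strictly before the given time. -/
lemma measurable_predictable_leftLim {E : Type*} [TopologicalSpace E]
    [TopologicalSpace.PseudoMetrizableSpace E] [MeasurableSpace E] [BorelSpace E]
    {ℱ : Filtration ℝ≥0 mΩ} {Y : ℝ≥0 → Ω → E} (hY : Adapted ℱ Y)
    (hc : ∀ ω, IsCadlagPath fun t => Y t ω) :
    Measurable[predictableSpace ℱ] fun x : Ω × ℝ≥0 × ℝ =>
      Function.leftLim (fun v => Y v x.1) x.2.1 := by
  -- `τ m k` is the `k`-th point of the grid of mesh `1 / (m + 1)`, and `τ m (idx m v)` is the last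
  -- grid point strictly before `v`
  set idx : ℕ → ℝ≥0 → ℕ := fun m v => ⌈((m : ℝ≥0) + 1) * v⌉₊ - 1 with hidx
  set τ : ℕ → ℕ → ℝ≥0 := fun m k => (k : ℝ≥0) / (m + 1) with hτ
  have hset : ∀ (m k : ℕ) (v : ℝ≥0), idx m v = k ↔
      (v ∈ ({0} : Set ℝ≥0) ∧ k = 0) ∨ v ∈ Ioc (τ m k) (((k : ℝ≥0) + 1) / (m + 1)) := by
    intro m k v
    have hm : (0 : ℝ≥0) < m + 1 := by positivity
    rw [mem_singleton_iff, mem_Ioc, hτ, div_lt_iff₀ hm, le_div_iff₀ hm]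
    rcases eq_zero_or_pos v with rfl | hv
    · simp [hidx, eq_comm]
    · have h1 : 0 < ⌈((m : ℝ≥0) + 1) * v⌉₊ := Nat.ceil_pos.2 (by positivity)
      have h2 : idx m v = k ↔ ⌈((m : ℝ≥0) + 1) * v⌉₊ = k + 1 := by
        simp only [hidx]; omega
      rw [h2, Nat.ceil_eq_iff (by omega)]
      simp [hv.ne', mul_comm]
  refine @measurable_of_tendsto_metrizable _ _ (predictableSpace ℱ) _ _ _ _
    (fun m x => Y (τ m (idx m x.2.1)) x.1) _ ?_ ?_
  · intro m A hA
    have : (fun x : Ω × ℝ≥0 × ℝ => Y (τ m (idx m x.2.1)) x.1) ⁻¹' A =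
        (Y 0 ⁻¹' A) ×ˢ (({0} : Set ℝ≥0) ×ˢ univ) ∪
        ⋃ k : ℕ, (Y (τ m k) ⁻¹' A) ×ˢ (Ioc (τ m k) (((k : ℝ≥0) + 1) / (m + 1)) ×ˢ univ) := by
      ext ⟨ω, v, z⟩
      simp only [mem_preimage, mem_union, Set.mem_prod, mem_univ, and_true, mem_iUnion]
      constructor
      · intro h
        rcases (hset m _ v).1 rfl with ⟨h1, h2⟩ | h1
        · rw [h2] at h
          exact Or.inl ⟨by simpa [hτ] using h, h1⟩
        · exact Or.inr ⟨_, h, h1⟩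
      · rintro (⟨h1, h2⟩ | ⟨k, h1, h2⟩)
        · rw [(hset m 0 v).2 (Or.inl ⟨h2, rfl⟩)]
          simpa [hτ] using h1
        · rw [(hset m k v).2 (Or.inr h2)]
          exact h1
    rw [this]
    exact (measurableSet_predictable_zero ℱ (hY 0 hA) MeasurableSet.univ).union
      (MeasurableSet.iUnion fun k => measurableSet_predictable_Ioc ℱ (hY _ hA) MeasurableSet.univ)
  · rw [tendsto_pi_nhds]
    rintro ⟨ω, v, z⟩
    simp only
    rcases eq_zero_or_pos v with rfl | hv
    · rw [leftLim_zero]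
      refine tendsto_const_nhds.congr fun m => ?_
      rw [(hset m 0 0).2 (Or.inl ⟨rfl, rfl⟩)]
      simp [hτ]
    · refine ((hc ω).tendsto_leftLim v).comp (tendsto_nhdsWithin_iff.2 ⟨?_, ?_⟩)
      · rw [tendsto_iff_dist_tendsto_zero]
        refine squeeze_zero (fun _ => dist_nonneg) (fun m => ?_)
          (tendsto_one_div_add_atTop_nhds_zero_nat (𝕜 := ℝ))
        rcases (hset m _ v).1 rfl with ⟨h1, -⟩ | h1
        · exact absurd h1 hv.ne'
        · rw [dist_comm, NNReal.dist_eq]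
          have h2 : (v : ℝ) ≤ ((idx m v : ℝ) + 1) / (m + 1) := by exact_mod_cast h1.2
          have h3 : (τ m (idx m v) : ℝ) < v := by exact_mod_cast h1.1
          have h4 : (τ m (idx m v) : ℝ) = (idx m v : ℝ) / (m + 1) := by simp [hτ]
          rw [abs_of_nonneg (by linarith), h4]
          rw [add_div] at h2
          linarith
      · refine Eventually.of_forall fun m => ?_
        rcases (hset m _ v).1 rfl with ⟨h1, -⟩ | h1
        · exact absurd h1 hv.ne'
        · exact h1.1

lemma measurable_predictable_time (ℱ : Filtration ℝ≥0 mΩ) :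
    Measurable[predictableSpace ℱ] fun x : Ω × ℝ≥0 × ℝ => x.2.1 := by
  have hid : ∀ t : ℝ≥0, ContinuousWithinAt (fun v : ℝ≥0 => v) (Iic t) t := fun t =>
    continuousWithinAt_id
  have h := measurable_predictable_leftLim (ℱ := ℱ) (Y := fun t _ => t)
    (fun t => measurable_const) (fun ω t => ⟨continuousWithinAt_id, t,
      tendsto_id.mono_left nhdsWithin_le_nhds⟩)
  have h2 : ∀ x : Ω × ℝ≥0 × ℝ, Function.leftLim (fun v : ℝ≥0 => v) x.2.1 = x.2.1 := fun x =>
    (hid x.2.1).leftLim_eq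
  simpa only [h2] using h

lemma measurable_jumpDiff (M : Model) {φ : ℝ → ℝ → State → ℝ → ℝ}
    (hφ : Measurable fun x : ℝ × ℝ × State × ℝ => φ x.1 x.2.1 x.2.2.1 x.2.2.2) :
    Measurable fun y : State × ℝ≥0 × ℝ≥0 × ℝ≥0 × ℝ =>
      jumpDiff M φ y.2.1 y.2.2.1 y.1 y.2.2.2.1 y.2.2.2.2 := by
  refine measurable_from_prod_countable_right fun i => ?_
  simp only [jumpDiff]
  refine Finset.measurable_fun_sum _ fun j _ => Measurable.mul (Measurable.sub ?_ ?_) ?_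
  · exact hφ.comp (by fun_prop : Measurable fun y : ℝ≥0 × ℝ≥0 × ℝ≥0 × ℝ =>
      ((y.1 : ℝ), (y.2.1 : ℝ) * M.fac j, j, (0 : ℝ)))
  · exact hφ.comp (by fun_prop : Measurable fun y : ℝ≥0 × ℝ≥0 × ℝ≥0 × ℝ =>
      ((y.1 : ℝ), (y.2.1 : ℝ), i, (y.2.2.1 : ℝ)))
  · have hm := (M.H_measurable (alphaBar ((i : ℤ) + (j : ℤ)))).preimage
      (by fun_prop : Measurable fun y : ℝ≥0 × ℝ≥0 × ℝ≥0 × ℝ => ((y.2.2.1 : ℝ), y.2.2.2))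
    have heq : (fun y : ℝ≥0 × ℝ≥0 × ℝ≥0 × ℝ =>
        (M.Hij i j y.2.2.1).indicator (fun _ => (1 : ℝ)) y.2.2.2) =
        ((fun y : ℝ≥0 × ℝ≥0 × ℝ≥0 × ℝ => ((y.2.2.1 : ℝ), y.2.2.2)) ⁻¹' {x : ℝ × ℝ | 0 ≤ x.1 ∧
          x.2 ∈ M.H (alphaBar ((i : ℤ) + (j : ℤ))) x.1}).indicator (fun _ => (1 : ℝ)) := by
      funext y
      by_cases hy : y.2.2.2 ∈ M.Hij i j y.2.2.1
      · rw [indicator_of_mem hy, indicator_of_mem (by exact ⟨NNReal.coe_nonneg _, hy⟩)]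
      · rw [indicator_of_notMem hy, indicator_of_notMem fun h => hy h.2]
    rw [heq]
    exact measurable_const.indicator hm

/-! ### Integrals over the half-plane -/

lemma lintegral_lebesgueHalfPlane {f : ℝ≥0 × ℝ → ℝ≥0∞} (hf : Measurable f) :
    ∫⁻ x, f x ∂lebesgueHalfPlane = ∫⁻ v in Ici (0 : ℝ), ∫⁻ z, f (v.toNNReal, z) := by
  have hg : Measurable fun y : ℝ × ℝ => f (y.1.toNNReal, y.2) := hf.comp (by fun_prop)
  have h1 := measurableEmbedding_halfPlane.lintegral_map (μ := lebesgueHalfPlane)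
    (fun y : ℝ × ℝ => f (y.1.toNNReal, y.2))
  simp only [Real.toNNReal_coe] at h1
  rw [← h1, map_lebesgueHalfPlane, Measure.volume_eq_prod, ← Measure.prod_restrict,
    lintegral_prod _ hg.aemeasurable, Measure.restrict_univ]

lemma setIntegral_lebesgueHalfPlane {f : ℝ≥0 × ℝ → ℝ} {a b : ℝ≥0} (hab : a ≤ b)
    (hf : IntegrableOn f (Ioc a b ×ˢ univ) lebesgueHalfPlane) :
    IntervalIntegrable (fun v => ∫ z, f (v.toNNReal, z)) volume a b ∧
      ∫ x in Ioc a b ×ˢ univ, f x ∂lebesgueHalfPlane =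
        ∫ v in (a : ℝ)..b, ∫ z, f (v.toNNReal, z) := by
  have hpre : (fun x : ℝ≥0 × ℝ => ((x.1 : ℝ), x.2)) ⁻¹' (Ioc (a : ℝ) b ×ˢ univ) =
      Ioc a b ×ˢ univ := by
    ext ⟨v, z⟩
    simp
  have hres : ((volume : Measure (ℝ × ℝ)).restrict (Ici 0 ×ˢ univ)).restrict
      (Ioc (a : ℝ) b ×ˢ univ) = (volume.restrict (Ioc (a : ℝ) b)).prod volume := by
    rw [Measure.restrict_restrict (measurableSet_Ioc.prod MeasurableSet.univ), prod_inter_prod,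
      inter_univ, inter_eq_self_of_subset_left (show Ioc (a : ℝ) b ⊆ Ici 0 from fun x hx =>
        a.2.trans hx.1.le), Measure.volume_eq_prod, ← Measure.prod_restrict,
      Measure.restrict_univ]
  have h1 : Integrable (fun y : ℝ × ℝ => f (y.1.toNNReal, y.2))
      ((volume.restrict (Ioc (a : ℝ) b)).prod volume) := by
    rw [← hres, ← map_lebesgueHalfPlane]
    refine (measurableEmbedding_halfPlane.integrableOn_map_iff).2 ?_
    rw [hpre]
    simpa [Function.comp_def] using hf
  have h2 := measurableEmbedding_halfPlane.setIntegral_map (μ := lebesgueHalfPlane)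
    (fun y : ℝ × ℝ => f (y.1.toNNReal, y.2)) (Ioc (a : ℝ) b ×ˢ univ)
  rw [hpre, map_lebesgueHalfPlane, hres, integral_prod _ h1] at h2
  have hab' : (a : ℝ) ≤ b := by exact_mod_cast hab
  refine ⟨(intervalIntegrable_iff_integrableOn_Ioc_of_le hab').2 h1.integral_prod_left, ?_⟩
  rw [intervalIntegral.integral_of_le hab', h2]
  simp

/-! ### Solutions of the stochastic equations are driven paths -/

namespace IsSolution

variable {M : Model} {μ : Measure Ω} {ℱ : Filtration ℝ≥0 mΩ} {N : Ω → Measure (ℝ≥0 × ℝ)}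
  {P : ℝ≥0 → Ω → ℝ≥0} {I : ℝ≥0 → Ω → State} {S : ℝ≥0 → Ω → ℝ≥0}

lemma measurable_predictable_path (hsol : IsSolution M μ ℱ N P I S) :
    Measurable[predictableSpace ℱ] fun x : Ω × ℝ≥0 × ℝ =>
      (Function.leftLim (fun v => I v x.1) x.2.1, x.2.1, leftVal (fun v => P v x.1) x.2.1,
        leftVal (fun v => S v x.1) x.2.1, x.2.2) :=
  (measurable_predictable_leftLim hsol.adapted_I hsol.cadlag_I).prodMk
    ((measurable_predictable_time ℱ).prodMk
      ((measurable_predictable_leftLim hsol.adapted_P hsol.cadlag_P).prodMk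
        ((measurable_predictable_leftLim hsol.adapted_S hsol.cadlag_S).prodMk
          (measurable_predictable_height ℱ))))

lemma measurable_predictable_jumpAlong (hsol : IsSolution M μ ℱ N P I S)
    {φ : ℝ → ℝ → State → ℝ → ℝ}
    (hφ : Measurable fun x : ℝ × ℝ × State × ℝ => φ x.1 x.2.1 x.2.2.1 x.2.2.2) :
    Measurable[predictableSpace ℱ] fun x : Ω × ℝ≥0 × ℝ =>
      jumpAlong M φ (fun v => P v x.1) (fun v => I v x.1) (fun v => S v x.1) x.2 := by
  intro A hA
  exact hsol.measurable_predictable_path (measurable_jumpDiff M hφ hA)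

lemma measurableSet_predictable_active (hsol : IsSolution M μ ℱ N P I S) :
    MeasurableSet[predictableSpace ℱ]
      {x : Ω × ℝ≥0 × ℝ | x.2 ∈ activeSet M (fun v => S v x.1)} := by
  have hm : MeasurableSet {y : ℝ × ℝ | 0 ≤ y.1 ∧ y.2 ∈ M.HUnion y.1} := by
    have : {y : ℝ × ℝ | 0 ≤ y.1 ∧ y.2 ∈ M.HUnion y.1} =
        {y : ℝ × ℝ | 0 ≤ y.1 ∧ y.2 ∈ M.H Sgn.plus y.1} ∪
        {y : ℝ × ℝ | 0 ≤ y.1 ∧ y.2 ∈ M.H Sgn.minus y.1} := by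
      ext y
      simp only [Model.HUnion, mem_union, mem_ofPred_eq]
      tauto
    rw [this]
    exact (M.H_measurable _).union (M.H_measurable _)
  have hg : Measurable fun y : State × ℝ≥0 × ℝ≥0 × ℝ≥0 × ℝ => ((y.2.2.2.1 : ℝ), y.2.2.2.2) := by
    fun_prop
  have h := (hg.comp hsol.measurable_predictable_path) hm
  have he : {x : Ω × ℝ≥0 × ℝ | x.2 ∈ activeSet M (fun v => S v x.1)} =
      ((fun y : State × ℝ≥0 × ℝ≥0 × ℝ≥0 × ℝ => ((y.2.2.2.1 : ℝ), y.2.2.2.2)) ∘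
        fun x : Ω × ℝ≥0 × ℝ =>
      (Function.leftLim (fun v => I v x.1) x.2.1, x.2.1, leftVal (fun v => P v x.1) x.2.1,
        leftVal (fun v => S v x.1) x.2.1, x.2.2)) ⁻¹'
        {y : ℝ × ℝ | 0 ≤ y.1 ∧ y.2 ∈ M.HUnion y.1} := by
    ext x
    exact ⟨fun hx => ⟨NNReal.coe_nonneg _, hx⟩, fun hx => hx.2⟩
  rw [he]
  exact h

lemma measurableSet_activeSet (hsol : IsSolution M μ ℱ N P I S) (ω : Ω) :
    MeasurableSet (activeSet M (fun v => S v ω)) :=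
  (predictableSpace_le ℱ _ hsol.measurableSet_predictable_active).preimage
    (measurable_prodMk_left (x := ω))

lemma volume_HUnion_le (M : Model) {s : ℝ} (hs : 0 ≤ s) :
    volume (M.HUnion s) ≤ ENNReal.ofReal (2 * M.hBound) := by
  have hν : ∀ ν, volume (M.H ν s) ≤ ENNReal.ofReal M.hBound := fun ν => by
    obtain ⟨a, ha⟩ := M.H_interval ν s hs
    rw [ha, Real.volume_Ico, add_sub_cancel_left]
    exact ENNReal.ofReal_le_ofReal (M.h_le_hBound ν hs)
  rw [two_mul, ENNReal.ofReal_add M.hBound_nonneg M.hBound_nonneg]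
  exact (measure_union_le _ _).trans (add_le_add (hν _) (hν _))

/-- Almost surely only finitely many points are active up to any time, because their mean number
is at most `2ct`. -/
lemma ae_active_lt_top [IsProbabilityMeasure μ] (hN : IsPoissonRandomMeasure μ ℱ N)
    (hsol : IsSolution M μ ℱ N P I S) :
    ∀ᵐ ω ∂μ, ∀ t, N ω (activeSet M (fun v => S v ω) ∩ Ioc 0 t ×ˢ univ) < ∞ := by
  have hm : ∀ t : ℝ≥0, MeasurableSet[predictableSpace ℱ]
      ({x : Ω × ℝ≥0 × ℝ | x.2 ∈ activeSet M (fun v => S v x.1)} ∩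
        univ ×ˢ (Ioc 0 t ×ˢ univ)) := fun t =>
    hsol.measurableSet_predictable_active.inter
      (measurableSet_predictable_Ioc ℱ MeasurableSet.univ MeasurableSet.univ)
  have hae : ∀ k : ℕ, ∀ᵐ ω ∂μ,
      N ω (activeSet M (fun v => S v ω) ∩ Ioc 0 (k : ℝ≥0) ×ˢ univ) < ∞ := by
    intro k
    set A := ({x : Ω × ℝ≥0 × ℝ | x.2 ∈ activeSet M (fun v => S v x.1)} ∩
        univ ×ˢ (Ioc 0 (k : ℝ≥0) ×ˢ univ)) with hA
    have hsec : ∀ ω, (fun x : ℝ≥0 × ℝ => (A.indicator 1 (ω, x) : ℝ≥0∞)) =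
        (activeSet M (fun v => S v ω) ∩ Ioc 0 (k : ℝ≥0) ×ˢ univ).indicator 1 := by
      intro ω
      funext x
      simp only [hA, indicator]
      congr 1
      simp
    have hmeas : ∀ ω, MeasurableSet
        (activeSet M (fun v => S v ω) ∩ Ioc 0 (k : ℝ≥0) ×ˢ univ) := fun ω =>
      (hsol.measurableSet_activeSet ω).inter (measurableSet_Ioc.prod MeasurableSet.univ)
    have h := hN.lintegral_lintegral (f := A.indicator 1)
      (Measurable.indicator measurable_const (hm k))
    simp only [hsec] at h
    simp only [lintegral_indicator_one (hmeas _)] at h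
    have hAm : Measurable (A.indicator (1 : Ω × ℝ≥0 × ℝ → ℝ≥0∞)) :=
      Measurable.indicator measurable_const (predictableSpace_le ℱ _ (hm k))
    have hNm : AEMeasurable (fun ω => N ω (activeSet M (fun v => S v ω) ∩
        Ioc 0 (k : ℝ≥0) ×ˢ univ)) μ := by
      have h1 : Measurable fun ω => ∫⁻ x, A.indicator 1 (ω, x) ∂(hN.kernel ω) :=
        hAm.lintegral_kernel_prod_right'
      refine ⟨_, h1, ?_⟩
      filter_upwards [hN.kernel_ae_eq] with ω hω
      rw [hω, hsec, lintegral_indicator_one (hmeas ω)]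
    refine ae_lt_top' hNm ?_
    rw [h]
    have hle : ∀ ω, lebesgueHalfPlane (activeSet M (fun v => S v ω) ∩
        Ioc 0 (k : ℝ≥0) ×ˢ univ) ≤ ENNReal.ofReal (2 * M.hBound) * k := by
      intro ω
      rw [← lintegral_indicator_one (hmeas ω),
        lintegral_lebesgueHalfPlane (measurable_one.indicator (hmeas ω))]
      calc _ ≤ ∫⁻ v in Ici (0 : ℝ), (Ioc (0 : ℝ) k).indicator
            (fun _ => ENNReal.ofReal (2 * M.hBound)) v := by
            refine setLIntegral_mono' measurableSet_Ici fun v hv => ?_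
            by_cases hvk : v ∈ Ioc (0 : ℝ) k
            · rw [indicator_of_mem hvk]
              refine le_trans ?_ (volume_HUnion_le M
                (NNReal.coe_nonneg (leftVal (fun v => S v ω) v.toNNReal)))
              refine le_trans (lintegral_mono fun z => ?_)
                (lintegral_indicator_one_le (M.HUnion (leftVal (fun v => S v ω) v.toNNReal)))
              by_cases hz : z ∈ M.HUnion (leftVal (fun v => S v ω) v.toNNReal)
              · rw [indicator_of_mem hz]
                exact indicator_le_self' (fun _ _ => zero_le) _
              · rw [indicator_of_notMem (fun h => hz h.1)]
                exact zero_le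
            · rw [indicator_of_notMem hvk]
              refine le_of_eq (lintegral_eq_zero_of_ae_eq_zero (ae_of_all _ fun z => ?_))
              refine indicator_of_notMem (fun h => hvk ?_) _
              have h2 := h.2.1
              simp only [mem_Ioc] at h2
              refine ⟨Real.toNNReal_pos.1 h2.1, ?_⟩
              have h3 : ((v.toNNReal : ℝ≥0) : ℝ) ≤ ((k : ℝ≥0) : ℝ) := NNReal.coe_le_coe.2 h2.2
              rwa [Real.coe_toNNReal _ hv, NNReal.coe_natCast] at h3
        _ ≤ ∫⁻ v, (Ioc (0 : ℝ) k).indicator (fun _ => ENNReal.ofReal (2 * M.hBound)) v :=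
            setLIntegral_le_lintegral _ _
        _ = _ := by
            rw [lintegral_indicator_const measurableSet_Ioc]
            simp
    refine ((lintegral_mono hle).trans_lt ?_).ne
    rw [lintegral_const, measure_univ, mul_one]
    exact ENNReal.mul_lt_top ENNReal.ofReal_lt_top (by simp)
  filter_upwards [ae_all_iff.2 hae] with ω hω t
  obtain ⟨k, hk⟩ := exists_nat_ge t
  exact (measure_mono (inter_subset_inter_right _ (Set.prod_mono_left
    (Ioc_subset_Ioc_right hk)))).trans_lt (hω k)

theorem ae_isJumpPath [IsProbabilityMeasure μ] (hN : IsPoissonRandomMeasure μ ℱ N)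
    (hsol : IsSolution M μ ℱ N P I S) :
    ∀ᵐ ω ∂μ, IsJumpPath M (N ω) (fun v => P v ω) (fun v => I v ω) (fun v => S v ω) := by
  filter_upwards [hsol.ae_active_lt_top hN, hsol.price_eq, hsol.state_eq, hsol.age_eq]
    with ω hfin hP hI hS
  have e1 : (fun x : ℝ≥0 × ℝ => Function.leftLim (fun v => (P v ω : ℝ)) x.1 *
      M.g₃ (Function.leftLim (fun v => I v ω) x.1)
        (Function.leftLim (fun v => (S v ω : ℝ)) x.1) x.2) =
      jumpAlong M (fun _ p _ _ => p) (fun v => P v ω) (fun v => I v ω) (fun v => S v ω) := by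
    funext x
    rw [(hsol.cadlag_P ω).leftLim_coe, (hsol.cadlag_S ω).leftLim_coe,
      M.mul_g₃_eq_jumpDiff x.1]
    rfl
  have e2 : (fun x : ℝ≥0 × ℝ => M.g₂ (Function.leftLim (fun v => I v ω) x.1)
        (Function.leftLim (fun v => (S v ω : ℝ)) x.1) x.2) =
      jumpAlong M (fun _ _ i _ => ((i : ℤ) : ℝ)) (fun v => P v ω) (fun v => I v ω)
        (fun v => S v ω) := by
    funext x
    rw [(hsol.cadlag_S ω).leftLim_coe]
    rfl
  have e3 : (fun x : ℝ≥0 × ℝ => M.g₁ (Function.leftLim (fun v => I v ω) x.1)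
        (Function.leftLim (fun v => (S v ω : ℝ)) x.1) x.2) =
      fun x => -jumpAlong M (fun _ _ _ s => s) (fun v => P v ω) (fun v => I v ω)
        (fun v => S v ω) x := by
    funext x
    rw [(hsol.cadlag_S ω).leftLim_coe, jumpAlong,
      ← M.neg_g₁_eq_jumpDiff _ _ _ (NNReal.coe_nonneg _), neg_neg]
  refine ⟨hsol.measurableSet_activeSet ω, hN.integer_valued ω, hfin, fun t => ?_, fun t => ?_,
    fun t => ?_⟩
  · have := hP t
    rw [e1] at this
    exact this
  · have := hI t
    rw [e2] at this
    exact this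
  · have := hS t
    rw [e3, integral_neg, sub_neg_eq_add] at this
    exact ⟨integrable_neg_iff.1 this.1, this.2⟩

end IsSolution

end

section

/-! ### Dynkin's formula -/

/-- The jumps of `φ` in the time interval `(a, b]`, on the event `F`. -/
def jumpIntegrand {Ω : Type*} (M : Model) (φ : ℝ → ℝ → State → ℝ → ℝ) (P : ℝ≥0 → Ω → ℝ≥0)
    (I : ℝ≥0 → Ω → State) (S : ℝ≥0 → Ω → ℝ≥0) (F : Set Ω) (a b : ℝ≥0) : Ω × ℝ≥0 × ℝ → ℝ :=
  (F ×ˢ (Ioc a b ×ˢ univ)).indicator fun x =>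
    jumpAlong M φ (fun v => P v x.1) (fun v => I v x.1) (fun v => S v x.1) x.2

section

variable {Ω : Type*} {M : Model} {φ : ℝ → ℝ → State → ℝ → ℝ} {P : ℝ≥0 → Ω → ℝ≥0}
  {I : ℝ≥0 → Ω → State} {S : ℝ≥0 → Ω → ℝ≥0}

lemma jumpIntegrand_apply {F : Set Ω} {a b : ℝ≥0} (ω : Ω) :
    (fun x => jumpIntegrand M φ P I S F a b (ω, x)) = (Ioc a b ×ˢ univ).indicator fun x =>
      F.indicator (fun ω => jumpAlong M φ (fun v => P v ω) (fun v => I v ω) (fun v => S v ω) x)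
        ω := by
  funext x
  by_cases h1 : ω ∈ F <;> by_cases h2 : x ∈ Ioc a b ×ˢ univ <;>
    simp only [jumpIntegrand, indicator, Set.mem_prod (p := (ω, x)), h1, h2, and_true, and_false,
      if_true, if_false]

lemma integral_jumpIntegrand {F : Set Ω} {a b : ℝ≥0} (ν : Ω → Measure (ℝ≥0 × ℝ)) (ω : Ω) :
    ∫ x, jumpIntegrand M φ P I S F a b (ω, x) ∂(ν ω) = F.indicator (fun ω =>
      ∫ x in Ioc a b ×ˢ univ, jumpAlong M φ (fun v => P v ω) (fun v => I v ω)
        (fun v => S v ω) x ∂(ν ω)) ω := by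
  rw [jumpIntegrand_apply, integral_indicator (measurableSet_Ioc.prod MeasurableSet.univ)]
  by_cases h1 : ω ∈ F
  · simp only [indicator_of_mem h1]
  · simp only [indicator_of_notMem h1, integral_zero]

end

variable {Ω : Type*} [mΩ : MeasurableSpace Ω]

lemma lintegral_le_of_tendsto {α : Type*} [MeasurableSpace α] {μ : Measure α}
    {f : ℕ → α → ℝ≥0∞} {g : α → ℝ≥0∞} {K : ℝ≥0∞} (hf : ∀ n, Measurable (f n))
    (hlim : ∀ x, Tendsto (fun n => f n x) atTop (𝓝 (g x))) (hK : ∀ n, ∫⁻ x, f n x ∂μ ≤ K) :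
    ∫⁻ x, g x ∂μ ≤ K := by
  have h1 : ∀ x, g x = liminf (fun n => f n x) atTop := fun x => (hlim x).liminf_eq.symm
  simp only [h1]
  refine (lintegral_liminf_le hf).trans ?_
  refine (liminf_le_liminf (Eventually.of_forall hK)).trans ?_
  simp

/-- The growth condition `|φ(t, p, i, s)| ≤ C(1 + κp)` for times in `[0, b]`. -/
def GrowthBound (φ : ℝ → ℝ → State → ℝ → ℝ) (b : ℝ≥0) (C κ : ℝ) : Prop :=
  ∀ t p i s, t ∈ Icc (0 : ℝ) b → 0 ≤ p → 0 ≤ s → |φ t p i s| ≤ C * (1 + κ * p)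

lemma GrowthBound.abs_jumpDiff_le (M : Model) {φ : ℝ → ℝ → State → ℝ → ℝ} {b : ℝ≥0} {C κ : ℝ}
    (hφ : GrowthBound φ b C κ) (hC : 0 ≤ C) (hκ : 0 ≤ κ) {t p s : ℝ} (ht : t ∈ Icc (0 : ℝ) b)
    (hp : 0 ≤ p) (hs : 0 ≤ s) (i : State) (z : ℝ) :
    |jumpDiff M φ t p i s z| ≤
      3 * C * (1 + κ * p) * (M.HUnion s).indicator (fun _ => (1 : ℝ)) z := by
  rw [← M.sum_indicator_Hij i hs, Finset.mul_sum, jumpDiff]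
  refine (Finset.abs_sum_le_sum_abs _ _).trans (Finset.sum_le_sum fun j _ => ?_)
  have hind : 0 ≤ (M.Hij i j s).indicator (fun _ => (1 : ℝ)) z :=
    indicator_nonneg (fun _ _ => zero_le_one) _
  rw [abs_mul, abs_of_nonneg hind]
  refine mul_le_mul_of_nonneg_right ?_ hind
  have h1 := hφ t (p * M.fac j) j 0 ht (mul_nonneg hp (M.fac_pos j).le) le_rfl
  have h2 := hφ t p i s ht hp hs
  have h3 : κ * (p * M.fac j) ≤ κ * (p * 2) :=
    mul_le_mul_of_nonneg_left (mul_le_mul_of_nonneg_left (M.fac_le_two j) hp) hκ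
  have h4 : C * (1 + κ * (p * M.fac j)) ≤ C * (1 + κ * (p * 2)) :=
    mul_le_mul_of_nonneg_left (by linarith) hC
  refine (abs_sub _ _).trans ?_
  nlinarith

namespace IsSolution

variable {M : Model} {μ : Measure Ω} {ℱ : Filtration ℝ≥0 mΩ} {N : Ω → Measure (ℝ≥0 × ℝ)}
  {P : ℝ≥0 → Ω → ℝ≥0} {I : ℝ≥0 → Ω → State} {S : ℝ≥0 → Ω → ℝ≥0}

lemma measurable_P (hsol : IsSolution M μ ℱ N P I S) (t : ℝ≥0) : Measurable (P t) :=
  (hsol.adapted_P t).mono (ℱ.le t) le_rfl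

lemma measurable_I (hsol : IsSolution M μ ℱ N P I S) (t : ℝ≥0) : Measurable (I t) :=
  (hsol.adapted_I t).mono (ℱ.le t) le_rfl

lemma measurable_S (hsol : IsSolution M μ ℱ N P I S) (t : ℝ≥0) : Measurable (S t) :=
  (hsol.adapted_S t).mono (ℱ.le t) le_rfl

lemma measurable_state (hsol : IsSolution M μ ℱ N P I S) (t : ℝ≥0)
    {φ : ℝ → ℝ → State → ℝ → ℝ}
    (hφ : Measurable fun x : ℝ × ℝ × State × ℝ => φ x.1 x.2.1 x.2.2.1 x.2.2.2) :
    Measurable fun ω => φ t (P t ω) (I t ω) (S t ω) := by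
  have h1 := hsol.measurable_P t
  have h2 := hsol.measurable_I t
  have h3 := hsol.measurable_S t
  exact hφ.comp (by fun_prop : Measurable fun ω => ((t : ℝ), (P t ω : ℝ), I t ω, (S t ω : ℝ)))

lemma measurable_leftVal_P (hsol : IsSolution M μ ℱ N P I S) :
    Measurable fun x : Ω × ℝ => leftVal (fun v => P v x.1) x.2.toNNReal := by
  have h := (measurable_predictable_leftLim hsol.adapted_P hsol.cadlag_P).mono
    (predictableSpace_le ℱ) le_rfl
  exact h.comp (by fun_prop : Measurable fun x : Ω × ℝ => (x.1, x.2.toNNReal, (0 : ℝ)))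

/-- A uniform moment bound passes to the left limits by Fatou's lemma. -/
lemma lintegral_leftVal_le (hsol : IsSolution M μ ℱ N P I S) {b : ℝ≥0} {κ : ℝ} {K : ℝ≥0∞}
    (hK : ∀ t ≤ b, ∫⁻ ω, ENNReal.ofReal (1 + κ * P t ω) ∂μ ≤ K) {v : ℝ≥0} (hv : 0 < v)
    (hvb : v ≤ b) : ∫⁻ ω, ENNReal.ofReal (1 + κ * leftVal (fun v => P v ω) v) ∂μ ≤ K := by
  obtain ⟨u, -, hu, hlim⟩ := exists_seq_strictMono_tendsto' hv
  refine lintegral_le_of_tendsto (f := fun n ω => ENNReal.ofReal (1 + κ * P (u n) ω))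
    (fun n => ?_) (fun ω => ?_) fun n => hK _ ((hu n).2.le.trans hvb)
  · have := hsol.measurable_P (u n)
    fun_prop
  · have h1 : Tendsto (fun n => P (u n) ω) atTop (𝓝 (leftVal (fun v => P v ω) v)) :=
      ((hsol.cadlag_P ω).tendsto_leftLim v).comp
        (tendsto_nhdsWithin_iff.2 ⟨hlim, Eventually.of_forall fun n => (hu n).2⟩)
    exact ((ENNReal.continuous_ofReal.comp
      (by fun_prop : Continuous fun x : ℝ≥0 => 1 + κ * (x : ℝ))).tendsto _).comp h1

variable {φ d : ℝ → ℝ → State → ℝ → ℝ} {b : ℝ≥0} {C κ : ℝ} {K : ℝ≥0∞}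

lemma integrable_state (hsol : IsSolution M μ ℱ N P I S)
    (hφm : Measurable fun x : ℝ × ℝ × State × ℝ => φ x.1 x.2.1 x.2.2.1 x.2.2.2)
    (hφ : GrowthBound φ b C κ) (hC : 0 ≤ C)
    (hKt : K ≠ ∞) (hK : ∀ t ≤ b, ∫⁻ ω, ENNReal.ofReal (1 + κ * P t ω) ∂μ ≤ K) {t : ℝ≥0}
    (htb : t ≤ b) : Integrable (fun ω => φ t (P t ω) (I t ω) (S t ω)) μ := by
  refine ⟨(hsol.measurable_state t hφm).aestronglyMeasurable, ?_⟩
  have hle : ∀ ω, ‖φ t (P t ω) (I t ω) (S t ω)‖ₑ ≤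
      ENNReal.ofReal C * ENNReal.ofReal (1 + κ * P t ω) := fun ω => by
    rw [Real.enorm_eq_ofReal_abs, ← ENNReal.ofReal_mul hC]
    exact ENNReal.ofReal_le_ofReal (hφ _ _ _ _ ⟨t.2, by exact_mod_cast htb⟩
      (NNReal.coe_nonneg _) (NNReal.coe_nonneg _))
  refine (lintegral_mono hle).trans_lt ?_
  rw [lintegral_const_mul' _ _ ENNReal.ofReal_ne_top]
  exact ENNReal.mul_lt_top ENNReal.ofReal_lt_top ((hK t htb).trans_lt hKt.lt_top)

lemma measurable_jumpIntegrand (hsol : IsSolution M μ ℱ N P I S)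
    (hφm : Measurable fun x : ℝ × ℝ × State × ℝ => φ x.1 x.2.1 x.2.2.1 x.2.2.2) {F : Set Ω}
    {a : ℝ≥0} (hF : MeasurableSet[ℱ a] F) :
    Measurable[predictableSpace ℱ] (jumpIntegrand M φ P I S F a b) :=
  (hsol.measurable_predictable_jumpAlong hφm).indicator
    (measurableSet_predictable_Ioc ℱ hF MeasurableSet.univ)

lemma integrable_jumpIntegrand [IsProbabilityMeasure μ] (hsol : IsSolution M μ ℱ N P I S)
    (hφm : Measurable fun x : ℝ × ℝ × State × ℝ => φ x.1 x.2.1 x.2.2.1 x.2.2.2)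
    (hφ : GrowthBound φ b C κ) (hC : 0 ≤ C) (hκ : 0 ≤ κ)
    (hKt : K ≠ ∞) (hK : ∀ t ≤ b, ∫⁻ ω, ENNReal.ofReal (1 + κ * P t ω) ∂μ ≤ K) {F : Set Ω}
    {a : ℝ≥0} (hF : MeasurableSet[ℱ a] F) :
    Integrable (jumpIntegrand M φ P I S F a b) (μ.prod lebesgueHalfPlane) := by
  have hm : Measurable (jumpIntegrand M φ P I S F a b) :=
    (hsol.measurable_jumpIntegrand hφm hF).mono (predictableSpace_le ℱ) le_rfl
  refine ⟨hm.aestronglyMeasurable, ?_⟩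
  -- integrating over the heights first costs the factor `2c`, the total length of the intervals
  set G : Ω → ℝ → ℝ≥0∞ := fun ω v => (Ioc (0 : ℝ) b).indicator (fun v =>
    ENNReal.ofReal (3 * C) * ENNReal.ofReal (2 * M.hBound) *
      ENNReal.ofReal (1 + κ * leftVal (fun v => P v ω) v.toNNReal)) v with hG
  have hGm : Measurable (Function.uncurry G) := by
    have h1 : Measurable fun x : Ω × ℝ => ENNReal.ofReal (3 * C) * ENNReal.ofReal (2 * M.hBound) *
        ENNReal.ofReal (1 + κ * leftVal (fun v => P v x.1) x.2.toNNReal) := by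
      have := hsol.measurable_leftVal_P
      fun_prop
    exact h1.indicator (measurable_snd measurableSet_Ioc)
  have hbound : ∀ ω, ∫⁻ x, ‖jumpIntegrand M φ P I S F a b (ω, x)‖ₑ ∂lebesgueHalfPlane ≤
      ∫⁻ v, G ω v := by
    intro ω
    rw [lintegral_lebesgueHalfPlane (f := fun x => ‖jumpIntegrand M φ P I S F a b (ω, x)‖ₑ)
      (hm.comp measurable_prodMk_left).enorm]
    refine (setLIntegral_mono' measurableSet_Ici fun v (hv : (0 : ℝ) ≤ v) => ?_).trans
      (setLIntegral_le_lintegral (Ici 0) _)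
    by_cases hvb : v ∈ Ioc (0 : ℝ) b
    · simp only [hG]
      rw [indicator_of_mem hvb]
      set p := leftVal (fun v => P v ω) v.toNNReal
      set s := leftVal (fun v => S v ω) v.toNNReal with hs
      have hz : ∀ z, ‖jumpIntegrand M φ P I S F a b (ω, (v.toNNReal, z))‖ₑ ≤
          ENNReal.ofReal (3 * C * (1 + κ * p)) * (M.HUnion s).indicator 1 z := by
        intro z
        refine (enorm_indicator_le_enorm_self _ _).trans ?_
        have h1 := hφ.abs_jumpDiff_le M hC hκ (t := v.toNNReal) (p := p) (s := s)
          ⟨NNReal.coe_nonneg _, by rw [Real.coe_toNNReal _ hv]; exact hvb.2⟩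
          (NNReal.coe_nonneg _) (NNReal.coe_nonneg _)
          (Function.leftLim (fun v => I v ω) v.toNNReal) z
        rw [Real.enorm_eq_ofReal_abs]
        refine (ENNReal.ofReal_le_ofReal h1).trans (le_of_eq ?_)
        by_cases hzH : z ∈ M.HUnion s
        · simp [indicator_of_mem hzH]
        · simp [indicator_of_notMem hzH]
      refine (lintegral_mono hz).trans ?_
      rw [lintegral_const_mul' _ _ ENNReal.ofReal_ne_top, ENNReal.ofReal_mul (by positivity),
        mul_assoc, mul_assoc]
      refine mul_le_mul_right ?_ _
      rw [mul_comm]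
      refine mul_le_mul_left ?_ _
      exact (lintegral_indicator_one_le _).trans (volume_HUnion_le M (NNReal.coe_nonneg _))
    · refine (le_of_eq (lintegral_eq_zero_of_ae_eq_zero (ae_of_all _ fun z => ?_))).trans zero_le
      rw [jumpIntegrand, indicator_of_notMem, enorm_zero]
      · rfl
      · rintro ⟨-, h, -⟩
        have h' : a < v.toNNReal ∧ v.toNNReal ≤ b := h
        refine hvb ⟨Real.toNNReal_pos.1 (zero_le.trans_lt h'.1), ?_⟩
        have := NNReal.coe_le_coe.2 h'.2
        rwa [Real.coe_toNNReal _ hv] at this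
  rw [HasFiniteIntegral, lintegral_prod _ hm.enorm.aemeasurable]
  refine (lintegral_mono hbound).trans_lt ?_
  rw [lintegral_lintegral_swap hGm.aemeasurable]
  have hle : ∀ v, ∫⁻ ω, G ω v ∂μ ≤ (Ioc (0 : ℝ) b).indicator (fun _ =>
      ENNReal.ofReal (3 * C) * ENNReal.ofReal (2 * M.hBound) * K) v := by
    intro v
    by_cases hvb : v ∈ Ioc (0 : ℝ) b
    · simp only [hG, indicator_of_mem hvb]
      rw [lintegral_const_mul' _ _ (ENNReal.mul_ne_top ENNReal.ofReal_ne_top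
        ENNReal.ofReal_ne_top)]
      exact mul_le_mul_right (hsol.lintegral_leftVal_le hK (Real.toNNReal_pos.2 hvb.1)
        (Real.toNNReal_le_iff_le_coe.2 hvb.2)) _
    · simp [hG, indicator_of_notMem hvb]
  refine (lintegral_mono hle).trans_lt ?_
  rw [lintegral_indicator_const measurableSet_Ioc, Real.volume_Ioc]
  exact ENNReal.mul_lt_top (ENNReal.mul_lt_top (ENNReal.mul_lt_top ENNReal.ofReal_lt_top
    ENNReal.ofReal_lt_top) hKt.lt_top) ENNReal.ofReal_lt_top

/-- Dynkin's formula for a function that is differentiable along the characteristics: the mean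
increment of `φ` along the solution on an event of the past is the mean of the time integral of
the generator applied to `φ`. -/
theorem dynkin [IsProbabilityMeasure μ] (hN : IsPoissonRandomMeasure μ ℱ N)
    (hsol : IsSolution M μ ℱ N P I S)
    (hφm : Measurable fun x : ℝ × ℝ × State × ℝ => φ x.1 x.2.1 x.2.2.1 x.2.2.2)
    (hd : Continuous fun x : ℝ × ℝ × State × ℝ => d x.1 x.2.1 x.2.2.1 x.2.2.2)
    (hφd : ∀ t p i s, HasDerivAt (fun r => φ (t + r) p i (s + r)) (d t p i s) 0)
    (hφ : GrowthBound φ b C κ) (hC : 0 ≤ C) (hκ : 0 ≤ κ)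
    (hKt : K ≠ ∞) (hK : ∀ t ≤ b, ∫⁻ ω, ENNReal.ofReal (1 + κ * P t ω) ∂μ ≤ K) {F : Set Ω}
    {a : ℝ≥0} (hab : a ≤ b) (hF : MeasurableSet[ℱ a] F) :
    (∫ ω in F, φ b (P b ω) (I b ω) (S b ω) ∂μ) - ∫ ω in F, φ a (P a ω) (I a ω) (S a ω) ∂μ =
      ∫ ω in F, (∫ v in (a : ℝ)..b, IsJumpPath.along
        (fun t p i s => d t p i s + jumpTerm M φ t p i s)
        (fun v => P v ω) (fun v => I v ω) (fun v => S v ω) v) ∂μ := by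
  have hFm : MeasurableSet F := ℱ.le a _ hF
  have hφb := hsol.integrable_state hφm hφ hC hKt hK le_rfl
  have hφa := hsol.integrable_state hφm hφ hC hKt hK hab
  have hfp := hsol.measurable_jumpIntegrand (b := b) hφm hF
  have hfi := hsol.integrable_jumpIntegrand hφm hφ hC hκ hKt hK hF
  -- the jump integral is integrable and has the same mean as its compensator
  obtain ⟨hJi, hJ⟩ := hN.integral_integral hfp hfi
  have hLi := hfi.integral_prod_left
  simp only [integral_jumpIntegrand N] at hJi hJ
  simp only [integral_jumpIntegrand fun _ => lebesgueHalfPlane] at hJ hLi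
  rw [integrable_indicator_iff hFm] at hJi hLi
  rw [integral_indicator hFm, integral_indicator hFm] at hJ
  rw [← integral_sub hφb.integrableOn hφa.integrableOn]
  -- the integrability of the left-hand side is read off from the change-of-variables formula
  have hae : ∀ᵐ ω ∂(μ.restrict F), (∫ v in (a : ℝ)..b, IsJumpPath.along
        (fun t p i s => d t p i s + jumpTerm M φ t p i s)
        (fun v => P v ω) (fun v => I v ω) (fun v => S v ω) v) =
      (φ b (P b ω) (I b ω) (S b ω) - φ a (P a ω) (I a ω) (S a ω) -
        ∫ x in Ioc a b ×ˢ univ, jumpAlong M φ (fun v => P v ω) (fun v => I v ω)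
          (fun v => S v ω) x ∂(N ω)) +
        ∫ x in Ioc a b ×ˢ univ, jumpAlong M φ (fun v => P v ω) (fun v => I v ω)
          (fun v => S v ω) x ∂lebesgueHalfPlane := by
    rw [ae_restrict_iff' hFm]
    filter_upwards [hsol.ae_isJumpPath hN, hfi.prod_right_ae] with ω hω hωi hωF
    obtain ⟨h1, -, h3⟩ := hω.changeOfVariables hd hφd hab
    rw [jumpIntegrand_apply, integrable_indicator_iff (measurableSet_Ioc.prod MeasurableSet.univ)]
      at hωi
    simp only [indicator_of_mem hωF] at hωi
    obtain ⟨h4, h5⟩ := setIntegral_lebesgueHalfPlane hab hωi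
    have h6 : ∀ v ∈ uIoc (a : ℝ) b, (∫ z, jumpAlong M φ (fun v => P v ω) (fun v => I v ω)
        (fun v => S v ω) (v.toNNReal, z)) = IsJumpPath.along (fun t p i s => jumpTerm M φ t p i s)
          (fun v => P v ω) (fun v => I v ω) (fun v => S v ω) v := by
      intro v hv
      rw [uIoc_of_le (by exact_mod_cast hab)] at hv
      have hv0 : (0 : ℝ) ≤ v := a.2.trans hv.1.le
      simp only [jumpAlong, IsJumpPath.along]
      rw [integral_jumpDiff M φ _ _ _ (NNReal.coe_nonneg _), Real.coe_toNNReal _ hv0]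
    rw [h3, h5, add_sub_cancel_right]
    rw [intervalIntegral.integral_congr_ae (ae_of_all _ h6)]
    rw [← intervalIntegral.integral_add h1 (h4.congr h6)]
    rfl
  have hdiff : Integrable (fun ω => φ b (P b ω) (I b ω) (S b ω) - φ a (P a ω) (I a ω) (S a ω))
      (μ.restrict F) := hφb.integrableOn.sub hφa.integrableOn
  have hsub : Integrable (fun ω => φ b (P b ω) (I b ω) (S b ω) - φ a (P a ω) (I a ω) (S a ω) -
      ∫ x in Ioc a b ×ˢ univ, jumpAlong M φ (fun v => P v ω) (fun v => I v ω)
          (fun v => S v ω) x ∂(N ω)) (μ.restrict F) := hdiff.sub hJi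
  rw [integral_congr_ae hae, integral_add hsub hLi, integral_sub hdiff hJi, hJ]
  ring

end IsSolution

end

section

variable {Ω : Type*} [mΩ : MeasurableSpace Ω]

namespace IsSolution

variable {M : Model} {μ : Measure Ω} {ℱ : Filtration ℝ≥0 mΩ} {N : Ω → Measure (ℝ≥0 × ℝ)}
  {P : ℝ≥0 → Ω → ℝ≥0} {I : ℝ≥0 → Ω → State} {S : ℝ≥0 → Ω → ℝ≥0} [IsProbabilityMeasure μ]

/-- A function on which the generator is non-negative is a submartingale along the solution. -/
lemma setIntegral_le_setIntegral {φ d : ℝ → ℝ → State → ℝ → ℝ} {b : ℝ≥0} {C κ : ℝ} {K : ℝ≥0∞}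
    (hN : IsPoissonRandomMeasure μ ℱ N) (hsol : IsSolution M μ ℱ N P I S)
    (hφm : Measurable fun x : ℝ × ℝ × State × ℝ => φ x.1 x.2.1 x.2.2.1 x.2.2.2)
    (hd : Continuous fun x : ℝ × ℝ × State × ℝ => d x.1 x.2.1 x.2.2.1 x.2.2.2)
    (hφd : ∀ t p i s, HasDerivAt (fun r => φ (t + r) p i (s + r)) (d t p i s) 0)
    (hφ : GrowthBound φ b C κ) (hC : 0 ≤ C) (hκ : 0 ≤ κ)
    (hKt : K ≠ ∞) (hK : ∀ t ≤ b, ∫⁻ ω, ENNReal.ofReal (1 + κ * P t ω) ∂μ ≤ K) {F : Set Ω}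
    {a : ℝ≥0} (hab : a ≤ b) (hF : MeasurableSet[ℱ a] F)
    (hL : ∀ t ∈ Ioc (0 : ℝ) b, ∀ p i s, 0 ≤ p → 0 ≤ s → 0 ≤ d t p i s + jumpTerm M φ t p i s) :
    ∫ ω in F, φ a (P a ω) (I a ω) (S a ω) ∂μ ≤ ∫ ω in F, φ b (P b ω) (I b ω) (S b ω) ∂μ := by
  rw [← sub_nonneg, hsol.dynkin hN hφm hd hφd hφ hC hκ hKt hK hab hF]
  refine integral_nonneg fun ω => ?_
  have hab' : (a : ℝ) ≤ b := by exact_mod_cast hab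
  rw [Pi.zero_apply, intervalIntegral.integral_of_le hab']
  exact setIntegral_nonneg measurableSet_Ioc fun v hv =>
    hL v ⟨a.2.trans_lt hv.1, hv.2⟩ _ _ _ (NNReal.coe_nonneg _) (NNReal.coe_nonneg _)

/-! ### Moments of the price -/

/-- The generator applied to the truncated price `min(p, n)` is at most `2cδ min(p, n)`. -/
lemma jumpTerm_min_le (M : Model) (n : ℕ) {e : ℝ} (he : 0 ≤ e) {p s : ℝ} (hp : 0 ≤ p)
    (hs : 0 ≤ s) (t : ℝ) (i : State) :
    -(2 * M.hBound * M.δ * (e * min p n)) ≤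
      jumpTerm M (fun _ p _ _ => -(e * min p n)) t p i s := by
  have hm : 0 ≤ min p n := le_min hp n.cast_nonneg
  have hj : ∀ j, min (p * M.fac j) n ≤ (1 + M.δ) * min p n := fun j => by
    have h1 : p * M.fac j ≤ (1 + M.δ) * p := by
      rw [mul_comm]
      exact mul_le_mul_of_nonneg_right (M.fac_le j) hp
    have h2 : (n : ℝ) ≤ (1 + M.δ) * n := by
      nlinarith [M.δ_pos, (n.cast_nonneg : (0 : ℝ) ≤ n)]
    rw [mul_min_of_nonneg _ _ (by linarith [M.δ_pos])]
    exact min_le_min h1 h2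
  have hterm : ∀ j : State, M.hij i j s * (-(M.δ * (e * min p n))) ≤ M.hij i j s *
      (-(e * min (p * (1 + M.δ * alpha (j : ℤ))) n) - -(e * min p n)) := fun j => by
    refine mul_le_mul_of_nonneg_left ?_ (M.hij_nonneg i j hs)
    have := mul_le_mul_of_nonneg_left (hj j) he
    rw [Model.fac] at this
    linarith
  refine le_trans ?_ (Finset.sum_le_sum fun j _ => hterm j)
  rw [← Finset.sum_mul, M.sum_hij]
  have h1 := M.h_le_hBound Sgn.plus hs
  have h2 := M.h_le_hBound Sgn.minus hs
  have h3 : 0 ≤ M.δ * (e * min p n) := mul_nonneg M.δ_pos.le (mul_nonneg he hm)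
  nlinarith

/-- On every bounded time interval the price has bounded first moments. -/
theorem exists_moment_bound (hN : IsPoissonRandomMeasure μ ℱ N) (hsol : IsSolution M μ ℱ N P I S)
    (hint : Integrable (fun ω => (P 0 ω : ℝ)) μ) (T : ℝ≥0) :
    ∃ K : ℝ≥0∞, K ≠ ∞ ∧ ∀ t ≤ T, ∫⁻ ω, ENNReal.ofReal (1 + 1 * P t ω) ∂μ ≤ K := by
  -- `exp(-kt) min(P_t, n)` is a bounded supermartingale for every `n`
  set k := 2 * M.hBound * M.δ with hk
  have hk0 : 0 ≤ k := mul_nonneg (mul_nonneg zero_le_two M.hBound_nonneg) M.δ_pos.le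
  set m := ∫ ω, (P 0 ω : ℝ) ∂μ with hm
  refine ⟨1 + ENNReal.ofReal (Real.exp (k * T) * m), by simp, fun t htT => ?_⟩
  have htT' : (t : ℝ) ≤ T := by exact_mod_cast htT
  have hm0 : 0 ≤ m := integral_nonneg fun ω => NNReal.coe_nonneg _
  have hmeas := hsol.measurable_P
  have hmini : ∀ n : ℕ, ∀ r, Integrable (fun ω => min (P r ω : ℝ) n) μ := fun n r => by
    have hr := hmeas r
    refine Integrable.of_bound (C := n) (by fun_prop) (ae_of_all _ fun ω => ?_)
    rw [Real.norm_of_nonneg (le_min (NNReal.coe_nonneg _) n.cast_nonneg)]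
    exact min_le_right _ _
  have hn : ∀ n : ℕ, ∫ ω, min (P t ω : ℝ) n ∂μ ≤ Real.exp (k * T) * m := by
    intro n
    have h := hsol.setIntegral_le_setIntegral hN (b := t) (a := 0) (F := univ) (C := n) (κ := 0)
      (K := 1) (φ := fun t p _ _ => -(Real.exp (-(k * t)) * min p n))
      (d := fun t p _ _ => k * (Real.exp (-(k * t)) * min p n)) (by fun_prop) (by fun_prop)
      (fun t p i s => by
        have h1 : HasDerivAt (fun r : ℝ => -(k * (t + r))) (-(k * 1)) 0 :=
          (((hasDerivAt_id (0 : ℝ)).const_add t).const_mul k).neg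
        have h2 : HasDerivAt (fun r : ℝ => -(Real.exp (-(k * (t + r))) * min p n))
            (-(Real.exp (-(k * (t + 0))) * -(k * 1) * min p n)) 0 :=
          (h1.exp.mul_const (min p n)).neg
        refine h2.congr_deriv ?_
        rw [add_zero]
        ring)
      (fun t p i s ht hp hs => by
        have h1 : Real.exp (-(k * t)) ≤ 1 := Real.exp_le_one_iff.2 (by nlinarith [ht.1])
        have h2 : 0 ≤ min p n := le_min hp n.cast_nonneg
        rw [abs_neg, abs_of_nonneg (mul_nonneg (Real.exp_pos _).le h2), zero_mul, add_zero, mul_one]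
        exact (mul_le_of_le_one_left h2 h1).trans (min_le_right _ _))
      n.cast_nonneg le_rfl ENNReal.one_ne_top (fun t _ => by simp) zero_le MeasurableSet.univ
      (fun t ht p i s hp hs => by
        have := jumpTerm_min_le M n (Real.exp_pos (-(k * t))).le hp hs t i
        rw [← hk] at this
        have e : jumpTerm M (fun t p _ _ => -(Real.exp (-(k * t)) * min p n)) t p i s =
          jumpTerm M (fun _ p _ _ => -(Real.exp (-(k * t)) * min p n)) t p i s := rfl
        rw [e]
        linarith)
    simp only [Measure.restrict_univ, integral_neg, integral_const_mul, NNReal.coe_zero, mul_zero,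
      neg_zero, Real.exp_zero, one_mul, neg_le_neg_iff] at h
    have h0 : ∫ ω, min (P 0 ω : ℝ) n ∂μ ≤ m :=
      integral_mono (hmini n 0) hint fun ω => min_le_left _ _
    have h1 : ∫ ω, min (P t ω : ℝ) n ∂μ ≤ Real.exp (k * t) * m := by
      have := mul_le_mul_of_nonneg_left (h.trans h0) (Real.exp_pos (k * t)).le
      rwa [← mul_assoc, ← Real.exp_add, add_neg_cancel, Real.exp_zero, one_mul] at this
    exact h1.trans (mul_le_mul_of_nonneg_right
      (Real.exp_le_exp.2 (mul_le_mul_of_nonneg_left htT' hk0)) hm0)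
  have hP : ∫⁻ ω, ENNReal.ofReal (P t ω) ∂μ ≤ ENNReal.ofReal (Real.exp (k * T) * m) := by
    refine lintegral_le_of_tendsto (f := fun n ω => ENNReal.ofReal (min (P t ω : ℝ) n))
      (fun n => ?_) (fun ω => ?_) fun n => ?_
    · have := hmeas t
      fun_prop
    · refine tendsto_const_nhds.congr' ?_
      filter_upwards [eventually_ge_atTop ⌈(P t ω : ℝ)⌉₊] with n hn
      rw [min_eq_left (Nat.ceil_le.1 hn)]
    · rw [← ofReal_integral_eq_lintegral_ofReal (hmini n t)
        (ae_of_all _ fun ω => le_min (NNReal.coe_nonneg _) n.cast_nonneg)]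
      exact ENNReal.ofReal_le_ofReal (hn n)
  have hsplit : ∀ ω, ENNReal.ofReal (1 + 1 * P t ω) = 1 + ENNReal.ofReal (P t ω) := fun ω => by
    rw [one_mul, ENNReal.ofReal_add zero_le_one (NNReal.coe_nonneg _), ENNReal.ofReal_one]
  simp only [hsplit]
  rw [lintegral_add_left measurable_const, lintegral_const, measure_univ, mul_one]
  gcongr

theorem integrable_price (hN : IsPoissonRandomMeasure μ ℱ N) (hsol : IsSolution M μ ℱ N P I S)
    (hint : Integrable (fun ω => (P 0 ω : ℝ)) μ) (t : ℝ≥0) :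
    Integrable (fun ω => (P t ω : ℝ)) μ := by
  obtain ⟨K, hKt, hK⟩ := hsol.exists_moment_bound hN hint t
  exact hsol.integrable_state (φ := fun _ p _ _ => p) (b := t) (C := 1) (κ := 1) (by fun_prop)
    (fun t p i s _ hp _ => by rw [abs_of_nonneg hp]; linarith) zero_le_one hKt hK le_rfl

/-! ### The solution of the equation is a version of the conditional expectation -/

lemma setIntegral_price (hN : IsPoissonRandomMeasure μ ℱ N) (hsol : IsSolution M μ ℱ N P I S)
    (hint : Integrable (fun ω => (P 0 ω : ℝ)) μ) {t T : ℝ≥0} (htT : t ≤ T) {F : Set Ω}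
    (hF : MeasurableSet[ℱ t] F) :
    ∫ ω in F, M.price T t (P t ω) (I t ω) (S t ω) ∂μ = ∫ ω in F, (P T ω : ℝ) ∂μ := by
  obtain ⟨K, hKt, hK⟩ := hsol.exists_moment_bound hN hint T
  obtain ⟨C, hC, hb⟩ := M.exists_price_bound T
  have hφ : GrowthBound (M.price T) T C 1 := fun t p i s ht hp hs => by
    rw [one_mul]
    exact (hb t p i s ⟨ht, hp, hs⟩).1
  have h := hsol.dynkin hN (M.continuous_price T).measurable (M.continuous_priceD T)
    (M.hasDerivAt_price_char T) hφ hC zero_le_one hKt hK htT hF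
  have htT' : (t : ℝ) ≤ T := by exact_mod_cast htT
  have h0 : ∀ ω, ∫ v in (t : ℝ)..T, IsJumpPath.along
      (fun t p i s => M.priceD T t p i s + jumpTerm M (M.price T) t p i s)
      (fun v => P v ω) (fun v => I v ω) (fun v => S v ω) v = 0 := fun ω => by
    rw [intervalIntegral.integral_of_le htT']
    refine setIntegral_eq_zero_of_forall_eq_zero fun v hv => ?_
    exact M.priceD_add_jumpTerm T ⟨t.2.trans hv.1.le, hv.2⟩ _ _ (NNReal.coe_nonneg _)
  simp only [h0, integral_zero, M.price_terminal] at h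
  linarith

theorem isCondExpVersion_price (hN : IsPoissonRandomMeasure μ ℱ N)
    (hsol : IsSolution M μ ℱ N P I S) (hint : Integrable (fun ω => (P 0 ω : ℝ)) μ) (T : ℝ≥0) :
    IsCondExpVersion μ T P I S (M.price T) := by
  intro t htT
  obtain ⟨K, hKt, hK⟩ := hsol.exists_moment_bound hN hint T
  obtain ⟨C, hC, hb⟩ := M.exists_price_bound T
  have hφ : GrowthBound (M.price T) T C 1 := fun t p i s ht hp hs => by
    rw [one_mul]
    exact (hb t p i s ⟨ht, hp, hs⟩).1
  set X : Ω → ℝ≥0 × State × ℝ≥0 := fun ω => (P t ω, I t ω, S t ω) with hX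
  have hXt : Measurable[ℱ t] X :=
    (hsol.adapted_P t).prodMk ((hsol.adapted_I t).prodMk (hsol.adapted_S t))
  have hle : MeasurableSpace.comap X inferInstance ≤ ℱ t := hXt.comap_le
  refine ae_eq_condExp_of_forall_setIntegral_eq (hle.trans (ℱ.le t))
    (hsol.integrable_price hN hint T) (fun F _ _ =>
      (hsol.integrable_state (M.continuous_price T).measurable hφ hC hKt hK htT).integrableOn)
    (fun F hF _ => hsol.setIntegral_price hN hint htT (hle F hF)) ?_
  have hg : Measurable fun x : ℝ≥0 × State × ℝ≥0 => M.price T t x.1 x.2.1 x.2.2 :=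
    (M.continuous_price T).measurable.comp (by fun_prop :
      Measurable fun x : ℝ≥0 × State × ℝ≥0 => ((t : ℝ), (x.1 : ℝ), x.2.1, (x.2.2 : ℝ)))
  exact (hg.comp (comap_measurable X)).stronglyMeasurable.aestronglyMeasurable

end IsSolution

end

section

/-! ### A test function for reachability -/

namespace Model

variable (M : Model)

/-- The weight `∫_v^t h_kj(s - v + r) g(t - r) dr` of the paths that jump from `k` to `j` at some
time `r` between `v` and `t` and then have age `t - r` at time `t`. -/
def entry (g : ℝ → ℝ) (k j : State) (t v s : ℝ) : ℝ :=
  ∫ r in v..t, M.hx (alphaBar ((k : ℤ) + (j : ℤ))) (s - v + r) * g (t - r)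

/-- A lower bound for the mean of `f(P_t) 1_{I_t = j} g(S_t)` given the state `(p, i, s)` at time
`v`. It only takes into account the paths without a jump and those with a single jump, from the
state `k` to `j`; the exponential factor bounds from below the probability of no other jump. -/
def test (f g : ℝ → ℝ) (k j : State) (t v p : ℝ) (i : State) (s : ℝ) : ℝ :=
  Real.exp (-(2 * M.hBound * (t - v))) * ((if i = j then f p * g (s - v + t) else 0) +
    if i = k then f (p * M.fac j) * M.entry g k j t v s else 0)

/-- The derivative of `test` along the characteristics. -/
def testD (f g : ℝ → ℝ) (k j : State) (t v p : ℝ) (i : State) (s : ℝ) : ℝ :=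
  2 * M.hBound * M.test f g k j t v p i s - Real.exp (-(2 * M.hBound * (t - v))) *
    if i = k then
      f (p * M.fac j) * (M.hx (alphaBar ((k : ℤ) + (j : ℤ))) s * g (t - v)) else 0

variable {f g : ℝ → ℝ} (k j : State) (t : ℝ)

lemma continuous_entry (hg : Continuous g) :
    Continuous fun x : ℝ × ℝ => M.entry g k j t x.1 x.2 :=
  (continuous_integral_shift (M.continuous_hx _)
    (by fun_prop : Continuous fun r => g (t - r)) t).comp
    (by fun_prop : Continuous fun x : ℝ × ℝ => (x.2 - x.1, x.1))

lemma continuous_test (hf : Continuous f) (hg : Continuous g) :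
    Continuous fun x : ℝ × ℝ × State × ℝ => M.test f g k j t x.1 x.2.1 x.2.2.1 x.2.2.2 := by
  refine continuous_of_forall_state fun i => ?_
  have h1 : Continuous fun x : ℝ × ℝ × ℝ => M.entry g k j t x.1 x.2.2 :=
    (M.continuous_entry k j t hg).comp (by fun_prop : Continuous fun x : ℝ × ℝ × ℝ => (x.1, x.2.2))
  unfold test
  split_ifs <;> fun_prop

lemma continuous_testD (hf : Continuous f) (hg : Continuous g) :
    Continuous fun x : ℝ × ℝ × State × ℝ => M.testD f g k j t x.1 x.2.1 x.2.2.1 x.2.2.2 := by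
  have h1 := M.continuous_test k j t hf hg
  refine Continuous.sub (by fun_prop) ?_
  refine continuous_of_forall_state (φ := fun v p i s => Real.exp (-(2 * M.hBound * (t - v))) *
    if i = k then f (p * M.fac j) * (M.hx (alphaBar ((k : ℤ) + (j : ℤ))) s * g (t - v)) else 0)
    fun i => ?_
  split_ifs <;> fun_prop

lemma hasDerivAt_entry_char (hg : Continuous g) (v s : ℝ) :
    HasDerivAt (fun r => M.entry g k j t (v + r) (s + r))
      (-(M.hx (alphaBar ((k : ℤ) + (j : ℤ))) s * g (t - v))) 0 := by
  have hc : Continuous fun r =>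
      M.hx (alphaBar ((k : ℤ) + (j : ℤ))) (s - v + r) * g (t - r) := by fun_prop
  have h1 : HasDerivAt (fun u => ∫ r in u..t,
      M.hx (alphaBar ((k : ℤ) + (j : ℤ))) (s - v + r) * g (t - r))
      (-(M.hx (alphaBar ((k : ℤ) + (j : ℤ))) (s - v + v) * g (t - v))) (v + 0) := by
    rw [add_zero]
    exact intervalIntegral.integral_hasDerivAt_left (hc.intervalIntegrable _ _)
      (hc.stronglyMeasurableAtFilter _ _) hc.continuousAt
  have h2 := h1.comp_const_add v 0
  rw [sub_add_cancel] at h2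
  refine h2.congr_of_eventuallyEq (Eventually.of_forall fun r => ?_)
  simp only [entry, add_sub_add_right_eq_sub]

lemma hasDerivAt_test_char (hg : Continuous g) (v p : ℝ) (i : State) (s : ℝ) :
    HasDerivAt (fun r => M.test f g k j t (v + r) p i (s + r)) (M.testD f g k j t v p i s) 0 := by
  have h0 : HasDerivAt (fun r => -(2 * M.hBound * (t - (v + r)))) (-(2 * M.hBound * -1)) 0 :=
    ((((hasDerivAt_id (0 : ℝ)).const_add v).const_sub t).const_mul _).neg
  have h1 : HasDerivAt (fun r => Real.exp (-(2 * M.hBound * (t - (v + r)))))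
      (Real.exp (-(2 * M.hBound * (t - (v + 0)))) * -(2 * M.hBound * -1)) 0 := h0.exp
  have h2 : HasDerivAt (fun r => (if i = j then f p * g (s + r - (v + r) + t) else 0) +
      if i = k then f (p * M.fac j) * M.entry g k j t (v + r) (s + r) else 0)
      (if i = k then f (p * M.fac j) *
        (-(M.hx (alphaBar ((k : ℤ) + (j : ℤ))) s * g (t - v))) else 0) 0 := by
    simp only [add_sub_add_right_eq_sub]
    split_ifs
    · exact ((M.hasDerivAt_entry_char k j t hg v s).const_mul _).const_add _
    · exact (hasDerivAt_const _ _).const_add _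
    · exact ((M.hasDerivAt_entry_char k j t hg v s).const_mul _).const_add _
    · exact (hasDerivAt_const _ _).const_add _
  refine (h1.mul h2).congr_deriv ?_
  simp only [testD, test, add_zero]
  split_ifs <;> ring

lemma entry_nonneg (hg0 : ∀ x, 0 ≤ g x) {v s : ℝ} (hvt : v ≤ t) (hs : 0 ≤ s) :
    0 ≤ M.entry g k j t v s := by
  refine intervalIntegral.integral_nonneg hvt fun r hr => mul_nonneg ?_ (hg0 _)
  have : 0 ≤ s - v + r := by linarith [hr.1]
  rw [M.hx_eq _ this]
  exact M.h_nonneg _ _ this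

lemma test_nonneg (hf0 : ∀ x, 0 ≤ f x) (hg0 : ∀ x, 0 ≤ g x) {v p : ℝ} (hvt : v ≤ t) (i : State)
    {s : ℝ} (hs : 0 ≤ s) : 0 ≤ M.test f g k j t v p i s := by
  have h1 := M.entry_nonneg k j t hg0 hvt hs
  refine mul_nonneg (Real.exp_pos _).le (add_nonneg ?_ ?_)
  · split_ifs
    · exact mul_nonneg (hf0 _) (hg0 _)
    · exact le_rfl
  · split_ifs
    · exact mul_nonneg (hf0 _) h1
    · exact le_rfl

lemma test_growthBound {t : ℝ≥0} {B : ℝ} (hf0 : ∀ x, 0 ≤ f x) (hg0 : ∀ x, 0 ≤ g x)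
    (hfB : ∀ x, f x ≤ B) (hgB : ∀ x, g x ≤ B) :
    GrowthBound (M.test f g k j t) t (B * B + B * (M.hBound * B * t)) 0 := by
  intro v p i s hv hp hs
  have hB : 0 ≤ B := (hf0 0).trans (hfB 0)
  have hc := M.hBound_nonneg
  have he := M.entry_nonneg k j t hg0 hv.2 hs
  have heB : M.entry g k j t v s ≤ M.hBound * B * t := by
    refine (le_abs_self _).trans ?_
    have h1 : ∀ r ∈ uIoc v (t : ℝ),
        ‖M.hx (alphaBar ((k : ℤ) + (j : ℤ))) (s - v + r) * g (t - r)‖ ≤ M.hBound * B := by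
      intro r hr
      rw [uIoc_of_le hv.2] at hr
      have h0 : 0 ≤ s - v + r := by linarith [hr.1]
      rw [M.hx_eq _ h0, Real.norm_of_nonneg (mul_nonneg (M.h_nonneg _ _ h0) (hg0 _))]
      exact mul_le_mul (M.h_le_hBound _ h0) (hgB _) (hg0 _) hc
    have h2 := intervalIntegral.norm_integral_le_of_norm_le_const h1
    refine h2.trans (mul_le_mul_of_nonneg_left ?_ (mul_nonneg hc hB))
    rw [abs_of_nonneg (by linarith [hv.2])]
    linarith [hv.1]
  rw [abs_of_nonneg (M.test_nonneg k j t hf0 hg0 hv.2 i hs), zero_mul, add_zero, mul_one]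
  have hexp : Real.exp (-(2 * M.hBound * ((t : ℝ) - v))) ≤ 1 := by
    rw [Real.exp_le_one_iff, neg_nonpos]
    exact mul_nonneg (by positivity) (by linarith [hv.2])
  have ha : 0 ≤ (if i = j then f p * g (s - v + t) else 0) ∧
      (if i = j then f p * g (s - v + t) else 0) ≤ B * B := by
    split_ifs
    · exact ⟨mul_nonneg (hf0 _) (hg0 _), mul_le_mul (hfB _) (hgB _) (hg0 _) hB⟩
    · exact ⟨le_rfl, by positivity⟩
  have hb : 0 ≤ (if i = k then f (p * M.fac j) * M.entry g k j t v s else 0) ∧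
      (if i = k then f (p * M.fac j) * M.entry g k j t v s else 0) ≤
        B * (M.hBound * B * t) := by
    split_ifs
    · exact ⟨mul_nonneg (hf0 _) he, mul_le_mul (hfB _) heB he hB⟩
    · exact ⟨le_rfl, by positivity⟩
  exact (mul_le_of_le_one_left (add_nonneg ha.1 hb.1) hexp).trans (add_le_add ha.2 hb.2)

/-- The generator is non-negative on the test function: the exponential factor pays for the jumps
that leave the test function, and the inflow into `j` cancels the derivative of `entry`. -/
lemma testD_add_jumpTerm_nonneg (hf0 : ∀ x, 0 ≤ f x) (hg0 : ∀ x, 0 ≤ g x)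
    (hkj : ¬ SameBlock k j) {v p s : ℝ} (hvt : v ≤ t) (i : State) (hs : 0 ≤ s) :
    0 ≤ M.testD f g k j t v p i s + jumpTerm M (M.test f g k j t) v p i s := by
  have hnn : ∀ l : State, 0 ≤ M.hij i l s *
      M.test f g k j t v (p * (1 + M.δ * alpha (l : ℤ))) l 0 :=
    fun l => mul_nonneg (M.hij_nonneg i l hs) (M.test_nonneg k j t hf0 hg0 hvt l le_rfl)
  have hin : Real.exp (-(2 * M.hBound * (t - v))) * (if i = k then
      f (p * M.fac j) * (M.hx (alphaBar ((k : ℤ) + (j : ℤ))) s * g (t - v)) else 0) ≤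
      ∑ l : State with ¬ SameBlock i l,
        M.hij i l s * M.test f g k j t v (p * (1 + M.δ * alpha (l : ℤ))) l 0 := by
    split_ifs with hik
    · subst hik
      refine le_trans ?_ (Finset.single_le_sum (fun l _ => hnn l)
        (Finset.mem_filter.2 ⟨Finset.mem_univ j, hkj⟩))
      have hne : j ≠ i := fun h => hkj (by rw [h])
      rw [test, if_pos rfl, if_neg hne, M.hx_eq _ hs, hij, fac, add_zero, zero_sub, neg_add_eq_sub]
      exact le_of_eq (by ring)
    · rw [mul_zero]
      exact Finset.sum_nonneg fun l _ => hnn l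
  have hout : (∑ l : State with ¬ SameBlock i l, M.hij i l s) * M.test f g k j t v p i s ≤
      2 * M.hBound * M.test f g k j t v p i s := by
    refine mul_le_mul_of_nonneg_right ?_ (M.test_nonneg k j t hf0 hg0 hvt i hs)
    rw [M.sum_hij]
    linarith [M.h_le_hBound Sgn.plus hs, M.h_le_hBound Sgn.minus hs]
  simp only [jumpTerm, mul_sub, Finset.sum_sub_distrib]
  rw [← Finset.sum_mul, testD]
  linarith

/-- An age `s₀ ≥ t` at time `t` is reached without a jump from the age `s₀ - t` at time zero; an age
`s₀ < t` is reached by a jump at time `t - s₀`, out of a state that had age zero at time zero. -/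
lemma exists_test_pos (hg : Continuous g) (hg0 : ∀ x, 0 ≤ g x) {p₀ s₀ : ℝ}
    (hp₀ : 0 ≤ p₀) (hs₀ : 0 ≤ s₀) (hf₀ : 0 < f p₀) (hg₀ : 0 < g s₀) (j : State) (t : ℝ) :
    ∃ k, ¬ SameBlock k j ∧ ∃ p i s, 0 ≤ p ∧ 0 ≤ s ∧ 0 < M.test f g k j t 0 p i s := by
  rcases le_or_gt t s₀ with hts | hts
  · obtain ⟨k, hkj, -⟩ := M.exists_source j le_rfl
    have hne : j ≠ k := fun h => hkj (by rw [h])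
    refine ⟨k, hkj, p₀, j, s₀ - t, hp₀, by linarith, ?_⟩
    rw [test, if_pos rfl, if_neg hne, sub_zero, sub_zero, sub_add_cancel, add_zero]
    positivity
  · obtain ⟨k, hkj, hpos⟩ := M.exists_source j (sub_nonneg.2 hts.le)
    have hne : k ≠ j := fun h => hkj (by rw [h])
    have hfac := M.fac_pos j
    refine ⟨k, hkj, p₀ / M.fac j, k, 0, by positivity, le_rfl, ?_⟩
    have h1 : 0 < M.entry g k j t 0 0 := by
      have hc : Continuous fun r =>
          M.hx (alphaBar ((k : ℤ) + (j : ℤ))) (0 - 0 + r) * g (t - r) := by fun_prop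
      refine intervalIntegral.integral_pos (hs₀.trans_lt hts) hc.continuousOn (fun r hr => ?_)
        ⟨t - s₀, ⟨by linarith, by linarith⟩, ?_⟩
      · rw [sub_zero, zero_add, M.hx_eq _ hr.1.le]
        exact mul_nonneg (M.h_nonneg _ _ hr.1.le) (hg0 _)
      · rw [sub_zero, zero_add, sub_sub_cancel, M.hx_eq _ (by linarith)]
        exact mul_pos hpos hg₀
    rw [test, if_neg hne, if_pos rfl, div_mul_cancel₀ _ hfac.ne', zero_add]
    positivity

end Model

end

section

/-! ### The laws of the solution have full support -/

variable {Ω : Type*} [mΩ : MeasurableSpace Ω] {μ : Measure Ω}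

lemma IsInitialCondition.measure_ne_zero {P₀ : Ω → ℝ≥0} {I₀ : Ω → State} {S₀ : Ω → ℝ≥0}
    (h : IsInitialCondition μ P₀ I₀ S₀) (hP : Measurable P₀) (hI : Measurable I₀)
    (hS : Measurable S₀) {U : Set (ℝ≥0 × State × ℝ≥0)} (hU : IsOpen U) (hne : U.Nonempty) :
    μ ((fun ω => (P₀ ω, I₀ ω, S₀ ω)) ⁻¹' U) ≠ 0 := by
  obtain ⟨⟨p, i, s⟩, hx⟩ := hne
  obtain ⟨A, V, hA, hV, hpA, hiV, hAV⟩ := isOpen_prod_iff.1 hU p (i, s) hx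
  obtain ⟨B, C, hB, hC, hiB, hsC, hBC⟩ := isOpen_prod_iff.1 hV i s hiV
  have hA0 : μ (P₀ ⁻¹' A) ≠ 0 := by
    rw [← Measure.map_apply hP hA.measurableSet]
    exact h.support_P.open_pos A hA ⟨p, hpA⟩
  have hB0 : μ (I₀ ⁻¹' B) ≠ 0 := by
    rw [← Measure.map_apply hI hB.measurableSet]
    exact h.support_I.open_pos B hB ⟨i, hiB⟩
  have hC0 : μ (S₀ ⁻¹' C) ≠ 0 := by
    rw [← Measure.map_apply hS hC.measurableSet]
    exact h.support_S.open_pos C hC ⟨s, hsC⟩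
  have hind := h.indep.meas_iInter (s := ![P₀ ⁻¹' A, I₀ ⁻¹' B, S₀ ⁻¹' C]) fun k => by
    fin_cases k
    · exact ⟨A, hA.measurableSet, rfl⟩
    · exact ⟨B, hB.measurableSet, rfl⟩
    · exact ⟨C, hC.measurableSet, rfl⟩
  have hsub : ⋂ k, (![P₀ ⁻¹' A, I₀ ⁻¹' B, S₀ ⁻¹' C] : Fin 3 → Set Ω) k ⊆
      (fun ω => (P₀ ω, I₀ ω, S₀ ω)) ⁻¹' U := fun ω hω => by
    rw [mem_iInter] at hω
    exact hAV ⟨hω 0, hBC ⟨hω 1, hω 2⟩⟩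
  intro h0
  have := measure_mono_null hsub h0
  rw [hind, Fin.prod_univ_three] at this
  exact mul_ne_zero (mul_ne_zero hA0 hB0) hC0 this

/-- A continuous bump that is positive exactly on `(x₀ - ε, x₀ + ε)`. -/
def bump (x₀ ε x : ℝ) : ℝ := max (ε - |x - x₀|) 0

lemma continuous_bump (x₀ ε : ℝ) : Continuous (bump x₀ ε) := by
  unfold bump
  fun_prop

lemma bump_nonneg (x₀ ε x : ℝ) : 0 ≤ bump x₀ ε x := le_max_right _ _

lemma bump_le (x₀ : ℝ) {ε : ℝ} (hε : 0 ≤ ε) (x : ℝ) : bump x₀ ε x ≤ ε :=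
  max_le (by linarith [abs_nonneg (x - x₀)]) hε

lemma bump_pos_iff {x₀ ε x : ℝ} : 0 < bump x₀ ε x ↔ |x - x₀| < ε := by
  simp [bump]

namespace IsSolution

variable {M : Model} {ℱ : Filtration ℝ≥0 mΩ} {N : Ω → Measure (ℝ≥0 × ℝ)}
  {P : ℝ≥0 → Ω → ℝ≥0} {I : ℝ≥0 → Ω → State} {S : ℝ≥0 → Ω → ℝ≥0} [IsProbabilityMeasure μ]

/-- The law of `(P_t, I_t, S_t)` charges every non-empty open set. -/
theorem measure_ne_zero (hN : IsPoissonRandomMeasure μ ℱ N) (hsol : IsSolution M μ ℱ N P I S)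
    (hinit : IsInitialCondition μ (P 0) (I 0) (S 0)) (t : ℝ≥0)
    {U : Set (ℝ≥0 × State × ℝ≥0)} (hU : IsOpen U) (hne : U.Nonempty) :
    μ ((fun ω => (P t ω, I t ω, S t ω)) ⁻¹' U) ≠ 0 := by
  obtain ⟨⟨p₀, j, s₀⟩, hx⟩ := hne
  obtain ⟨ε, hε, hball⟩ := Metric.isOpen_iff.1 hU _ hx
  have hf := continuous_bump p₀ ε
  have hg := continuous_bump s₀ ε
  obtain ⟨k, hkj, p, i, s, hp, hs, hpos⟩ := M.exists_test_pos hg (bump_nonneg s₀ ε)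
    (f := bump p₀ ε) (p₀ := p₀) (s₀ := s₀) p₀.2 s₀.2 (by simpa [bump] using hε)
    (by simpa [bump] using hε) j t
  set φ := M.test (bump p₀ ε) (bump s₀ ε) k j t with hφ
  have hφc : Continuous fun x : ℝ × ℝ × State × ℝ => φ x.1 x.2.1 x.2.2.1 x.2.2.2 :=
    M.continuous_test k j t hf hg
  have hbd : GrowthBound φ t _ 0 := M.test_growthBound k j (bump_nonneg p₀ ε) (bump_nonneg s₀ ε)
    (bump_le p₀ hε.le) (bump_le s₀ hε.le)
  have hc := M.hBound_nonneg
  have hC : 0 ≤ ε * ε + ε * (M.hBound * ε * t) := by positivity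
  have hK : ∀ r ≤ t, ∫⁻ ω, ENNReal.ofReal (1 + 0 * P r ω) ∂μ ≤ 1 := fun r _ => by simp
  have hle := hsol.setIntegral_le_setIntegral hN hφc.measurable
    (M.continuous_testD k j t hf hg) (M.hasDerivAt_test_char k j t hg) hbd hC le_rfl
    ENNReal.one_ne_top hK zero_le MeasurableSet.univ (fun v hv p i s _ hs =>
      M.testD_add_jumpTerm_nonneg k j t (bump_nonneg p₀ ε) (bump_nonneg s₀ ε) hkj hv.2 i hs)
  simp only [Measure.restrict_univ] at hle
  have hnn : ∀ r ≤ t, ∀ ω, 0 ≤ φ r (P r ω) (I r ω) (S r ω) := fun r hr ω =>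
    M.test_nonneg k j t (bump_nonneg p₀ ε) (bump_nonneg s₀ ε) (by exact_mod_cast hr) _
      (NNReal.coe_nonneg _)
  have hpos0 : 0 < ∫ ω, φ ((0 : ℝ≥0) : ℝ) (P 0 ω) (I 0 ω) (S 0 ω) ∂μ := by
    rw [integral_pos_iff_support_of_nonneg (hnn 0 zero_le)
      (hsol.integrable_state hφc.measurable hbd hC ENNReal.one_ne_top hK zero_le), pos_iff_ne_zero]
    have hc0 : Continuous fun x : ℝ≥0 × State × ℝ≥0 => φ ((0 : ℝ≥0) : ℝ) x.1 x.2.1 x.2.2 :=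
      hφc.comp (by fun_prop : Continuous fun x : ℝ≥0 × State × ℝ≥0 =>
        (((0 : ℝ≥0) : ℝ), (x.1 : ℝ), x.2.1, (x.2.2 : ℝ)))
    exact hinit.measure_ne_zero (hsol.measurable_P 0) (hsol.measurable_I 0) (hsol.measurable_S 0)
      (isOpen_ne_fun hc0 continuous_const) ⟨(⟨p, hp⟩, i, ⟨s, hs⟩), hpos.ne'⟩
  -- at time `t` the test function is positive only near `(p₀, j, s₀)`
  have hpost := hpos0.trans_le hle
  rw [integral_pos_iff_support_of_nonneg (hnn t le_rfl)
    (hsol.integrable_state hφc.measurable hbd hC ENNReal.one_ne_top hK le_rfl)] at hpost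
  refine fun h0 => hpost.ne' (measure_mono_null (fun ω hω => hball ?_) h0)
  have hω' : φ t (P t ω) (I t ω) (S t ω) ≠ 0 := hω
  have he : M.entry (bump s₀ ε) k j t t (S t ω) = 0 := intervalIntegral.integral_same
  rw [hφ, Model.test, he, mul_zero, ite_self, add_zero, sub_add_cancel] at hω'
  have h1 : (if I t ω = j then bump p₀ ε (P t ω) * bump s₀ ε (S t ω) else 0) ≠ 0 :=
    right_ne_zero_of_mul hω'
  have hj : I t ω = j := by
    by_contra hj
    exact h1 (if_neg hj)
  rw [if_pos hj] at h1
  have hP := (bump_nonneg _ _ _).lt_of_ne' (left_ne_zero_of_mul h1)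
  have hS := (bump_nonneg _ _ _).lt_of_ne' (right_ne_zero_of_mul h1)
  rw [bump_pos_iff] at hP hS
  rw [hj, Metric.mem_ball, Prod.dist_eq, Prod.dist_eq, dist_self, NNReal.dist_eq, NNReal.dist_eq]
  exact max_lt hP (max_lt hε hS)

/-- The conditional expectation has at most one continuous version. -/
theorem eqOnDomain_of_isCondExpVersion (hN : IsPoissonRandomMeasure μ ℱ N)
    (hsol : IsSolution M μ ℱ N P I S) (hinit : IsInitialCondition μ (P 0) (I 0) (S 0)) {T : ℝ≥0}
    {φ ψ : ℝ → ℝ → State → ℝ → ℝ} (hφc : ContOn φ (domain T)) (hψc : ContOn ψ (domain T))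
    (hφ : IsCondExpVersion μ T P I S φ) (hψ : IsCondExpVersion μ T P I S ψ) :
    EqOnDomain T φ ψ := by
  rintro t p i s ⟨ht, hp, hs⟩
  by_contra hne
  lift t to ℝ≥0 using ht.1
  have hcont : ∀ {χ : ℝ → ℝ → State → ℝ → ℝ}, ContOn χ (domain T) →
      Continuous fun x : ℝ≥0 × State × ℝ≥0 => χ t x.1 x.2.1 x.2.2 := fun hχ =>
    ContinuousOn.comp_continuous hχ (by fun_prop : Continuous fun x : ℝ≥0 × State × ℝ≥0 =>
      ((t : ℝ), (x.1 : ℝ), x.2.1, (x.2.2 : ℝ)))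
      fun x => ⟨ht, NNReal.coe_nonneg _, NNReal.coe_nonneg _⟩
  refine hsol.measure_ne_zero hN hinit t (isOpen_ne_fun (hcont hφc) (hcont hψc))
    ⟨(⟨p, hp⟩, i, ⟨s, hs⟩), hne⟩ ?_
  have htT : t ≤ T := by exact_mod_cast ht.2
  exact (hφ t htT).trans (hψ t htT).symm

end IsSolution

end

end TickPrice

end

theorem corollary3p1 {Ω : Type*} [mΩ : MeasurableSpace Ω] (μ : Measure Ω) [IsProbabilityMeasure μ]
    (ℱ : Filtration ℝ≥0 mΩ) (N : Ω → Measure (ℝ≥0 × ℝ))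
    (hN : TickPrice.IsPoissonRandomMeasure μ ℱ N) (M : TickPrice.Model)
    (P : ℝ≥0 → Ω → ℝ≥0) (I : ℝ≥0 → Ω → TickPrice.State) (S : ℝ≥0 → Ω → ℝ≥0)
    (hsol : TickPrice.IsSolution M μ ℱ N P I S)
    (hinit : TickPrice.IsInitialCondition μ (P 0) (I 0) (S 0))
    (T : ℝ≥0) (hT : 0 < T) :
    Integrable (fun ω => (P T ω : ℝ)) μ ∧
    ∃ π : ℝ → ℝ → TickPrice.State → ℝ → ℝ,
      -- `π` is the continuous version of the conditional expectation, and the only one on `𝒟`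
      TickPrice.IsCondExpVersion μ T P I S π ∧
      (∀ φ : ℝ → ℝ → TickPrice.State → ℝ → ℝ, TickPrice.ContOn φ (TickPrice.domain T) →
        TickPrice.IsCondExpVersion μ T P I S φ → TickPrice.EqOnDomain T φ π) ∧
      -- regularity
      TickPrice.InV T π ∧
      TickPrice.IsC11 T π (TickPrice.domain T) ∧
      -- `π` solves the terminal value problem, up to the boundary of `𝒟`
      TickPrice.SolvesPDE M T π (TickPrice.domain T) ∧
      TickPrice.TerminalCondition T π ∧
      -- uniqueness of classical solutions
      (∀ φ : ℝ → ℝ → TickPrice.State → ℝ → ℝ, TickPrice.InV T φ →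
        TickPrice.IsC11 T φ (TickPrice.openDomain T) →
        TickPrice.SolvesPDE M T φ (TickPrice.openDomain T) →
        TickPrice.TerminalCondition T φ → TickPrice.EqOnDomain T φ π) ∧
      -- uniqueness in the larger class where only the derivative along `(1, 1)` has to exist
      (∀ φ : ℝ → ℝ → TickPrice.State → ℝ → ℝ, TickPrice.InV T φ →
        TickPrice.SolvesPDEAlongCharacteristics M T φ →
        TickPrice.TerminalCondition T φ → TickPrice.EqOnDomain T φ π) := by
  have hce := hsol.isCondExpVersion_price hN hinit.integrable T
  refine ⟨hsol.integrable_price hN hinit.integrable T, M.price T, hce, fun φ hφ hφce =>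
    hsol.eqOnDomain_of_isCondExpVersion hN hinit hφ (M.price_inV T).1 hφce hce, M.price_inV T,
    M.price_isC11 hT, M.price_solvesPDE hT, fun p i s _ _ => M.price_terminal T p i s,
    fun φ hV hC hφ hterm => ?_, fun φ hV hφ hterm => ?_⟩
  · exact TickPrice.eqOnDomain_price_of_characteristics M hV (hφ.alongCharacteristics hC) hterm
  · exact TickPrice.eqOnDomain_price_of_characteristics M hV hφ hterm
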